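/- Let $\mu_2=\mu*\mu$, i.e. $\mu_2(n)=\sum_{d\mid n}\mu(d)\mu(n/d)$, so that $\sum_{n\ge1}\mu_2(n)n^{-s}=\zeta(s)^{-2}$ for $\Re(s)>1$. Let $K_0(z)=\int_0^\infty e^{-z\cosh t}\,dt$ $(\Re z>0)$ be the modified Bessel function of the second kind of order $0$; square roots, logarithms and powers are principal. The non-trivial zeros $\rho$ of $\zeta$ are those with $0<\Re(\rho)<1$, and for such $\rho$ and $x\neq0$, $|\operatorname{Arg}x|<\pi/2$, put $$R_\rho(x)=\lim_{s\to\rho}\frac{d}{ds}\Big((s-\rho)^2\,\Gamma\big(\tfrac s2\big)^2\,\zeta(1-s)^{-2}\,(\pi\sqrt x)^{-s}\Big),\qquad \sum_\rho R_\rho(x)=\lim_{T\to\infty}\sum_{|\Im\rho|\le T}R_\rho(x).$$ Assume that all non-trivial zeros of $\zeta$ are simple and that $\sum_\rho R_\rho(x)$ converges for every real $x>0$. Then for every $x\ne0$ with $|\operatorname{Arg}x|<\pi/2$ the series $$\sum_{n=1}^{\infty}\frac{\mu_2(n)}{n}\Big[K_0\Big(\frac{2\pi\sqrt x}{n}\Big)+\log\Big(\frac{\pi\sqrt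 x}{n}\Big)\Big]$$ converges (as the limit of its partial sums). Put $$U_{\mathbb Q,-2}(x)=4\sum_{n=1}^{\infty}\frac{\mu_2(n)}{n}\Big[K_0\Big(\frac{2\pi\sqrt x}{n}\Big)+\log\Big(\frac{\pi\sqrt x}{n}\Big)\Big]+\frac12\sum_\rho R_\rho(x).$$ The following two statements are equivalent. (i) The functional equation of $\zeta^{-2}$: with $\Lambda(s)=\pi^{-s/2}\Gamma(s/2)\,\zeta(1-s)^{-1}$, one has $\Lambda(s)^2=\Lambda(1-s)^2$ for all $s\in\mathbb C$ at which none of $\Gamma(\frac s2)$, $\Gamma(\frac{1-s}2)$, $\zeta(s)^{-1}$, $\zeta(1-s)^{-1}$ has a pole and $s\ne 0,1$. (ii) The theta relation $U_{\mathbb Q,-2}(1/x)=\sqrt x\,U_{\mathbb Q,-2}(x)$ holds for all $x\ne0$ with $|\operatorname{Arg}x|<\pi/2$ for which $\sum_\rho R_\rho(x)$ and $\sum_\rho R_\rho(1/x)$ converge (in particular for all real $x>0$). -/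

import Mathlib

open Filter Topology

namespace ZetaInvSq

/-- Principal square root. -/
noncomputable def csqrt (x : ℂ) : ℂ := x ^ (1 / 2 : ℂ)

/-- The generalized Moebius function `μ₂ = μ * μ` (Dirichlet convolution), that is, the coefficients
of the Dirichlet series of `1 / ζ(s)²`; see `LSeries_mobius₂`. -/
def mobius₂ : ArithmeticFunction ℤ := ArithmeticFunction.moebius * ArithmeticFunction.moebius

/-- `∑ μ₂(n) / n ^ s = 1 / ζ(s)²` for `Re s > 1`. -/
theorem LSeries_mobius₂ {s : ℂ} (hs : 1 < s.re) :
    LSeriesSummable (fun n => (mobius₂ n : ℂ)) s ∧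
      LSeries (fun n => (mobius₂ n : ℂ)) s = (riemannZeta s ^ 2)⁻¹ := by
  have hμ := ArithmeticFunction.LSeriesSummable_moebius_iff.mpr hs
  have h1 := LSeries_one_mul_Lseries_moebius hs
  rw [LSeries_one_eq_riemannZeta hs] at h1
  have hz := riemannZeta_ne_zero_of_one_lt_re hs
  have e : (fun n => (mobius₂ n : ℂ)) =
      fun n => ((ArithmeticFunction.moebius : ArithmeticFunction ℂ) *
        (ArithmeticFunction.moebius : ArithmeticFunction ℂ)) n := by
    funext n
    rw [← ArithmeticFunction.intCoe_mul]
    simp [mobius₂]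
  rw [e]
  refine ⟨ArithmeticFunction.LSeriesSummable_mul (by simpa using hμ) (by simpa using hμ), ?_⟩
  rw [ArithmeticFunction.LSeries_mul' (by simpa using hμ) (by simpa using hμ)]
  have h2 : LSeries (fun n => (ArithmeticFunction.moebius : ArithmeticFunction ℂ) n) s
      = (riemannZeta s)⁻¹ := by
    refine eq_inv_of_mul_eq_one_right ?_
    simpa using h1
  rw [h2, ← inv_pow, sq]

/-- Modified Bessel function of the second kind of order zero, `K₀(z) = ∫₀^∞ exp(-z cosh t) dt`,
for `Re z > 0`. -/
noncomputable def besselK0 (z : ℂ) : ℂ :=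
  ∫ t in Set.Ioi (0 : ℝ), Complex.exp (-z * (Real.cosh t : ℂ))

/-- The partial sum over `1 ≤ n ≤ N` of
`∑ μ₂(n) / n * (K₀(2π√x / n) + log(π√x / n))`. -/
noncomputable def mobiusPartialSum (x : ℂ) (N : ℕ) : ℂ :=
  ∑ n ∈ Finset.Icc 1 N, (mobius₂ n : ℂ) / (n : ℂ) *
    (besselK0 (2 * Real.pi * csqrt x / n) + Complex.log (Real.pi * csqrt x / n))

/-- Convergence of the series over `n` as the limit of its partial sums (the series need not
converge absolutely). -/
def MobiusSeriesConverges (x : ℂ) : Prop :=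
  ∃ S : ℂ, Tendsto (mobiusPartialSum x) atTop (𝓝 S)

/-- The value of the series over `n`. -/
noncomputable def mobiusSeries (x : ℂ) : ℂ := limUnder atTop (mobiusPartialSum x)

/-- The non-trivial zeros of `ζ`. -/
def nontrivialZeros : Set ℂ := {ρ | riemannZeta ρ = 0 ∧ 0 < ρ.re ∧ ρ.re < 1}

theorem finite_nontrivialZeros_le (T : ℝ) :
    {ρ | ρ ∈ nontrivialZeros ∧ |ρ.im| ≤ T}.Finite := by
  have hc : IsCompact (Set.Icc (0 : ℝ) 1 ×ℂ Set.Icc (-T) T) := isCompact_Icc.reProdIm isCompact_Icc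
  refine hc.inter_riemannZetaZeros_finite.subset ?_
  rintro ρ ⟨⟨h0, h1, h2⟩, h3⟩
  exact ⟨Complex.mem_reProdIm.mpr ⟨⟨h1.le, h2.le⟩, abs_le.mp h3⟩, h0⟩

/-- The finite set of non-trivial zeros `ρ` with `|Im ρ| ≤ T`. -/
noncomputable def zerosUpTo (T : ℝ) : Finset ℂ := (finite_nontrivialZeros_le T).toFinset

/-- `R_ρ(x) = lim_{s → ρ} d/ds ((s - ρ)² Γ(s/2)² ζ(1-s)⁻² (π√x)^(-s))`. -/
noncomputable def residueTerm (ρ x : ℂ) : ℂ :=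
  limUnder (𝓝[≠] ρ) (deriv fun s : ℂ =>
    (s - ρ) ^ 2 * Complex.Gamma (s / 2) ^ 2 * (riemannZeta (1 - s) ^ 2)⁻¹ *
      (Real.pi * csqrt x) ^ (-s))

noncomputable def zeroPartialSum (x : ℂ) (T : ℝ) : ℂ := ∑ ρ ∈ zerosUpTo T, residueTerm ρ x

/-- Convergence of `∑_ρ R_ρ(x)`, the zeros being ordered by the absolute value of their imaginary
part. -/
def ZeroSeriesConverges (x : ℂ) : Prop :=
  ∃ S : ℂ, Tendsto (zeroPartialSum x) atTop (𝓝 S)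

/-- The value of `∑_ρ R_ρ(x)`. -/
noncomputable def zeroSeries (x : ℂ) : ℂ := limUnder atTop (zeroPartialSum x)

/-- `U(x) = 4 ∑ μ₂(n) / n * (K₀(2π√x / n) + log(π√x / n)) + (1/2) ∑_ρ R_ρ(x)`. -/
noncomputable def U (x : ℂ) : ℂ := 4 * mobiusSeries x + 1 / 2 * zeroSeries x

/-- `Λ(s) = π^(-s/2) Γ(s/2) / ζ(1-s)`. -/
noncomputable def Lam (s : ℂ) : ℂ :=
  (Real.pi : ℂ) ^ (-s / 2) * Complex.Gamma (s / 2) * (riemannZeta (1 - s))⁻¹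

/-- The functional equation of `ζ⁻²`: `Λ(s)² = Λ(1-s)²`, at all points where none of the factors
`Γ(s/2)`, `Γ((1-s)/2)`, `1/ζ(s)`, `1/ζ(1-s)` is singular. -/
def FunctionalEquation : Prop :=
  ∀ s : ℂ, (∀ m : ℕ, s / 2 ≠ -m) → (∀ m : ℕ, (1 - s) / 2 ≠ -m) →
    riemannZeta s ≠ 0 → riemannZeta (1 - s) ≠ 0 → Lam s ^ 2 = Lam (1 - s) ^ 2

/-- The theta relation `U(1/x) = √x U(x)` for `|Arg x| < π/2`, at every such `x` for which the
series over the zeros occurring in `U(x)` and `U(1/x)` converge. -/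
def ThetaRelation : Prop :=
  ∀ x : ℂ, x ≠ 0 → |x.arg| < Real.pi / 2 →
    ZeroSeriesConverges x → ZeroSeriesConverges (1 / x) → U (1 / x) = csqrt x * U x

end ZetaInvSq

/-! Statement (i) is a theorem: it is the classical functional equation of ζ, inverted and squared
(`functionalEquation`). So (ii) implies (i) at once, and the content is the derivation of (ii) from
(i), together with the convergence of the series over n.

Write M(x) for four times the series over n, and k_x(s) = Γ(s/2)² ζ(1-s)⁻² (π√x)^(-s) = Λ(s)²
(√x)^(-s) (`kernel`). The Mellin–Barnes formula expresses K₀(2v) as an integral of Γ(s/2)² v^(-s)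
over a line Re s > 0. Moving the line to Re s = -1/2 crosses the double pole at 0, whose residue
yields -log v and the constant Γ'(1). With v = π√x/n and weights μ₂(n)/n, the integrals add up to
one integral of k_x, because ζ(1-s)⁻² has an absolutely convergent Dirichlet series on that line.
The constants add up to Γ'(1) ∑ μ₂(n)/n = 0. Hence 2πi M(x) is the integral of k_x over Re s = -1/2
(`tendsto_mobiusPartialSum`, `four_mul_mobiusSeries`).

The functional equation gives k_x(1-s) = x^(-1/2) k_{1/x}(s), so the integral of k_x over Re s = 3/2
is 2πi x^(-1/2) M(1/x). Between the two lines k_x is regular except for double poles at the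
non-trivial zeros: at 0 the double pole of Γ(s/2)² cancels the double zero of ζ(1-s)⁻². The residue
theorem therefore gives ∑ R_ρ(x) = x^(-1/2) M(1/x) - M(x) (`zeroSeries_eq`), whence U(x) = (M(x) +
x^(-1/2) M(1/x))/2. The theta relation is visible in this form.

Two analytic inputs carry the argument.

The vanishing of ∑ μ₂(n)/n (`tendsto_sum_mobius₂_div`) has the depth of the prime number theorem. A
quantitative 3-4-1 argument bounds ζ from below on Re s ≥ 1. So 1/(sζ(1+s))² and its derivative are
integrable on the imaginary axis, and Riemann–Lebesgue shows that the first Riesz mean of ∑ μ₂(n)/n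
at e^v is o(1/v). A difference quotient, with the divisor function controlled on short intervals,
passes from the Riesz mean to the partial sums.

To discard the horizontal sides of the contour one needs arbitrarily large heights T at which |ζ| ≥
e^(-εT) for 1/2 ≤ Re s ≤ 3/2 (`exists_norm_riemannZeta_ge`). These come from dividing out the zeros
near 2 + iT, applying Borel–Carathéodory to what remains, and choosing the height away from the
zeros. A sequence of heights suffices because ∑ R_ρ(x) is assumed to converge. -/

/-! ### Euler–Maclaurin formula and polynomial growth of ζ in Re s > 0 -/

namespace ZetaInvSq

/-- The `n`-th Euler–Maclaurin error term, multiplied by `s - 1`. -/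
noncomputable def emTerm (n : ℕ) (s : ℂ) : ℂ :=
  (s - 1) * ((n + 1 : ℕ) : ℂ) ^ (-s) + ((n : ℂ) ^ (1 - s) - ((n + 1 : ℕ) : ℂ) ^ (1 - s)) * (-1)

lemma norm_cpow_neg_sub_le {s : ℂ} (hs : 0 < s.re) {n : ℝ} (hn : 0 < n) {u v : ℝ}
    (hu : u ∈ Set.Icc n (n + 1)) (hv : v ∈ Set.Icc n (n + 1)) :
    ‖(u : ℂ) ^ (-s) - (v : ℂ) ^ (-s)‖ ≤ ‖s‖ * n ^ (-s.re - 1) := by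
  have hs0 : -s ≠ 0 := fun h => by simp_all
  have hder : ∀ x ∈ Set.Icc n (n + 1), HasDerivWithinAt (fun y : ℝ => (y : ℂ) ^ (-s))
      (-s * (x : ℂ) ^ (-s - 1)) (Set.Icc n (n + 1)) x := fun x hx =>
    (hasDerivAt_ofReal_cpow_const (hn.trans_le hx.1).ne' hs0).hasDerivWithinAt
  have hb : ∀ x ∈ Set.Icc n (n + 1), ‖-s * (x : ℂ) ^ (-s - 1)‖ ≤ ‖s‖ * n ^ (-s.re - 1) := by
    intro x hx
    rw [norm_mul, norm_neg, Complex.norm_cpow_eq_rpow_re_of_pos (hn.trans_le hx.1)]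
    simp only [Complex.sub_re, Complex.neg_re, Complex.one_re]
    exact mul_le_mul_of_nonneg_left (Real.rpow_le_rpow_of_nonpos hn hx.1 (by linarith))
      (norm_nonneg _)
  refine ((convex_Icc n (n + 1)).norm_image_sub_le_of_norm_hasDerivWithin_le hder hb hv hu).trans ?_
  have h1 : ‖u - v‖ ≤ 1 := by
    rw [Real.norm_eq_abs, abs_le]; constructor <;> linarith [hu.1, hu.2, hv.1, hv.2]
  have : 0 ≤ ‖s‖ * n ^ (-s.re - 1) := by positivity
  nlinarith

/-- The term is the increment over [n, n+1] of ψ(u) = u^(1-s) + (s-1)(n+1)^(-s) u. Since ψ' is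
(s-1)((n+1)^(-s) - u^(-s)), the mean value inequality applies, once to ψ and once to the power
u^(-s). -/
lemma norm_emTerm_le {s : ℂ} (hs : 0 < s.re) {n : ℕ} (hn : 0 < n) :
    ‖emTerm n s‖ ≤ ‖s - 1‖ * (‖s‖ * (n : ℝ) ^ (-s.re - 1)) := by
  have hn' : (0 : ℝ) < n := by exact_mod_cast hn
  rcases eq_or_ne s 1 with rfl | h1
  · simp [emTerm]
  set ψ : ℝ → ℂ := fun u => (u : ℂ) ^ (1 - s) + (s - 1) * ((n + 1 : ℝ) : ℂ) ^ (-s) * u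
  have hder : ∀ x ∈ Set.Icc (n : ℝ) (n + 1), HasDerivWithinAt ψ
      ((1 - s) * (x : ℂ) ^ (1 - s - 1) + (s - 1) * ((n + 1 : ℝ) : ℂ) ^ (-s) * ((1 : ℝ) : ℂ))
      (Set.Icc (n : ℝ) (n + 1)) x := fun x hx =>
    ((hasDerivAt_ofReal_cpow_const (hn'.trans_le hx.1).ne' (sub_ne_zero.2 h1.symm)).add
      ((hasDerivAt_id x).ofReal_comp.const_mul _)).hasDerivWithinAt
  have hb : ∀ x ∈ Set.Icc (n : ℝ) (n + 1), ‖(1 - s) * (x : ℂ) ^ (1 - s - 1)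
      + (s - 1) * ((n + 1 : ℝ) : ℂ) ^ (-s) * ((1 : ℝ) : ℂ)‖ ≤
      ‖s - 1‖ * (‖s‖ * (n : ℝ) ^ (-s.re - 1)) := by
    intro x hx
    have : (1 - s) * (x : ℂ) ^ (1 - s - 1) + (s - 1) * ((n + 1 : ℝ) : ℂ) ^ (-s) * ((1 : ℝ) : ℂ)
        = (s - 1) * (((n + 1 : ℝ) : ℂ) ^ (-s) - (x : ℂ) ^ (-s)) := by
      rw [show 1 - s - 1 = -s by ring]; push_cast; ring
    rw [this, norm_mul]
    gcongr
    exact norm_cpow_neg_sub_le hs hn' ⟨by linarith, le_rfl⟩ hx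
  have := (convex_Icc (n : ℝ) (n + 1)).norm_image_sub_le_of_norm_hasDerivWithin_le hder hb
    (Set.left_mem_Icc.2 (by linarith)) (Set.right_mem_Icc.2 (by linarith))
  have e : ψ (n + 1) - ψ n = emTerm n s := by
    simp only [ψ, emTerm]; push_cast; ring
  rw [e] at this
  simpa using this

/-- Convexity of the exponential gives (n/(n+1))^(-δ) ≥ 1 + δ/(n+1), so the difference is at least
δ(n+1)^(-δ-1). Replacing n+1 by 2n costs a factor 2^(δ+1) ≤ 4. Tail sums then telescope, with
explicit dependence on N. -/
lemma rpow_neg_telescope {δ : ℝ} (h0 : 0 < δ) (h1 : δ ≤ 1) {n : ℕ} (hn : 0 < n) :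
    (n : ℝ) ^ (-δ - 1) ≤ 4 / δ * ((n : ℝ) ^ (-δ) - ((n + 1 : ℕ) : ℝ) ^ (-δ)) := by
  have hn' : (1 : ℝ) ≤ n := by exact_mod_cast hn
  have hn0 : (0 : ℝ) < n := by linarith
  push_cast
  have a : (1 + δ / (n + 1)) * ((n : ℝ) + 1) ^ (-δ) ≤ (n : ℝ) ^ (-δ) := by
    have e : (n : ℝ) ^ (-δ) = ((n : ℝ) / (n + 1)) ^ (-δ) * ((n : ℝ) + 1) ^ (-δ) := by
      rw [← Real.mul_rpow (by positivity) (by positivity)]; congr 1; field_simp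
    rw [e]
    gcongr
    rw [Real.rpow_def_of_pos (by positivity)]
    have l := Real.log_le_sub_one_of_pos (show (0 : ℝ) < n / (n + 1) by positivity)
    have l2 : (n : ℝ) / (n + 1) - 1 = -(1 / (n + 1)) := by field_simp; ring
    refine le_trans ?_ (Real.exp_le_exp.2 (show δ / (n + 1) ≤ _ from ?_))
    · linarith [Real.add_one_le_exp (δ / (n + 1))]
    · have : δ / (n + 1) = δ * (1 / ((n : ℝ) + 1)) := by ring
      rw [this]; nlinarith
  have b : (n : ℝ) ^ (-δ - 1) ≤ 4 * (((n : ℝ) + 1) ^ (-δ) / (n + 1)) := by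
    rw [← Real.rpow_sub_one (by positivity)]
    have : (2 : ℝ) ^ (-δ - 1) * (n : ℝ) ^ (-δ - 1) ≤ ((n : ℝ) + 1) ^ (-δ - 1) := by
      rw [← Real.mul_rpow (by positivity) (by positivity)]
      exact Real.rpow_le_rpow_of_nonpos (by positivity) (by linarith) (by linarith)
    have h2 : (1 / 4 : ℝ) ≤ (2 : ℝ) ^ (-δ - 1) := by
      calc (1 / 4 : ℝ) = (2 : ℝ) ^ (-2 : ℝ) := by
            rw [Real.rpow_neg (by norm_num)]; norm_num
        _ ≤ _ := Real.rpow_le_rpow_of_exponent_le (by norm_num) (by linarith)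
    have h3 : 0 < (n : ℝ) ^ (-δ - 1) := by positivity
    nlinarith
  rw [div_mul_eq_mul_div, le_div_iff₀ h0]
  have c : (n : ℝ) ^ (-δ - 1) * δ ≤ 4 * (((n : ℝ) + 1) ^ (-δ) / (n + 1)) * δ := by gcongr
  have d : δ / (n + 1) * ((n : ℝ) + 1) ^ (-δ) = ((n : ℝ) + 1) ^ (-δ) / (n + 1) * δ := by ring
  nlinarith

lemma sum_rpow_neg_tail_le {δ : ℝ} (h0 : 0 < δ) (h1 : δ ≤ 1) {N : ℕ} (hN : 0 < N) (K : ℕ) :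
    ∑ k ∈ Finset.range K, ((N + k : ℕ) : ℝ) ^ (-δ - 1) ≤ 4 / δ * (N : ℝ) ^ (-δ) := by
  calc _ ≤ ∑ k ∈ Finset.range K,
        4 / δ * (((N + k : ℕ) : ℝ) ^ (-δ) - ((N + (k + 1) : ℕ) : ℝ) ^ (-δ)) :=
        Finset.sum_le_sum fun k _ => rpow_neg_telescope h0 h1 (by omega)
    _ = 4 / δ * ((N : ℝ) ^ (-δ) - ((N + K : ℕ) : ℝ) ^ (-δ)) := by
        rw [← Finset.mul_sum, Finset.sum_range_sub' (fun k => ((N + k : ℕ) : ℝ) ^ (-δ))]; simp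
    _ ≤ _ := by
        have : (0 : ℝ) ≤ ((N + K : ℕ) : ℝ) ^ (-δ) := by positivity
        gcongr; linarith

lemma summable_rpow_neg_tail {δ : ℝ} (h0 : 0 < δ) (h1 : δ ≤ 1) {N : ℕ} (hN : 0 < N) :
    Summable fun k : ℕ => ((N + k : ℕ) : ℝ) ^ (-δ - 1) :=
  summable_of_sum_range_le (fun _ => by positivity) (sum_rpow_neg_tail_le h0 h1 hN)

lemma tsum_rpow_neg_tail_le {δ : ℝ} (h0 : 0 < δ) (h1 : δ ≤ 1) {N : ℕ} (hN : 0 < N) :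
    ∑' k : ℕ, ((N + k : ℕ) : ℝ) ^ (-δ - 1) ≤ 4 / δ * (N : ℝ) ^ (-δ) :=
  Real.tsum_le_of_sum_range_le (fun _ => by positivity) (sum_rpow_neg_tail_le h0 h1 hN)

lemma norm_emTerm_le' {δ : ℝ} (h0 : 0 < δ) {s : ℂ} (hs : δ ≤ s.re) {N : ℕ}
    (hN : 0 < N) (k : ℕ) :
    ‖emTerm (N + k) s‖ ≤ ‖s - 1‖ * ‖s‖ * ((N + k : ℕ) : ℝ) ^ (-δ - 1) := by
  refine (norm_emTerm_le (h0.trans_le hs) (by omega)).trans ?_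
  rw [mul_assoc]
  gcongr
  exact_mod_cast (by omega : 1 ≤ N + k)

lemma sum_rpow_neg_le {δ : ℝ} (h0 : 0 < δ) (h1 : δ < 1) (N : ℕ) :
    ∑ k ∈ Finset.range N, ((k + 1 : ℕ) : ℝ) ^ (-δ) ≤ (N : ℝ) ^ (1 - δ) / (1 - δ) := by
  have hd : 0 < 1 - δ := by linarith
  calc _ ≤ ∑ k ∈ Finset.range N,
        (((k + 1 : ℕ) : ℝ) ^ (1 - δ) - (k : ℝ) ^ (1 - δ)) / (1 - δ) := by
        refine Finset.sum_le_sum fun k _ => ?_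
        have hk : (0 : ℝ) < ((k + 1 : ℕ) : ℝ) := by positivity
        rw [le_div_iff₀ hd]
        have b := rpow_one_add_le_one_add_mul_self (s := -(1 / ((k + 1 : ℕ) : ℝ))) (by
          rw [neg_le_neg_iff, div_le_one hk]; push_cast; linarith [(Nat.cast_nonneg k : (0:ℝ) ≤ k)])
          hd.le (by linarith)
        have e : (k : ℝ) ^ (1 - δ) =
            ((k + 1 : ℕ) : ℝ) ^ (1 - δ) * (1 + -(1 / ((k + 1 : ℕ) : ℝ))) ^ (1 - δ) := by
          rw [← Real.mul_rpow (by positivity)]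
          · congr 1; field_simp; push_cast; ring
          · have : 1 / ((k + 1 : ℕ) : ℝ) ≤ 1 := by
              rw [div_le_one hk]; push_cast; linarith [(Nat.cast_nonneg k : (0:ℝ) ≤ k)]
            linarith
        have e2 : ((k + 1 : ℕ) : ℝ) ^ (-δ) = ((k + 1 : ℕ) : ℝ) ^ (1 - δ) * (1 / ((k + 1 : ℕ) : ℝ)) := by
          rw [mul_one_div, ← Real.rpow_sub_one hk.ne']; congr 1; ring
        rw [e, e2]
        have := mul_le_mul_of_nonneg_left b (show 0 ≤ ((k + 1 : ℕ) : ℝ) ^ (1 - δ) by positivity)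
        nlinarith
    _ = _ := by
        rw [← Finset.sum_div, Finset.sum_range_sub (fun k => ((k : ℕ) : ℝ) ^ (1 - δ))]
        simp [Real.zero_rpow hd.ne']

lemma differentiableOn_tsum_emTerm {N : ℕ} (hN : 0 < N) :
    DifferentiableOn ℂ (fun s => ∑' k : ℕ, emTerm (N + k) s) {s | 0 < s.re} := by
  intro s₀ hs₀
  have hs₀' : 0 < s₀.re := hs₀
  set δ := min (s₀.re / 2) 1 with hδ
  have hδ0 : 0 < δ := lt_min (by linarith) one_pos
  have hδ1 : δ ≤ 1 := min_le_right _ _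
  set V : Set ℂ := {s | δ < s.re} ∩ Metric.ball 0 (‖s₀‖ + 1) with hV
  have hVo : IsOpen V := (isOpen_lt continuous_const Complex.continuous_re).inter Metric.isOpen_ball
  have hmem : s₀ ∈ V := by
    refine ⟨show δ < s₀.re from (min_le_left _ _).trans_lt (by linarith), by simp⟩
  set B := ‖s₀‖ + 1
  have hd : DifferentiableOn ℂ (fun s => ∑' k : ℕ, emTerm (N + k) s) V := by
    refine Complex.differentiableOn_tsum_of_summable_norm
      (u := fun k : ℕ => (B + 1) * B * ((N + k : ℕ) : ℝ) ^ (-δ - 1))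
      ((summable_rpow_neg_tail hδ0 hδ1 hN).mul_left _) ?_ hVo ?_
    · intro k
      have h1 : ((N + k : ℕ) : ℂ) ≠ 0 := by exact_mod_cast (by omega : N + k ≠ 0)
      have h2 : ((N + k + 1 : ℕ) : ℂ) ≠ 0 := by exact_mod_cast (by omega : N + k + 1 ≠ 0)
      refine Differentiable.differentiableOn (fun s => ?_)
      unfold emTerm
      refine DifferentiableAt.add (DifferentiableAt.mul (by fun_prop) ?_)
        (DifferentiableAt.mul (DifferentiableAt.sub ?_ ?_) (by fun_prop)) <;>
      exact DifferentiableAt.const_cpow (by fun_prop) (Or.inl (by assumption))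
    · intro k s hs
      refine (norm_emTerm_le' hδ0 (le_of_lt hs.1) hN k).trans ?_
      have : ‖s‖ ≤ B := (mem_ball_zero_iff.1 hs.2).le
      have h2 : ‖s - 1‖ ≤ B + 1 := (norm_sub_le _ _).trans (by simpa using this)
      gcongr
  exact (hd.differentiableAt (hVo.mem_nhds hmem)).differentiableWithinAt

lemma riemannZeta₁_eq_of_one_lt_re {s : ℂ} (hs : 1 < s.re) {N : ℕ} (hN : 0 < N) :
    riemannZeta₁ s = (s - 1) * ∑ n ∈ Finset.range N, ((n + 1 : ℕ) : ℂ) ^ (-s)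
      + (N : ℂ) ^ (1 - s) + ∑' k : ℕ, emTerm (N + k) s := by
  have hs1 : s ≠ 1 := by rintro rfl; simp at hs
  have hz : HasSum (fun n : ℕ => ((n + 1 : ℕ) : ℂ) ^ (-s)) (riemannZeta s) := by
    rw [zeta_eq_tsum_one_div_nat_add_one_cpow hs]
    have hsum : Summable fun n : ℕ => 1 / ((n : ℂ) + 1) ^ s := by
      have := (summable_nat_add_iff 1).2 (Complex.summable_one_div_nat_cpow.2 hs)
      simpa using this
    convert! hsum.hasSum using 2 with n
    rw [Complex.cpow_neg, one_div]; push_cast; rfl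
  have hsum : Summable fun k : ℕ => emTerm (N + k) s := by
    refine Summable.of_norm_bounded (g := fun k : ℕ => ‖s - 1‖ * ‖s‖ * ((N + k : ℕ) : ℝ) ^ (-1 - 1 : ℝ))
      ((summable_rpow_neg_tail one_pos le_rfl hN).mul_left _) fun k =>
        norm_emTerm_le' one_pos hs.le hN k
  have t1 := hsum.hasSum.tendsto_sum_nat
  have e : ∀ K : ℕ, ∑ k ∈ Finset.range K, emTerm (N + k) s =
      (s - 1) * (∑ n ∈ Finset.range (N + K), ((n + 1 : ℕ) : ℂ) ^ (-s) -
        ∑ n ∈ Finset.range N, ((n + 1 : ℕ) : ℂ) ^ (-s))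
      + ((N : ℂ) ^ (1 - s) - ((N + K : ℕ) : ℂ) ^ (1 - s)) * (-1) := by
    intro K
    simp only [emTerm]
    rw [Finset.sum_add_distrib, ← Finset.mul_sum, ← Finset.sum_mul, Finset.sum_range_add]
    have := Finset.sum_range_sub' (fun k => ((N + k : ℕ) : ℂ) ^ (1 - s)) K
    simp only [add_zero, ← add_assoc] at this
    rw [this]; ring
  simp only [e] at t1
  have hcomp : Tendsto (fun K : ℕ => N + K) atTop atTop := tendsto_atTop_mono (by simp) tendsto_id
  have t2 : Tendsto (fun K : ℕ => ((N + K : ℕ) : ℂ) ^ (1 - s)) atTop (𝓝 0) := by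
    rw [tendsto_zero_iff_norm_tendsto_zero]
    have h : ∀ K : ℕ, ‖((N + K : ℕ) : ℂ) ^ (1 - s)‖ = ((N + K : ℕ) : ℝ) ^ (-(s.re - 1)) := by
      intro K
      rw [Complex.norm_natCast_cpow_of_pos (by omega)]; simp
    simp only [h]
    exact (tendsto_rpow_neg_atTop (by linarith)).comp (tendsto_natCast_atTop_atTop.comp hcomp)
  have t3 := (hz.tendsto_sum_nat.comp hcomp)
  have t4 := ((t3.sub_const (∑ n ∈ Finset.range N, ((n + 1 : ℕ) : ℂ) ^ (-s))).const_mul (s - 1)).add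
    ((t2.const_sub ((N : ℂ) ^ (1 - s))).mul_const (-1))
  have := tendsto_nhds_unique t1 t4
  rw [this]
  rw [riemannZeta_eq_inv_sub_mul hs1]
  have : s - 1 ≠ 0 := sub_ne_zero.2 hs1
  field_simp
  ring

/-- Euler–Maclaurin to first order. -/
lemma riemannZeta₁_eq {s : ℂ} (hs : 0 < s.re) {N : ℕ} (hN : 0 < N) :
    riemannZeta₁ s = (s - 1) * ∑ n ∈ Finset.range N, ((n + 1 : ℕ) : ℂ) ^ (-s)
      + (N : ℂ) ^ (1 - s) + ∑' k : ℕ, emTerm (N + k) s := by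
  have ho : IsOpen {s : ℂ | 0 < s.re} := isOpen_lt continuous_const Complex.continuous_re
  have hN' : (N : ℂ) ≠ 0 := by exact_mod_cast hN.ne'
  have hd : DifferentiableOn ℂ (fun s : ℂ => (s - 1) * ∑ n ∈ Finset.range N, ((n + 1 : ℕ) : ℂ) ^ (-s)
      + (N : ℂ) ^ (1 - s) + ∑' k : ℕ, emTerm (N + k) s) {s | 0 < s.re} := by
    refine DifferentiableOn.add (Differentiable.differentiableOn (fun s => ?_))
      (differentiableOn_tsum_emTerm hN)
    refine DifferentiableAt.add (DifferentiableAt.mul (by fun_prop)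
      (DifferentiableAt.fun_sum fun n _ => ?_)) ?_
    · exact DifferentiableAt.const_cpow (by fun_prop) (Or.inl (Nat.cast_ne_zero.2 (by omega)))
    · exact DifferentiableAt.const_cpow (by fun_prop) (Or.inl hN')
  -- Multiplication by s - 1 has removed the pole, so both sides are holomorphic on the whole half
  -- plane Re s > 0, and the identity theorem extends the formula from Re s > 1.
  refine (differentiable_riemannZeta₁.differentiableOn.analyticOnNhd ho).eqOn_of_preconnected_of_eventuallyEq
    (hd.analyticOnNhd ho) (convex_halfSpace_re_gt 0).isPreconnected (z₀ := 2) (by simp) ?_ hs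
  filter_upwards [(isOpen_lt continuous_const Complex.continuous_re).mem_nhds
    (show (1 : ℝ) < (2 : ℂ).re by simp)] with z hz using riemannZeta₁_eq_of_one_lt_re hz hN

/-- Polynomial growth of `ζ` to the right of the line `Re s = δ`. -/
lemma exists_norm_riemannZeta_le {δ : ℝ} (h0 : 0 < δ) (h1 : δ < 1) :
    ∃ C : ℝ, 0 < C ∧ ∀ s : ℂ, δ ≤ s.re → s.re ≤ 4 → 1 ≤ |s.im| →
      ‖riemannZeta s‖ ≤ C * |s.im| ^ (1 - δ) := by
  have hd : 0 < 1 - δ := by linarith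
  refine ⟨1 / (1 - δ) + 1 + 40 / δ, by positivity, fun s hs hs4 ht => ?_⟩
  set t := |s.im| with htdef
  have ht0 : 0 < t := by linarith
  have hs0 : 0 < s.re := by linarith
  have hs1 : s ≠ 1 := by rintro rfl; simp at htdef; linarith
  -- The cut at N ≈ t balances the formula: the sum is of order t^(1-δ), the boundary term is
  -- bounded, and the error is of order |s| N^(-δ), again t^(1-δ).
  set N := ⌊t⌋₊ with hNdef
  have hN : 0 < N := Nat.floor_pos.2 ht
  have hN1 : (1 : ℝ) ≤ N := by exact_mod_cast hN
  have hNt : (N : ℝ) ≤ t := Nat.floor_le ht0.le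
  have htN : t ≤ 2 * N := by linarith [Nat.lt_floor_add_one t]
  have hts : t ≤ ‖s - 1‖ := by
    have := Complex.abs_im_le_norm (s - 1); simpa using this
  have hs1' : s - 1 ≠ 0 := sub_ne_zero.2 hs1
  have hnorm : ‖s‖ ≤ 5 * t := by
    refine (Complex.norm_le_abs_re_add_abs_im s).trans ?_
    rw [abs_of_pos hs0]; linarith
  have key : riemannZeta s = ∑ n ∈ Finset.range N, ((n + 1 : ℕ) : ℂ) ^ (-s)
      + (N : ℂ) ^ (1 - s) / (s - 1) + (∑' k : ℕ, emTerm (N + k) s) / (s - 1) := by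
    rw [riemannZeta_eq_inv_sub_mul hs1, riemannZeta₁_eq hs0 hN]; field_simp
  have b1 : ‖∑ n ∈ Finset.range N, ((n + 1 : ℕ) : ℂ) ^ (-s)‖ ≤ 1 / (1 - δ) * t ^ (1 - δ) := by
    calc _ ≤ ∑ n ∈ Finset.range N, ((n + 1 : ℕ) : ℝ) ^ (-δ) := by
          refine norm_sum_le_of_le _ fun n _ => ?_
          rw [Complex.norm_natCast_cpow_of_pos (by omega)]
          refine Real.rpow_le_rpow_of_exponent_le (by simp) (by simpa using hs)
      _ ≤ _ := sum_rpow_neg_le h0 h1 N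
      _ ≤ _ := by
          rw [div_mul_eq_mul_div, one_mul]; gcongr
  have hpow1 : 1 ≤ t ^ (1 - δ) := Real.one_le_rpow ht hd.le
  have b2 : ‖(N : ℂ) ^ (1 - s) / (s - 1)‖ ≤ 1 * t ^ (1 - δ) := by
    rw [norm_div, div_le_iff₀ (norm_pos_iff.2 hs1'), Complex.norm_natCast_cpow_of_pos hN]
    have : (N : ℝ) ^ (1 - s).re ≤ t := by
      calc (N : ℝ) ^ (1 - s).re ≤ (N : ℝ) ^ (1 : ℝ) :=
            Real.rpow_le_rpow_of_exponent_le hN1 (by simp; linarith)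
        _ ≤ t := by simpa using hNt
    nlinarith
  have b3 : ‖(∑' k : ℕ, emTerm (N + k) s) / (s - 1)‖ ≤ 40 / δ * t ^ (1 - δ) := by
    rw [norm_div, div_le_iff₀ (norm_pos_iff.2 hs1')]
    have hsm := (summable_rpow_neg_tail h0 h1.le hN).mul_left (‖s - 1‖ * ‖s‖)
    have c1 := tsum_of_norm_bounded hsm.hasSum fun k => norm_emTerm_le' h0 hs hN k
    rw [tsum_mul_left] at c1
    have c2 := tsum_rpow_neg_tail_le h0 h1.le hN
    have c3 : (N : ℝ) ^ (-δ) ≤ 2 * t ^ (-δ) := by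
      have : (2 : ℝ) ^ (-δ) * (N : ℝ) ^ (-δ) ≤ t ^ (-δ) := by
        rw [← Real.mul_rpow (by norm_num) (by positivity)]
        exact Real.rpow_le_rpow_of_nonpos ht0 htN (by linarith)
      have h2 : (1 / 2 : ℝ) ≤ (2 : ℝ) ^ (-δ) := by
        calc (1 / 2 : ℝ) = (2 : ℝ) ^ (-1 : ℝ) := by rw [Real.rpow_neg_one]; norm_num
          _ ≤ _ := Real.rpow_le_rpow_of_exponent_le (by norm_num) (by linarith)
      have h3 : 0 < (N : ℝ) ^ (-δ) := by positivity
      nlinarith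
    have c4 : t ^ (1 - δ) = t * t ^ (-δ) := by
      rw [sub_eq_add_neg, Real.rpow_add ht0, Real.rpow_one]
    calc _ ≤ _ := c1
      _ ≤ ‖s - 1‖ * (5 * t) * (4 / δ * (2 * t ^ (-δ))) := by
          refine mul_le_mul (by gcongr) (c2.trans (by gcongr)) (tsum_nonneg fun _ => by positivity)
            (by positivity)
      _ = _ := by rw [c4]; ring
  rw [key]
  refine (norm_add₃_le).trans ?_
  linarith

end ZetaInvSq

/-! ### Lower bound for ζ on Re s ≥ 1 by the 3-4-1 inequality -/

namespace ZetaInvSq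

/-- Cauchy's estimate on discs of radius 1/16: they stay in Re s ≥ 15/16, where ζ grows at most like
|t|^(1/16). -/
lemma exists_norm_deriv_riemannZeta_le :
    ∃ C : ℝ, 0 < C ∧ ∀ s : ℂ, 1 ≤ s.re → s.re ≤ 2 → 2 ≤ |s.im| →
      ‖deriv riemannZeta s‖ ≤ C * |s.im| ^ (1 / 16 : ℝ) := by
  obtain ⟨C, hC, h⟩ := exists_norm_riemannZeta_le (δ := 15 / 16) (by norm_num) (by norm_num)
  refine ⟨C * 2 * 16, by positivity, fun s hs1 hs2 ht => ?_⟩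
  have hmem : ∀ z ∈ Metric.closedBall s (1 / 16), |z.re - s.re| ≤ 1 / 16 ∧ |z.im - s.im| ≤ 1 / 16 := by
    intro z hz
    rw [mem_closedBall_iff_norm] at hz
    exact ⟨(Complex.abs_re_le_norm (z - s)).trans hz, (Complex.abs_im_le_norm (z - s)).trans hz⟩
  have him : ∀ z ∈ Metric.closedBall s (1 / 16), 1 ≤ |z.im| ∧ |z.im| ≤ 2 * |s.im| := by
    intro z hz
    have := (hmem z hz).2
    have h1 := abs_sub_abs_le_abs_sub z.im s.im
    have h2 := abs_sub_abs_le_abs_sub s.im z.im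
    rw [abs_sub_comm] at h2
    constructor <;> linarith
  have hd : DiffContOnCl ℂ riemannZeta (Metric.ball s (1 / 16)) := by
    refine DifferentiableOn.diffContOnCl_ball (U := Metric.closedBall s (1 / 16)) (fun z hz => ?_) subset_rfl
    refine (differentiableAt_riemannZeta ?_).differentiableWithinAt
    rintro rfl
    have := (him _ hz).1
    simp at this; linarith
  have := Complex.norm_deriv_le_of_forall_mem_sphere_norm_le (C := C * 2 * |s.im| ^ (1 / 16 : ℝ))
    (by norm_num : (0 : ℝ) < 1 / 16) hd ?_
  · refine this.trans (le_of_eq ?_); ring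
  · intro z hz
    have hz' := Metric.sphere_subset_closedBall hz
    have hr := abs_le.1 (hmem z hz').1
    refine (h z (by linarith) (by linarith) (him z hz').1).trans ?_
    have e : (1 : ℝ) - 15 / 16 = 1 / 16 := by norm_num
    rw [e, mul_assoc]
    gcongr
    calc |z.im| ^ (1 / 16 : ℝ) ≤ (2 * |s.im|) ^ (1 / 16 : ℝ) := by
          gcongr; exact (him z hz').2
      _ = 2 ^ (1 / 16 : ℝ) * |s.im| ^ (1 / 16 : ℝ) := Real.mul_rpow (by norm_num) (abs_nonneg _)
      _ ≤ 2 * |s.im| ^ (1 / 16 : ℝ) := by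
          gcongr
          calc (2 : ℝ) ^ (1 / 16 : ℝ) ≤ 2 ^ (1 : ℝ) :=
                Real.rpow_le_rpow_of_exponent_le (by norm_num) (by norm_num)
            _ = 2 := by norm_num

lemma exists_norm_riemannZeta_one_add_le :
    ∃ K : ℝ, 0 < K ∧ ∀ x : ℝ, 0 < x → x ≤ 1 → ‖riemannZeta (1 + x)‖ ≤ K / x := by
  have hc : Continuous fun x : ℝ => riemannZeta₁ (1 + x) :=
    differentiable_riemannZeta₁.continuous.comp (by fun_prop)
  obtain ⟨K, hK⟩ := (isCompact_Icc (a := (0 : ℝ)) (b := 1)).exists_bound_of_continuousOn hc.continuousOn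
  refine ⟨|K| + 1, by positivity, fun x h0 h1 => ?_⟩
  have hx : (x : ℂ) ≠ 0 := by exact_mod_cast h0.ne'
  rw [riemannZeta_eq_inv_sub_mul (by simpa using hx), norm_mul, add_sub_cancel_left, norm_inv,
    Complex.norm_real, Real.norm_of_nonneg h0.le, div_eq_inv_mul]
  gcongr
  exact (hK x ⟨h0.le, h1⟩).trans ((le_abs_self K).trans (by linarith))

lemma one_le_norm_riemannZeta_prod {x : ℝ} (hx : 0 < x) (y : ℝ) :
    1 ≤ ‖riemannZeta (1 + x)‖ ^ 3 * ‖riemannZeta (1 + x + Complex.I * y)‖ ^ 4 *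
      ‖riemannZeta (1 + x + 2 * Complex.I * y)‖ := by
  have := (1 : DirichletCharacter ℂ 1).norm_LFunction_product_ge_one hx y
  rw [DirichletCharacter.LFunctionTrivChar, DirichletCharacter.LFunction_modOne_eq, DirichletCharacter.LFunction_modOne_eq] at this
  simpa using this

/-- A quantitative lower bound for `ζ` on the closed half plane `Re s ≥ 1`. -/
lemma exists_le_norm_riemannZeta :
    ∃ c : ℝ, 0 < c ∧ ∀ s : ℂ, 1 ≤ s.re → s.re ≤ 2 → 2 ≤ |s.im| →
      c * |s.im| ^ (-(1 / 4) : ℝ) ≤ ‖riemannZeta s‖ := by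
  obtain ⟨C, hC, hup⟩ := exists_norm_riemannZeta_le (δ := 15 / 16) (by norm_num) (by norm_num)
  obtain ⟨D, hD, hder⟩ := exists_norm_deriv_riemannZeta_le
  obtain ⟨K, hK, hpole⟩ := exists_norm_riemannZeta_one_add_le
  set A := 1 / (K ^ 3 * (C * 2)) with hA
  have hA0 : 0 < A := by positivity
  -- With B⁴ = Aκ³, the condition κ ≤ A/(16D⁴) says exactly that Dκ ≤ B/2: the variation of ζ near
  -- the line Re s = 1 takes away at most half of the lower bound obtained further to the right.
  set κ := min 1 (A / (16 * D ^ 4)) with hκ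
  have hκ0 : 0 < κ := lt_min one_pos (by positivity)
  have hκ1 : κ ≤ 1 := min_le_left _ _
  have hκ2 : κ * (16 * D ^ 4) ≤ A := by
    rw [← le_div_iff₀ (by positivity)]; exact min_le_right _ _
  set B := (A * κ ^ 3) ^ (1 / 4 : ℝ) with hB
  have hB0 : 0 < B := by positivity
  have hB4 : B ^ 4 = A * κ ^ 3 := by
    rw [hB, ← Real.rpow_natCast, ← Real.rpow_mul (by positivity)]; norm_num
  have hDB : D * κ ≤ B / 2 := by
    refine le_of_pow_le_pow_left₀ (n := 4) (by norm_num) (by positivity) ?_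
    rw [div_pow, hB4]
    have : κ ^ 3 * (κ * (16 * D ^ 4)) ≤ κ ^ 3 * A := by gcongr
    nlinarith
  -- the bound for `Re s > 1`
  have h341 : ∀ x t : ℝ, 0 < x → x ≤ 1 → 2 ≤ |t| →
      A * x ^ 3 ≤ ‖riemannZeta (1 + x + Complex.I * t)‖ ^ 4 * |t| ^ (1 / 16 : ℝ) := by
    intro x t hx0 hx1 ht
    have h1 := one_le_norm_riemannZeta_prod hx0 t
    have h2 := hup (1 + x + 2 * Complex.I * t) (by simp; linarith) (by simp; linarith)
      (by simp [abs_mul]; linarith)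
    have e : (1 : ℝ) - 15 / 16 = 1 / 16 := by norm_num
    have h3 : ‖riemannZeta (1 + x + 2 * Complex.I * t)‖ ≤ C * 2 * |t| ^ (1 / 16 : ℝ) := by
      have e2 : (1 + (x : ℂ) + 2 * Complex.I * t).im = 2 * t := by simp
      rw [e2, e, abs_mul, abs_two, Real.mul_rpow (by norm_num) (abs_nonneg _)] at h2
      refine h2.trans ?_
      rw [mul_assoc C]
      gcongr
      calc (2 : ℝ) ^ (1 / 16 : ℝ) ≤ 2 ^ (1 : ℝ) :=
            Real.rpow_le_rpow_of_exponent_le (by norm_num) (by norm_num)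
        _ = 2 := by norm_num
    have h4 : 1 ≤ (K / x) ^ 3 * ‖riemannZeta (1 + x + Complex.I * t)‖ ^ 4 *
        (C * 2 * |t| ^ (1 / 16 : ℝ)) := by
      refine h1.trans ?_
      gcongr
      exact hpole x hx0 hx1
    have e3 : (K / x) ^ 3 * ‖riemannZeta (1 + x + Complex.I * t)‖ ^ 4 *
        (C * 2 * |t| ^ (1 / 16 : ℝ)) = (‖riemannZeta (1 + x + Complex.I * t)‖ ^ 4 *
         |t| ^ (1 / 16 : ℝ)) * (K ^ 3 * (C * 2)) / x ^ 3 := by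
      field_simp
    rw [e3, le_div_iff₀ (by positivity), one_mul] at h4
    rw [hA, one_div, inv_mul_eq_div, div_le_iff₀ (by positivity)]
    exact h4
  -- At distance x = κ|t|^(-e) from the line, 3-4-1 gives |ζ| of order at least |t|^(-(3e +
  -- 1/16)/4), whereas moving from there to the line changes ζ by order |t|^(1/16 - e). The
  -- exponents agree for e = 5/16, and both are then -1/4.
  have hfar : ∀ x t : ℝ, 2 ≤ |t| → κ * |t| ^ (-(5 / 16) : ℝ) ≤ x → x ≤ 1 →
      B * |t| ^ (-(1 / 4) : ℝ) ≤ ‖riemannZeta (1 + x + Complex.I * t)‖ := by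
    intro x t ht hx hx1
    have ht0 : 0 < |t| := by linarith
    have hx0 : 0 < x := lt_of_lt_of_le (by positivity) hx
    have h1 := h341 x t hx0 hx1 ht
    refine le_of_pow_le_pow_left₀ (n := 4) (by norm_num) (norm_nonneg _) ?_
    have h2 : A * (κ * |t| ^ (-(5 / 16) : ℝ)) ^ 3 ≤ A * x ^ 3 := by gcongr
    have e1 : (|t| ^ (-(5 / 16) : ℝ)) ^ 3 = (|t| ^ (-(1 / 4) : ℝ)) ^ 4 * |t| ^ (1 / 16 : ℝ) := by
      rw [← Real.rpow_natCast, ← Real.rpow_natCast, ← Real.rpow_mul ht0.le, ← Real.rpow_mul ht0.le,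
        ← Real.rpow_add ht0]
      norm_num
    have h3 := h2.trans h1
    rw [mul_pow, e1, ← mul_assoc, ← mul_assoc, ← hB4] at h3
    rw [mul_pow]
    exact le_of_mul_le_mul_right h3 (by positivity)
  refine ⟨B / 2, by positivity, fun s hs1 hs2 ht => ?_⟩
  set t := s.im
  have ht0 : 0 < |t| := by linarith
  have hs : s = 1 + ((s.re - 1 : ℝ) : ℂ) + Complex.I * t := by
    apply Complex.ext <;> simp [t]
  have hpos : 0 < |t| ^ (-(1 / 4) : ℝ) := by positivity
  set x₁ := κ * |t| ^ (-(5 / 16) : ℝ) with hx₁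
  have hx₁0 : 0 < x₁ := by positivity
  have hx₁1 : x₁ ≤ 1 := by
    have : |t| ^ (-(5 / 16) : ℝ) ≤ 1 := Real.rpow_le_one_of_one_le_of_nonpos (by linarith) (by norm_num)
    nlinarith
  rcases le_total x₁ (s.re - 1) with hx | hx
  · have := hfar (s.re - 1) t ht hx (by linarith)
    rw [← hs] at this
    nlinarith
  · have h1 := hfar x₁ t ht le_rfl hx₁1
    set s₁ : ℂ := 1 + x₁ + Complex.I * t with hs₁
    have hre : s₁.re = 1 + x₁ := by simp [hs₁]
    have him : s₁.im = t := by simp [hs₁]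
    have h2 : ‖riemannZeta s₁ - riemannZeta s‖ ≤ D * |t| ^ (1 / 16 : ℝ) * ‖s₁ - s‖ := by
      refine (convex_segment s s₁).norm_image_sub_le_of_norm_deriv_le (f := riemannZeta) (fun z hz => ?_) (fun z hz => ?_)
        (left_mem_segment ℝ s s₁) (right_mem_segment ℝ s s₁)
      all_goals
        obtain ⟨a, b, ha, hb, hab, rfl⟩ := hz
        have him' : (a • s + b • s₁).im = t := by
          simp [him, ← add_mul, hab, t]
        have hre' : (a • s + b • s₁).re = 1 + (a * (s.re - 1) + b * x₁) := by
          simp [hre]; linear_combination hab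
      · refine differentiableAt_riemannZeta fun h => ?_
        rw [h] at him'; rw [← him'] at ht; simp at ht; linarith
      · have := hder (a • s + b • s₁) (by rw [hre']; nlinarith) (by rw [hre']; nlinarith)
          (by rw [him']; exact ht)
        rwa [him'] at this
    have h3 : ‖s₁ - s‖ ≤ x₁ := by
      have : s₁ - s = ((x₁ - (s.re - 1) : ℝ) : ℂ) := by
        apply Complex.ext <;> simp [hre, him, t]; ring
      rw [this, Complex.norm_real, Real.norm_eq_abs, abs_of_nonneg (by linarith)]
      linarith
    have h4 : D * |t| ^ (1 / 16 : ℝ) * ‖s₁ - s‖ ≤ B / 2 * |t| ^ (-(1 / 4) : ℝ) := by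
      calc _ ≤ D * |t| ^ (1 / 16 : ℝ) * x₁ := by gcongr
        _ = D * κ * (|t| ^ (1 / 16 : ℝ) * |t| ^ (-(5 / 16) : ℝ)) := by rw [hx₁]; ring
        _ = D * κ * |t| ^ (-(1 / 4) : ℝ) := by rw [← Real.rpow_add ht0]; norm_num
        _ ≤ _ := by gcongr
    have h5 := norm_sub_norm_le (riemannZeta s₁) (riemannZeta s)
    nlinarith

end ZetaInvSq

/-! ### Gamma integral on rotated rays and decay of Γ on vertical lines -/

namespace ZetaInvSq

open MeasureTheory

lemma integrableOn_rpow_mul_exp_neg {σ b : ℝ} (hσ : 0 < σ) (hb : 0 < b) :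
    IntegrableOn (fun t : ℝ => t ^ (σ - 1) * Real.exp (-b * t)) (Set.Ioi 0) := by
  have := integrableOn_rpow_mul_exp_neg_mul_rpow (s := σ - 1) (p := 1) (by linarith) one_pos hb
  simpa using this

lemma norm_cpow_mul_cexp {a r : ℂ} {t : ℝ} (ht : 0 < t) :
    ‖(t : ℂ) ^ (a - 1) * Complex.exp (-(r * t))‖ = t ^ (a.re - 1) * Real.exp (-r.re * t) := by
  rw [norm_mul, Complex.norm_cpow_eq_rpow_re_of_pos ht, Complex.norm_exp]
  simp

lemma integrableOn_cpow_mul_cexp {a r : ℂ} (ha : 0 < a.re) (hr : 0 < r.re) :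
    IntegrableOn (fun t : ℝ => (t : ℂ) ^ (a - 1) * Complex.exp (-(r * t))) (Set.Ioi 0) := by
  refine (integrableOn_rpow_mul_exp_neg ha hr).mono' ?_ ?_
  · refine ContinuousOn.aestronglyMeasurable (fun t ht => ?_) measurableSet_Ioi
    refine ContinuousAt.continuousWithinAt (ContinuousAt.mul ?_ (by fun_prop))
    exact (Complex.continuousAt_ofReal_cpow_const _ _ (Or.inr (ne_of_gt ht)))
  · refine (ae_restrict_iff' measurableSet_Ioi).2 (.of_forall fun t ht => ?_)
    exact (norm_cpow_mul_cexp ht).le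

lemma differentiableAt_integral_cpow_mul_cexp {a r : ℂ} (ha : 0 < a.re) (hr : 0 < r.re) :
    DifferentiableAt ℂ (fun r : ℂ => ∫ t : ℝ in Set.Ioi 0, (t : ℂ) ^ (a - 1) * Complex.exp (-(r * t))) r := by
  have hs : {z : ℂ | r.re / 2 < z.re} ∈ 𝓝 r :=
    (isOpen_lt continuous_const Complex.continuous_re).mem_nhds (show r.re / 2 < r.re by linarith)
  refine (hasDerivAt_integral_of_dominated_loc_of_deriv_le (𝕜 := ℂ)
    (F := fun (r : ℂ) (t : ℝ) => (t : ℂ) ^ (a - 1) * Complex.exp (-(r * t)))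
    (F' := fun (r : ℂ) (t : ℝ) => -((t : ℂ) ^ (a + 1 - 1) * Complex.exp (-(r * t))))
    (bound := fun t => t ^ (a.re + 1 - 1) * Real.exp (-(r.re / 2) * t))
    hs ?_ (integrableOn_cpow_mul_cexp ha hr) ?_ ?_
    (integrableOn_rpow_mul_exp_neg (by linarith) (by linarith)) ?_).2.differentiableAt
  · filter_upwards [hs] with z hz
    exact (integrableOn_cpow_mul_cexp ha (by have : r.re / 2 < z.re := hz; linarith)).1
  · exact (integrableOn_cpow_mul_cexp (a := a + 1) (by simp; linarith) hr).1.neg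
  · refine (ae_restrict_iff' measurableSet_Ioi).2 (.of_forall fun t ht z hz => ?_)
    rw [norm_neg, norm_cpow_mul_cexp ht]
    have ht' : 0 < t := ht
    simp only [Complex.add_re, Complex.one_re]
    have : r.re / 2 < z.re := hz
    gcongr
  · refine (ae_restrict_iff' measurableSet_Ioi).2 (.of_forall fun t ht z hz => ?_)
    have ht' : (t : ℂ) ≠ 0 := by exact_mod_cast (ne_of_gt ht)
    have h1 : HasDerivAt (fun z : ℂ => Complex.exp (-(z * t))) (Complex.exp (-(z * t)) * (-(1 * t))) z :=
      (((hasDerivAt_id z).mul_const (t : ℂ)).neg).cexp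
    convert! h1.const_mul ((t : ℂ) ^ (a - 1)) using 1
    rw [show a + 1 - 1 = (a - 1) + 1 by ring, Complex.cpow_add _ _ ht', Complex.cpow_one]
    ring

/-- The Gamma integral along a rotated ray. -/
lemma integral_cpow_mul_cexp {a r : ℂ} (ha : 0 < a.re) (hr : 0 < r.re) :
    ∫ t : ℝ in Set.Ioi 0, (t : ℂ) ^ (a - 1) * Complex.exp (-(r * t)) =
      r ^ (-a) * Complex.Gamma a := by
  have ho : IsOpen {z : ℂ | 0 < z.re} := isOpen_lt continuous_const Complex.continuous_re
  have h1 : DifferentiableOn ℂ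
      (fun r : ℂ => ∫ t : ℝ in Set.Ioi 0, (t : ℂ) ^ (a - 1) * Complex.exp (-(r * t))) {z | 0 < z.re} :=
    fun z hz => (differentiableAt_integral_cpow_mul_cexp ha hz).differentiableWithinAt
  have h2 : DifferentiableOn ℂ (fun r : ℂ => r ^ (-a) * Complex.Gamma a) {z | 0 < z.re} :=
    fun z hz => ((differentiableAt_id.cpow_const (Or.inl hz)).mul_const _).differentiableWithinAt
  -- Both sides are holomorphic in r on Re r > 0 and agree for positive real r, a set that
  -- accumulates at 1.
  refine (h1.analyticOnNhd ho).eqOn_of_preconnected_of_frequently_eq (h2.analyticOnNhd ho)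
    (convex_halfSpace_re_gt 0).isPreconnected (z₀ := 1) (by simp) ?_ hr
  have hreal : ∀ x : ℝ, 0 < x → ∫ t : ℝ in Set.Ioi 0, (t : ℂ) ^ (a - 1) * Complex.exp (-((x : ℂ) * t)) =
      (x : ℂ) ^ (-a) * Complex.Gamma a := by
    intro x hx
    rw [Complex.integral_cpow_mul_exp_neg_mul_Ioi ha hx, Complex.cpow_neg, one_div,
      Complex.inv_cpow]
    rw [Complex.arg_ofReal_of_nonneg hx.le]; exact Real.pi_ne_zero.symm
  have ht : Tendsto (fun x : ℝ => (x : ℂ)) (𝓝[≠] 1) (𝓝[≠] 1) := by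
    refine tendsto_nhdsWithin_iff.2 ⟨?_, ?_⟩
    · exact (Complex.continuous_ofReal.tendsto' 1 1 (by simp)).mono_left nhdsWithin_le_nhds
    · filter_upwards [self_mem_nhdsWithin] with x hx
      simpa using hx
  refine ht.frequently (Eventually.frequently ?_)
  filter_upwards [nhdsWithin_le_nhds (lt_mem_nhds (show (0 : ℝ) < 1 by norm_num))] with x hx
  exact hreal x hx

/-- Exponential decay of `Γ` on vertical lines. -/
lemma norm_Gamma_le {a : ℂ} (ha : 0 < a.re) {θ : ℝ} (h0 : |θ| < Real.pi / 2) :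
    ‖Complex.Gamma a‖ ≤ Real.exp (-(θ * a.im)) * ((Real.cos θ) ^ (-a.re) * Real.Gamma a.re) := by
  have hcos : 0 < Real.cos θ := Real.cos_pos_of_mem_Ioo (abs_lt.1 h0 |> fun h => ⟨h.1, h.2⟩)
  -- On the ray of angle θ the right side of the Gamma integral carries the factor |r^(-a)| = e^(θ
  -- Im a), while the integral is at most its value for the real parts. The decay of Γ(a) is the
  -- quotient of the two.
  set r : ℂ := Complex.exp (θ * Complex.I) with hr
  have hrre : r.re = Real.cos θ := by rw [hr, Complex.exp_ofReal_mul_I_re]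
  have h := integral_cpow_mul_cexp ha (r := r) (by rw [hrre]; exact hcos)
  have hb : ‖∫ t : ℝ in Set.Ioi 0, (t : ℂ) ^ (a - 1) * Complex.exp (-(r * t))‖ ≤
      (Real.cos θ) ^ (-a.re) * Real.Gamma a.re := by
    refine (norm_integral_le_integral_norm _).trans (le_of_eq ?_)
    rw [Real.rpow_neg hcos.le, ← Real.inv_rpow hcos.le, ← one_div, ← Real.integral_rpow_mul_exp_neg_mul_Ioi ha hcos]
    refine setIntegral_congr_fun measurableSet_Ioi fun t ht => ?_
    simp only [norm_cpow_mul_cexp ht, hrre, neg_mul]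
  rw [h, norm_mul] at hb
  have hn : ‖r ^ (-a)‖ = Real.exp (θ * a.im) := by
    rw [Complex.cpow_def_of_ne_zero (Complex.exp_ne_zero _), Complex.norm_exp, Complex.log_exp]
    · simp
    · simp; linarith [(abs_lt.1 h0).1, Real.pi_pos]
    · simp; linarith [(abs_lt.1 h0).2, Real.pi_pos]
  rw [hn] at hb
  rw [Real.exp_neg, inv_mul_eq_div, le_div_iff₀ (Real.exp_pos _)]
  linarith

end ZetaInvSq

/-! ### Size of 1/(sζ(1+s))² and of its derivative near the imaginary axis -/

namespace ZetaInvSq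

open MeasureTheory

/-- The function `1 / (s ζ(1+s))²`, continued to `s = 0`. -/
noncomputable def zInv (s : ℂ) : ℂ := (riemannZeta₁ (1 + s) ^ 2)⁻¹

lemma riemannZeta₁_ne_zero {s : ℂ} (hs : 1 ≤ s.re) : riemannZeta₁ s ≠ 0 := by
  rcases eq_or_ne s 1 with rfl | h
  · simp
  · intro h0
    have := riemannZeta_ne_zero_of_one_le_re hs
    rw [riemannZeta_eq_inv_sub_mul h, h0] at this
    simp at this

lemma riemannZeta₁_eq_mul {s : ℂ} (hs : s ≠ 1) : riemannZeta₁ s = (s - 1) * riemannZeta s := by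
  rw [riemannZeta_eq_inv_sub_mul hs]; field_simp [sub_ne_zero.2 hs]

lemma hasDerivAt_zInv {s : ℂ} (hs : 0 ≤ s.re) : HasDerivAt zInv
    (-2 * deriv riemannZeta₁ (1 + s) / riemannZeta₁ (1 + s) ^ 3) s := by
  have h0 : riemannZeta₁ (1 + s) ≠ 0 := riemannZeta₁_ne_zero (by simpa using hs)
  have h1 : HasDerivAt (fun s => riemannZeta₁ (1 + s)) (deriv riemannZeta₁ (1 + s)) s :=
    (differentiable_riemannZeta₁ (1 + s)).hasDerivAt.comp_const_add 1 s
  convert! (h1.pow 2).inv (pow_ne_zero 2 h0) using 1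
  simp only [Pi.pow_apply]
  field_simp
  push_cast
  ring

/-- Compactness covers |y| ≤ 2, and for |y| ≥ 2 the weights |y|^(-r) and (1+|y|)^(-r) are
comparable. The resulting majorant has no singularity at 0, so it serves on the whole line. -/
lemma exists_bound_of_large (f : ℝ → ℝ → ℂ) (hf : ContinuousOn (Function.uncurry f) (Set.Icc 0 1 ×ˢ Set.univ))
    {C r : ℝ} (h : ∀ σ ∈ Set.Icc (0 : ℝ) 1, ∀ y, 2 ≤ |y| → ‖f σ y‖ ≤ C * |y| ^ (-r)) (hr : 0 ≤ r) :
    ∃ C' : ℝ, ∀ σ ∈ Set.Icc (0 : ℝ) 1, ∀ y, ‖f σ y‖ ≤ C' * (1 + |y|) ^ (-r) := by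
  have hc : IsCompact (Set.Icc (0 : ℝ) 1 ×ˢ Set.Icc (-2 : ℝ) 2) := isCompact_Icc.prod isCompact_Icc
  obtain ⟨M, hM⟩ := hc.exists_bound_of_continuousOn (hf.mono (Set.prod_mono subset_rfl (Set.subset_univ _)))
  refine ⟨max (|C| * 2 ^ r) (|M| * 3 ^ r), fun σ hσ y => ?_⟩
  have hy : 0 ≤ |y| := abs_nonneg y
  have hp : 0 < (1 + |y|) ^ (-r) := by positivity
  rcases le_total 2 |y| with h2 | h2
  · calc _ ≤ |C| * |y| ^ (-r) := (h σ hσ y h2).trans (by gcongr; exact le_abs_self C)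
      _ ≤ |C| * (2 ^ r * (1 + |y|) ^ (-r)) := by
        gcongr
        have e : |y| ^ (-r) = 2 ^ r * (2 * |y|) ^ (-r) := by
          rw [Real.mul_rpow (by norm_num) hy, ← mul_assoc, ← Real.rpow_add (by norm_num)]; simp
        rw [e]
        gcongr ?_ * ?_
        exact Real.rpow_le_rpow_of_nonpos (by positivity) (by linarith) (by linarith)
      _ ≤ _ := by
        rw [← mul_assoc]
        exact mul_le_mul_of_nonneg_right (le_max_left _ _) hp.le
  · calc _ ≤ |M| * 1 := by
          rw [mul_one]; exact (hM (σ, y) ⟨hσ, abs_le.1 h2⟩).trans (le_abs_self M)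
      _ ≤ |M| * (3 ^ r * (1 + |y|) ^ (-r)) := by
        gcongr
        have e : (1 : ℝ) = 3 ^ r * 3 ^ (-r) := by
          rw [← Real.rpow_add (by norm_num)]; simp
        rw [e]
        gcongr ?_ * ?_
        exact Real.rpow_le_rpow_of_nonpos (by positivity) (by linarith) (by linarith)
      _ ≤ _ := by
        rw [← mul_assoc]
        exact mul_le_mul_of_nonneg_right (le_max_right _ _) hp.le

lemma exists_le_norm_riemannZeta₁ : ∃ c : ℝ, 0 < c ∧ ∀ σ ∈ Set.Icc (0 : ℝ) 1, ∀ y : ℝ, 2 ≤ |y| →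
    c * |y| ^ (3 / 4 : ℝ) ≤ ‖riemannZeta₁ (1 + (σ + y * Complex.I))‖ := by
  obtain ⟨c, hc, h⟩ := exists_le_norm_riemannZeta
  refine ⟨c, hc, fun σ hσ y hy => ?_⟩
  have hy0 : 0 < |y| := by linarith
  have him : (1 + (σ + y * Complex.I) : ℂ).im = y := by simp
  have hre : (1 + (σ + y * Complex.I) : ℂ).re = 1 + σ := by simp
  have hne : (1 + (σ + y * Complex.I) : ℂ) ≠ 1 := by
    intro h0; rw [h0] at him; simp at him; rw [← him] at hy; simp at hy; linarith
  have h1 := h (1 + (σ + y * Complex.I)) (by rw [hre]; linarith [hσ.1]) (by rw [hre]; linarith [hσ.2])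
    (by rwa [him])
  rw [him] at h1
  rw [riemannZeta₁_eq_mul hne, norm_mul]
  have h2 : |y| ≤ ‖(1 + (σ + y * Complex.I) : ℂ) - 1‖ := by
    have := Complex.abs_im_le_norm ((1 + (σ + y * Complex.I) : ℂ) - 1); simpa using this
  calc _ = |y| * (c * |y| ^ (-(1 / 4) : ℝ)) := by
        have : |y| ^ (3 / 4 : ℝ) = |y| * |y| ^ (-(1 / 4) : ℝ) := by
          nth_rw 2 [← Real.rpow_one |y|]; rw [← Real.rpow_add hy0]; norm_num
        rw [this]; ring
    _ ≤ _ := by gcongr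

lemma exists_norm_deriv_riemannZeta₁_le : ∃ C : ℝ, 0 < C ∧ ∀ σ ∈ Set.Icc (0 : ℝ) 1, ∀ y : ℝ, 2 ≤ |y| →
    ‖deriv riemannZeta₁ (1 + (σ + y * Complex.I))‖ ≤ C * |y| ^ (17 / 16 : ℝ) := by
  obtain ⟨C, hC, h⟩ := exists_norm_deriv_riemannZeta_le
  obtain ⟨C', hC', h'⟩ := exists_norm_riemannZeta_le (δ := 15 / 16) (by norm_num) (by norm_num)
  refine ⟨C' + 2 * C, by positivity, fun σ hσ y hy => ?_⟩
  have hy0 : 0 < |y| := by linarith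
  set s : ℂ := 1 + (σ + y * Complex.I) with hs
  have him : s.im = y := by simp [hs]
  have hre : s.re = 1 + σ := by simp [hs]
  have hne : s ≠ 1 := by
    intro h0; rw [h0] at him; simp at him; rw [← him] at hy; simp at hy; linarith
  have h1 := h s (by rw [hre]; linarith [hσ.1]) (by rw [hre]; linarith [hσ.2]) (by rwa [him])
  have h2 := h' s (by rw [hre]; linarith [hσ.1]) (by rw [hre]; linarith [hσ.2]) (by rw [him]; linarith)
  rw [him] at h1 h2
  have hd : deriv riemannZeta₁ s = riemannZeta s + (s - 1) * deriv riemannZeta s := by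
    have e : riemannZeta₁ =ᶠ[𝓝 s] fun z => (z - 1) * riemannZeta z := by
      filter_upwards [isOpen_ne.mem_nhds hne] with z hz using riemannZeta₁_eq_mul hz
    rw [e.deriv_eq]
    have := (((hasDerivAt_id s).sub_const 1).mul (differentiableAt_riemannZeta hne).hasDerivAt).deriv
    exact this.trans (by simp)
  have h3 : ‖s - 1‖ ≤ 2 * |y| := by
    refine (Complex.norm_le_abs_re_add_abs_im _).trans ?_
    simp only [Complex.sub_re, Complex.sub_im, him, hre, Complex.one_re, Complex.one_im, sub_zero,
      add_sub_cancel_left, abs_of_nonneg hσ.1]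
    linarith [hσ.2]
  have e1 : |y| ^ (17 / 16 : ℝ) = |y| * |y| ^ (1 / 16 : ℝ) := by
    nth_rw 2 [← Real.rpow_one |y|]; rw [← Real.rpow_add hy0]; norm_num
  have e2 : (1 : ℝ) - 15 / 16 = 1 / 16 := by norm_num
  rw [e2] at h2
  rw [hd]
  calc _ ≤ ‖riemannZeta s‖ + ‖s - 1‖ * ‖deriv riemannZeta s‖ := (norm_add_le _ _).trans (by rw [norm_mul])
    _ ≤ C' * |y| ^ (1 / 16 : ℝ) + 2 * |y| * (C * |y| ^ (1 / 16 : ℝ)) := by gcongr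
    _ ≤ C' * |y| ^ (17 / 16 : ℝ) + 2 * C * |y| ^ (17 / 16 : ℝ) := by
      have : |y| ^ (1 / 16 : ℝ) ≤ |y| ^ (17 / 16 : ℝ) :=
        Real.rpow_le_rpow_of_exponent_le (by linarith) (by norm_num)
      rw [e1] at this ⊢
      nlinarith
    _ = _ := by ring

lemma re_mul_I (σ y : ℝ) : (σ + y * Complex.I : ℂ).re = σ := by simp

/-- The factor s² and the squared lower bound |y|^(-1/4) for ζ leave the exponent -2 + 1/2 = -3/2.
This is integrable, and uniform in σ, so it dominates as σ → 0. -/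
lemma exists_norm_zInv_le : ∃ C : ℝ, ∀ σ ∈ Set.Icc (0 : ℝ) 1, ∀ y : ℝ,
    ‖zInv (σ + y * Complex.I)‖ ≤ C * (1 + |y|) ^ (-(3 / 2) : ℝ) := by
  obtain ⟨c, hc, h⟩ := exists_le_norm_riemannZeta₁
  refine exists_bound_of_large (fun σ y => zInv (σ + y * Complex.I)) ?_ (C := (c ^ 2)⁻¹) (fun σ hσ y hy => ?_) (by norm_num)
  · rintro ⟨σ, y⟩ ⟨hσ, -⟩
    have : ContinuousAt zInv (σ + y * Complex.I) :=
      (hasDerivAt_zInv (by rw [re_mul_I]; exact hσ.1)).continuousAt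
    exact (this.comp (f := fun p : ℝ × ℝ => (p.1 + p.2 * Complex.I : ℂ)) (x := (σ, y)) (by fun_prop)).continuousWithinAt
  · have hy0 : 0 < |y| := by linarith
    rw [zInv, norm_inv, norm_pow, Real.rpow_neg hy0.le, ← mul_inv]
    refine inv_anti₀ (by positivity) ?_
    have e : c ^ 2 * |y| ^ (3 / 2 : ℝ) = (c * |y| ^ (3 / 4 : ℝ)) ^ 2 := by
      rw [mul_pow, ← Real.rpow_natCast (|y| ^ (3 / 4 : ℝ)), ← Real.rpow_mul hy0.le]; norm_num
    rw [e]
    gcongr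
    exact h σ hσ y hy

/-- The exponent is 17/16 - 3·(3/4) = -19/16. Being below -1, it makes the derivative integrable, as
Riemann–Lebesgue requires. -/
lemma exists_norm_deriv_zInv_le : ∃ C : ℝ, ∀ σ ∈ Set.Icc (0 : ℝ) 1, ∀ y : ℝ,
    ‖-2 * deriv riemannZeta₁ (1 + (σ + y * Complex.I)) / riemannZeta₁ (1 + (σ + y * Complex.I)) ^ 3‖
      ≤ C * (1 + |y|) ^ (-(19 / 16) : ℝ) := by
  obtain ⟨c, hc, h⟩ := exists_le_norm_riemannZeta₁
  obtain ⟨D, hD, h'⟩ := exists_norm_deriv_riemannZeta₁_le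
  refine exists_bound_of_large (fun σ y => -2 * deriv riemannZeta₁ (1 + (σ + y * Complex.I)) /
    riemannZeta₁ (1 + (σ + y * Complex.I)) ^ 3) ?_ (C := 2 * D / c ^ 3) (fun σ hσ y hy => ?_) (by norm_num)
  · have hd : Continuous (deriv riemannZeta₁) :=
      (differentiable_riemannZeta₁.contDiff (n := 1)).continuous_deriv le_rfl
    have hz := differentiable_riemannZeta₁.continuous
    refine ContinuousOn.div (Continuous.continuousOn ?_) (Continuous.continuousOn ?_) ?_
    · exact continuous_const.mul (hd.comp (by fun_prop))
    · exact (hz.comp (by fun_prop)).pow 3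
    · rintro ⟨σ, y⟩ ⟨hσ, -⟩
      refine pow_ne_zero 3 (riemannZeta₁_ne_zero ?_)
      simpa using hσ.1
  · have hy0 : 0 < |y| := by linarith
    rw [norm_div, norm_mul, norm_neg, Complex.norm_two, norm_pow]
    calc _ ≤ 2 * (D * |y| ^ (17 / 16 : ℝ)) / (c * |y| ^ (3 / 4 : ℝ)) ^ 3 := by
          gcongr
          · exact h' σ hσ y hy
          · exact h σ hσ y hy
      _ = _ := by
          have e : (c * |y| ^ (3 / 4 : ℝ)) ^ 3 = c ^ 3 * |y| ^ (9 / 4 : ℝ) := by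
            rw [mul_pow, ← Real.rpow_natCast (|y| ^ (3 / 4 : ℝ)), ← Real.rpow_mul hy0.le]; norm_num
          have e2 : |y| ^ (17 / 16 : ℝ) = |y| ^ (-(19 / 16) : ℝ) * |y| ^ (9 / 4 : ℝ) := by
            rw [← Real.rpow_add hy0]; norm_num
          rw [e, e2]
          have : 0 < |y| ^ (9 / 4 : ℝ) := by positivity
          field_simp

lemma integrable_one_add_abs_mul {r : ℝ} (hr : 1 < r) (C : ℝ) :
    Integrable fun y : ℝ => C * (1 + |y|) ^ (-r) := by
  have := integrable_one_add_norm (E := ℝ) (μ := volume) (r := r) (by simpa using hr)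
  simpa using this.const_mul C

end ZetaInvSq

/-! ### The first Riesz mean as a Fourier integral -/

namespace ZetaInvSq

open MeasureTheory FourierTransform

/-- The function `v ↦ max v 0 * exp (-σ v)`. -/
noncomputable def rampExp (σ v : ℝ) : ℂ := ((max v 0 * Real.exp (-(σ * v)) : ℝ) : ℂ)

lemma fourier_rampExp_integrand (σ ξ v : ℝ) :
    Real.fourierChar (-(v * ξ)) • rampExp σ v =
      Set.indicator (Set.Ioi 0) (fun t : ℝ => (t : ℂ) ^ ((2 : ℂ) - 1) *
        Complex.exp (-((σ + 2 * Real.pi * ξ * Complex.I) * t))) v := by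
  rw [Circle.smul_def, Real.fourierChar_apply, smul_eq_mul, rampExp]
  by_cases hv : 0 < v
  · rw [Set.indicator_of_mem (show v ∈ Set.Ioi 0 from hv), max_eq_left hv.le]
    norm_num
    rw [mul_left_comm, ← Complex.exp_add]
    congr 2; ring
  · rw [Set.indicator_of_notMem (by simpa using hv), max_eq_right (by linarith)]
    simp

lemma integrable_rampExp {σ : ℝ} (hσ : 0 < σ) : Integrable (rampExp σ) := by
  have h : rampExp σ = Set.indicator (Set.Ioi 0) (fun t : ℝ => (t : ℂ) ^ ((2 : ℂ) - 1) *
        Complex.exp (-((σ : ℂ) * t))) := by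
    funext v
    have := fourier_rampExp_integrand σ 0 v
    simpa using this
  rw [h]
  exact (integrableOn_cpow_mul_cexp (by simp) (by simpa using hσ)).integrable_indicator measurableSet_Ioi

lemma fourier_rampExp {σ : ℝ} (hσ : 0 < σ) (ξ : ℝ) :
    𝓕 (rampExp σ) ξ = ((σ + 2 * Real.pi * ξ * Complex.I : ℂ) ^ 2)⁻¹ := by
  rw [Real.fourier_real_eq]
  simp only [fourier_rampExp_integrand]
  rw [integral_indicator measurableSet_Ioi, integral_cpow_mul_cexp (by simp) (by simpa using hσ),
    Complex.cpow_neg]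
  norm_num

lemma norm_sq_ge {σ : ℝ} (ξ : ℝ) : σ ^ 2 + ξ ^ 2 ≤ ‖(σ + 2 * Real.pi * ξ * Complex.I : ℂ) ^ 2‖ := by
  rw [norm_pow, Complex.sq_norm, Complex.normSq_apply]
  simp
  have : 1 ≤ (2 * Real.pi) ^ 2 := by nlinarith [Real.pi_gt_three]
  nlinarith [sq_nonneg ξ]

lemma integrable_inv_sq {σ : ℝ} (hσ : 0 < σ) :
    Integrable fun ξ : ℝ => ((σ + 2 * Real.pi * ξ * Complex.I : ℂ) ^ 2)⁻¹ := by
  have h1 : Integrable fun ξ : ℝ => (σ ^ 2)⁻¹ * (1 + (ξ / σ) ^ 2)⁻¹ :=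
    (integrable_inv_one_add_sq.comp_div hσ.ne').const_mul _
  refine h1.mono' (Continuous.aestronglyMeasurable ?_) (.of_forall fun ξ => ?_)
  · refine Continuous.inv₀ (by fun_prop) fun ξ h => ?_
    have := norm_sq_ge (σ := σ) ξ
    rw [h, norm_zero] at this
    nlinarith [sq_nonneg ξ, pow_pos hσ 2]
  · rw [norm_inv, ← mul_inv]
    refine inv_anti₀ (by positivity) ((le_of_eq ?_).trans (norm_sq_ge ξ))
    field_simp

lemma continuous_rampExp (σ : ℝ) : Continuous (rampExp σ) := by
  unfold rampExp; fun_prop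

/-- Perron's formula with weight 1/s². The ramp is continuous and its transform 1/(σ+2πiξ)² is
integrable, so Fourier inversion holds at every point; this is the gain from Riesz means over sharp
partial sums. -/
lemma integral_kernel {σ : ℝ} (hσ : 0 < σ) (v : ℝ) :
    ∫ ξ : ℝ, Complex.exp (2 * Real.pi * ξ * v * Complex.I) *
      ((σ + 2 * Real.pi * ξ * Complex.I : ℂ) ^ 2)⁻¹ = rampExp σ v := by
  have h := congrFun ((continuous_rampExp σ).fourierInv_fourier_eq (integrable_rampExp hσ) (by
    have : 𝓕 (rampExp σ) = fun ξ : ℝ => ((σ + 2 * Real.pi * ξ * Complex.I : ℂ) ^ 2)⁻¹ :=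
      funext (fourier_rampExp hσ)
    rw [this]; exact integrable_inv_sq hσ)) v
  rw [← h, Real.fourierInv_eq']
  refine integral_congr_ae (.of_forall fun ξ => ?_)
  simp only [fourier_rampExp hσ, smul_eq_mul]
  congr 2
  simp
  ring

/-- The first Riesz mean of `∑ μ₂(n) / n`. -/
noncomputable def rieszMean (v : ℝ) : ℂ := ∑' n : ℕ, (mobius₂ n : ℂ) / n * ((max (v - Real.log n) 0 : ℝ) : ℂ)

/-- Absolute convergence of the Dirichlet series on Re = 1+σ permits termwise integration against
the Perron kernel. The product ζ(1+S)⁻² S⁻² is then `zInv` at S, which stays regular as σ → 0. -/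
lemma rieszMean_mul_exp {σ : ℝ} (hσ : 0 < σ) (v : ℝ) :
    (Real.exp (-(σ * v)) : ℂ) * rieszMean v =
      ∫ ξ : ℝ, Complex.exp (2 * Real.pi * ξ * v * Complex.I) * zInv (σ + 2 * Real.pi * ξ * Complex.I) := by
  set S : ℝ → ℂ := fun ξ => σ + 2 * Real.pi * ξ * Complex.I with hS
  have hre : ∀ ξ, (1 + S ξ).re = 1 + σ := fun ξ => by simp [hS]
  set F : ℕ → ℝ → ℂ := fun n ξ => LSeries.term (fun n => (mobius₂ n : ℂ)) (1 + S ξ) n *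
    (Complex.exp (2 * Real.pi * ξ * v * Complex.I) * (S ξ ^ 2)⁻¹) with hF
  -- rewriting a term
  have hterm : ∀ n : ℕ, n ≠ 0 → ∀ ξ : ℝ, F n ξ = (mobius₂ n : ℂ) / n * (Real.exp (-(σ * Real.log n)) : ℂ) *
      (Complex.exp (2 * Real.pi * ξ * ((v - Real.log n : ℝ) : ℂ) * Complex.I) * (S ξ ^ 2)⁻¹) := by
    intro n hn ξ
    have hn' : (n : ℂ) ≠ 0 := by exact_mod_cast hn
    simp only [hF, LSeries.term_of_ne_zero hn]
    rw [Complex.cpow_add _ _ hn', Complex.cpow_one, Complex.cpow_def_of_ne_zero hn', ← Complex.natCast_log]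
    have : Complex.exp (2 * Real.pi * ξ * ((v - Real.log n : ℝ) : ℂ) * Complex.I) =
        Complex.exp (2 * Real.pi * ξ * v * Complex.I) * (Complex.exp (Real.log n * (2 * Real.pi * ξ * Complex.I)))⁻¹ := by
      rw [← Complex.exp_neg, ← Complex.exp_add]; congr 1; push_cast; ring
    rw [this]
    have h2 : Complex.exp (Real.log n * S ξ) = Complex.exp (σ * Real.log n) *
        Complex.exp (Real.log n * (2 * Real.pi * ξ * Complex.I)) := by
      rw [← Complex.exp_add]; congr 1; simp only [hS]; ring
    rw [h2]
    push_cast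
    rw [Complex.exp_neg]
    field_simp [Complex.exp_ne_zero]
  have hFint : ∀ n, Integrable (F n) := by
    intro n
    rcases eq_or_ne n 0 with rfl | hn
    · simp [hF]
    · rw [show F n = _ from funext (hterm n hn)]
      refine Integrable.const_mul ?_ _
      refine (integrable_inv_sq hσ).bdd_mul (c := 1) (by fun_prop) (.of_forall fun ξ => ?_)
      rw [show 2 * Real.pi * ξ * ((v - Real.log n : ℝ) : ℂ) * Complex.I =
        ((2 * Real.pi * ξ * (v - Real.log n) : ℝ) : ℂ) * Complex.I by push_cast; ring,
        Complex.norm_exp_ofReal_mul_I]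
  have hFnorm : ∀ n, ∫ ξ, ‖F n ξ‖ = ‖LSeries.term (fun n => (mobius₂ n : ℂ)) (1 + σ : ℂ) n‖ *
      ∫ ξ, ‖(S ξ ^ 2)⁻¹‖ := by
    intro n
    rw [← integral_const_mul]
    refine integral_congr_ae (.of_forall fun ξ => ?_)
    simp only [hF, norm_mul, LSeries.norm_term_eq, hre, Complex.norm_exp]
    simp
  have hsumm : Summable fun n => ∫ ξ, ‖F n ξ‖ := by
    simp only [hFnorm]
    have := (LSeries_mobius₂ (s := 1 + σ) (by simpa using hσ)).1
    exact (this.norm).mul_right _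
  have key := hasSum_integral_of_summable_integral_norm hFint hsumm
  have hval : ∀ n, ∫ ξ, F n ξ = (Real.exp (-(σ * v)) : ℂ) *
      ((mobius₂ n : ℂ) / n * ((max (v - Real.log n) 0 : ℝ) : ℂ)) := by
    intro n
    rcases eq_or_ne n 0 with rfl | hn
    · simp [hF]
    · simp only [hterm n hn]
      rw [integral_const_mul, integral_kernel hσ, rampExp]
      have : Real.exp (-(σ * v)) = Real.exp (-(σ * Real.log n)) * Real.exp (-(σ * (v - Real.log n))) := by
        rw [← Real.exp_add]; congr 1; ring
      rw [this]
      push_cast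
      ring
  have e1 := key.tsum_eq
  simp only [hval, tsum_mul_left] at e1
  rw [rieszMean, e1]
  refine integral_congr_ae (.of_forall fun ξ => ?_)
  simp only [hF, tsum_mul_right]
  have h1 : ∑' n, LSeries.term (fun n => (mobius₂ n : ℂ)) (1 + S ξ) n = (riemannZeta (1 + S ξ) ^ 2)⁻¹ :=
    (LSeries_mobius₂ (s := 1 + S ξ) (by rw [hre]; linarith)).2
  rw [h1]
  have h2 : 1 + S ξ ≠ 1 := by
    intro h; have := hre ξ; rw [h] at this; simp at this; linarith
  rw [zInv, riemannZeta₁_eq_mul h2, add_sub_cancel_left, mul_pow, mul_inv]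
  ring

/-- Dominated convergence as σ → 0⁺: the non-vanishing of ζ on Re s = 1 makes the integrand
continuous up to σ = 0, and its decay is uniform in σ. -/
lemma rieszMean_eq (v : ℝ) : rieszMean v =
    ∫ ξ : ℝ, Complex.exp (2 * Real.pi * ξ * v * Complex.I) * zInv (2 * Real.pi * ξ * Complex.I) := by
  obtain ⟨C, hC⟩ := exists_norm_zInv_le
  have hb : ∀ σ ∈ Set.Icc (0 : ℝ) 1, ∀ ξ : ℝ, ‖zInv (σ + 2 * Real.pi * ξ * Complex.I)‖ ≤
      |C| * (1 + |ξ|) ^ (-(3 / 2) : ℝ) := by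
    intro σ hσ ξ
    have := hC σ hσ (2 * Real.pi * ξ)
    push_cast at this
    refine this.trans ?_
    have h3 : |ξ| ≤ |2 * Real.pi * ξ| := by
      rw [abs_mul, abs_of_pos (by positivity : 0 < 2 * Real.pi)]
      nlinarith [Real.pi_gt_three, abs_nonneg ξ]
    calc _ ≤ |C| * (1 + |2 * Real.pi * ξ|) ^ (-(3 / 2) : ℝ) := by
          gcongr; exact le_abs_self C
      _ ≤ _ := by
          gcongr ?_ * ?_
          exact Real.rpow_le_rpow_of_nonpos (by positivity) (by linarith) (by norm_num)
  have h1 : Tendsto (fun σ : ℝ => ∫ ξ : ℝ, Complex.exp (2 * Real.pi * ξ * v * Complex.I) *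
      zInv (σ + 2 * Real.pi * ξ * Complex.I)) (𝓝[>] 0) (𝓝 (∫ ξ : ℝ,
      Complex.exp (2 * Real.pi * ξ * v * Complex.I) * zInv ((0 : ℝ) + 2 * Real.pi * ξ * Complex.I))) := by
    refine tendsto_integral_filter_of_dominated_convergence
      (fun ξ => |C| * (1 + |ξ|) ^ (-(3 / 2) : ℝ)) ?_ ?_ (integrable_one_add_abs_mul (by norm_num) _) ?_
    · filter_upwards [self_mem_nhdsWithin] with σ hσ
      refine Continuous.aestronglyMeasurable (Continuous.mul (by fun_prop) ?_)
      refine continuous_iff_continuousAt.2 fun ξ => ?_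
      exact ContinuousAt.comp (f := fun ξ : ℝ => (σ + 2 * Real.pi * ξ * Complex.I : ℂ))
        (hasDerivAt_zInv (by simpa using le_of_lt hσ)).continuousAt (by fun_prop)
    · filter_upwards [Ioc_mem_nhdsGT (zero_lt_one' ℝ)] with σ hσ
      refine .of_forall fun ξ => ?_
      rw [norm_mul, Complex.norm_exp]
      simpa using hb σ ⟨hσ.1.le, hσ.2⟩ ξ
    · refine .of_forall fun ξ => Tendsto.const_mul _ ?_
      refine Tendsto.mono_left ?_ nhdsWithin_le_nhds
      exact ContinuousAt.comp (f := fun σ : ℝ => (σ + 2 * Real.pi * ξ * Complex.I : ℂ))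
        (hasDerivAt_zInv (by simp)).continuousAt (by fun_prop)
  have h2 : Tendsto (fun σ : ℝ => (Real.exp (-(σ * v)) : ℂ) * rieszMean v) (𝓝[>] 0)
      (𝓝 ((Real.exp (-(0 * v)) : ℂ) * rieszMean v)) := by
    refine Tendsto.mono_left (Continuous.tendsto ?_ 0) nhdsWithin_le_nhds
    fun_prop
  have h3 := tendsto_nhds_unique (h2.congr' (by
    filter_upwards [self_mem_nhdsWithin] with σ hσ using rieszMean_mul_exp hσ v)) h1
  simpa using h3

/-- The first Riesz mean of `∑ μ₂(n) / n` at `exp v` is `o(1 / v)`. -/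
lemma tendsto_mul_rieszMean : Tendsto (fun v : ℝ => (v : ℂ) * rieszMean v) atTop (𝓝 0) := by
  set g : ℝ → ℂ := fun ξ => zInv (2 * Real.pi * ξ * Complex.I) with hg
  set g' : ℝ → ℂ := fun ξ => -2 * deriv riemannZeta₁ (1 + 2 * Real.pi * ξ * Complex.I) /
    riemannZeta₁ (1 + 2 * Real.pi * ξ * Complex.I) ^ 3 * (2 * Real.pi * Complex.I) with hg'
  have hder : ∀ ξ, HasDerivAt g (g' ξ) ξ := by
    intro ξ
    have h1 : HasDerivAt (fun z : ℂ => 2 * Real.pi * z * Complex.I) (2 * Real.pi * Complex.I) (ξ : ℂ) := by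
      have := (((hasDerivAt_id (ξ : ℂ)).const_mul (2 * Real.pi : ℂ)).mul_const Complex.I)
      simpa using this
    exact ((hasDerivAt_zInv (s := 2 * Real.pi * ξ * Complex.I) (by simp)).comp (ξ : ℂ) h1).comp_ofReal
  have habs : ∀ ξ : ℝ, |ξ| ≤ |2 * Real.pi * ξ| := fun ξ => by
    rw [abs_mul, abs_of_pos (by positivity : 0 < 2 * Real.pi)]
    nlinarith [Real.pi_gt_three, abs_nonneg ξ]
  have hint : Integrable g := by
    obtain ⟨C, hC⟩ := exists_norm_zInv_le
    refine (integrable_one_add_abs_mul (r := 3 / 2) (by norm_num) |C|).mono'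
      (continuous_iff_continuousAt.2 fun ξ => (hder ξ).continuousAt).aestronglyMeasurable
      (.of_forall fun ξ => ?_)
    have := hC 0 (by simp) (2 * Real.pi * ξ)
    push_cast at this
    rw [zero_add] at this
    refine this.trans ((mul_le_mul_of_nonneg_right (le_abs_self C) (by positivity)).trans ?_)
    gcongr ?_ * ?_
    exact Real.rpow_le_rpow_of_nonpos (by positivity) (by linarith [habs ξ]) (by norm_num)
  have hderiv : deriv g = g' := funext fun ξ => (hder ξ).deriv
  have hint' : Integrable (deriv g) := by
    obtain ⟨C, hC⟩ := exists_norm_deriv_zInv_le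
    refine (integrable_one_add_abs_mul (r := 19 / 16) (by norm_num) (|C| * (2 * Real.pi))).mono'
      (aestronglyMeasurable_deriv g _) (.of_forall fun ξ => ?_)
    have := hC 0 (by simp) (2 * Real.pi * ξ)
    push_cast at this
    rw [zero_add] at this
    have e : ‖(2 * Real.pi * Complex.I : ℂ)‖ = 2 * Real.pi := by simp [abs_of_pos Real.pi_pos]
    rw [hderiv, hg', norm_mul, e]
    calc _ ≤ (C * (1 + |2 * Real.pi * ξ|) ^ (-(19 / 16) : ℝ)) * (2 * Real.pi) := by gcongr
      _ ≤ (|C| * (1 + |ξ|) ^ (-(19 / 16) : ℝ)) * (2 * Real.pi) := by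
          refine mul_le_mul_of_nonneg_right ((mul_le_mul_of_nonneg_right (le_abs_self C)
            (by positivity)).trans ?_) (by positivity)
          gcongr ?_ * ?_
          exact Real.rpow_le_rpow_of_nonpos (by positivity) (by linarith [habs ξ]) (by norm_num)
      _ = _ := by ring
  -- Multiplication by v corresponds, up to a constant, to differentiation before the Fourier
  -- transform. The derivative is integrable, so the product tends to 0 by Riemann–Lebesgue; the
  -- transform is evaluated at -v because of the sign in the exponential.
  have hF := Real.fourier_deriv hint (fun ξ => (hder ξ).differentiableAt) hint'
  have hRL := Real.zero_at_infty_fourier (deriv g)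
  have hcomp : Tendsto (fun v : ℝ => -v) atTop (cocompact ℝ) :=
    tendsto_neg_atTop_atBot.mono_right atBot_le_cocompact
  have h2 := (hRL.comp hcomp).const_mul (-(2 * Real.pi * Complex.I : ℂ)⁻¹)
  rw [mul_zero] at h2
  refine h2.congr fun v => ?_
  have e : 𝓕 g (-v) = rieszMean v := by
    rw [rieszMean_eq, Real.fourier_real_eq]
    refine integral_congr_ae (.of_forall fun ξ => ?_)
    simp only [Circle.smul_def, Real.fourierChar_apply, smul_eq_mul, hg]
    congr 2
    push_cast; ring
  simp only [Function.comp_apply, hF, e, smul_eq_mul]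
  have : (Real.pi : ℂ) ≠ 0 := by exact_mod_cast Real.pi_ne_zero
  push_cast
  field_simp

end ZetaInvSq

/-! ### Tauberian step: from the Riesz mean to the partial sums of ∑ μ₂(n)/n -/

namespace ZetaInvSq

lemma abs_mobius₂_le (n : ℕ) : |mobius₂ n| ≤ (n.divisors.card : ℤ) := by
  rw [mobius₂, ArithmeticFunction.mul_apply]
  refine (Finset.abs_sum_le_sum_abs _ _).trans ?_
  have h : ∀ p ∈ n.divisorsAntidiagonal, |ArithmeticFunction.moebius p.1 * ArithmeticFunction.moebius p.2| ≤ 1 := by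
    intro p _
    rw [abs_mul]
    exact mul_le_one₀ ArithmeticFunction.abs_moebius_le_one (abs_nonneg _) ArithmeticFunction.abs_moebius_le_one
  refine (Finset.sum_le_sum h).trans ?_
  rw [Finset.sum_const, nsmul_eq_mul, mul_one, ← Nat.map_div_right_divisors, Finset.card_map]

lemma norm_mobius₂_le (n : ℕ) : ‖(mobius₂ n : ℂ)‖ ≤ n.divisors.card := by
  rw [Complex.norm_intCast]
  exact_mod_cast abs_mobius₂_le n

/-- Of two complementary divisors of n one is at most √n. Bounding it by √M instead makes its range
independent of n, so that the order of summation over n and d can be exchanged. -/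
lemma card_divisors_le {n M : ℕ} (hn : 0 < n) (hM : n ≤ M) :
    n.divisors.card ≤ 2 * ((Finset.Icc 1 M.sqrt).filter (· ∣ n)).card := by
  set A := (Finset.Icc 1 M.sqrt).filter (· ∣ n) with hA
  have hsub : n.divisors ⊆ A ∪ A.image (n / ·) := by
    intro d hd
    have hdn := Nat.dvd_of_mem_divisors hd
    have hd0 : 0 < d := Nat.pos_of_dvd_of_pos hdn hn
    have hs : n.sqrt ≤ M.sqrt := Nat.sqrt_le_sqrt hM
    rw [Finset.mem_union, Finset.mem_image]
    rcases le_or_gt d n.sqrt with h | h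
    · left; simp [hA, hdn]; omega
    · right
      refine ⟨n / d, ?_, Nat.div_div_self hdn hn.ne'⟩
      have h1 : n / d ≤ n.sqrt := by
        have := Nat.lt_succ_sqrt n
        refine Nat.lt_succ_iff.1 (Nat.div_lt_of_lt_mul (this.trans_le ?_))
        exact Nat.mul_le_mul_right _ h
      have h2 : 0 < n / d := Nat.div_pos (Nat.le_of_dvd hn hdn) hd0
      simp [hA, Nat.div_dvd_of_dvd hdn]; omega
  calc _ ≤ _ := Finset.card_le_card hsub
    _ ≤ A.card + (A.image (n / ·)).card := Finset.card_union_le _ _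
    _ ≤ A.card + A.card := Nat.add_le_add_left Finset.card_image_le _
    _ = _ := by ring

lemma card_multiples_Ioc_le {N M d : ℕ} (hNM : N ≤ M) (hd : 0 < d) :
    (((Finset.Ioc N M).filter (d ∣ ·)).card : ℝ) ≤ (M - N) / d + 1 := by
  have h : ((Finset.Ioc 0 N).filter (d ∣ ·)).card + ((Finset.Ioc N M).filter (d ∣ ·)).card =
      ((Finset.Ioc 0 M).filter (d ∣ ·)).card := by
    rw [← Finset.Ioc_union_Ioc_eq_Ioc (Nat.zero_le _) hNM, Finset.filter_union, Finset.card_union_of_disjoint]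
    refine Finset.disjoint_filter_filter (Finset.disjoint_left.2 fun n h1 h2 => ?_)
    rw [Finset.mem_Ioc] at h1 h2; omega
  rw [Nat.Ioc_filter_dvd_card_eq_div, Nat.Ioc_filter_dvd_card_eq_div] at h
  have h' : ((N / d : ℕ) : ℝ) + ((Finset.Ioc N M).filter (d ∣ ·)).card = ((M / d : ℕ) : ℝ) := by
    exact_mod_cast h
  have h1 : ((M / d : ℕ) : ℝ) ≤ M / d := Nat.cast_div_le
  have hd' : (0 : ℝ) < d := by exact_mod_cast hd
  have h2 : (N : ℝ) / d - 1 ≤ ((N / d : ℕ) : ℝ) := by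
    rw [sub_le_iff_le_add, div_le_iff₀ hd']
    have := Nat.lt_succ_iff.2 (Nat.div_add_mod N d).ge
    have h3 := Nat.mod_lt N hd
    have h4 := Nat.div_add_mod N d
    have : N ≤ (N / d + 1) * d := by nlinarith
    exact_mod_cast this
  rw [sub_div]; linarith

/-- The average of the divisor function over a short interval. -/
lemma sum_card_divisors_Ioc_le {N M : ℕ} (hNM : N ≤ M) :
    ∑ n ∈ Finset.Ioc N M, (n.divisors.card : ℝ) ≤ 2 * ((M - N) * (1 + Real.log M) + Real.sqrt M) := by
  have hMN : (0 : ℝ) ≤ M - N := sub_nonneg.2 (by exact_mod_cast hNM)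
  calc ∑ n ∈ Finset.Ioc N M, (n.divisors.card : ℝ)
      ≤ ∑ n ∈ Finset.Ioc N M, 2 * (((Finset.Icc 1 M.sqrt).filter (· ∣ n)).card : ℝ) := by
        refine Finset.sum_le_sum fun n hn => ?_
        rw [Finset.mem_Ioc] at hn
        exact_mod_cast card_divisors_le (by omega) hn.2
    _ = 2 * ∑ d ∈ Finset.Icc 1 M.sqrt, (((Finset.Ioc N M).filter (d ∣ ·)).card : ℝ) := by
        rw [← Finset.mul_sum]
        congr 1
        exact_mod_cast Finset.sum_card_bipartiteAbove_eq_sum_card_bipartiteBelow (fun n d : ℕ => d ∣ n)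
    _ ≤ 2 * ∑ d ∈ Finset.Icc 1 M.sqrt, (((M : ℝ) - N) * (d : ℝ)⁻¹ + 1) := by
        gcongr with d hd
        rw [← div_eq_mul_inv]
        exact card_multiples_Ioc_le hNM (Finset.mem_Icc.1 hd).1
    _ ≤ _ := by
        rw [Finset.sum_add_distrib, ← Finset.mul_sum]
        have h1 : ∑ d ∈ Finset.Icc 1 M.sqrt, (d : ℝ)⁻¹ ≤ 1 + Real.log M := by
          have h := harmonic_le_one_add_log M.sqrt
          rw [harmonic_eq_sum_Icc] at h
          push_cast at h
          refine h.trans ?_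
          rcases Nat.eq_zero_or_pos M with rfl | hM
          · simp
          gcongr
          · exact_mod_cast Nat.sqrt_le_self M
        have h2 : ∑ d ∈ Finset.Icc 1 M.sqrt, (1 : ℝ) ≤ Real.sqrt M := by
          simp only [Finset.sum_const, Nat.card_Icc, nsmul_eq_mul, mul_one, Nat.add_sub_cancel]
          exact Real.nat_sqrt_le_real_sqrt
        gcongr

lemma norm_mobius₂_div_le (n : ℕ) : ‖(mobius₂ n : ℂ) / n‖ ≤ n.divisors.card / n := by
  rw [norm_div, Complex.norm_natCast]
  gcongr
  exact norm_mobius₂_le n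

lemma rieszMean_eq_sum {v : ℝ} {M : ℕ} (hM : v ≤ Real.log (M + 1)) : rieszMean v =
    ∑ n ∈ Finset.Icc 1 M, (mobius₂ n : ℂ) / n * ((max (v - Real.log n) 0 : ℝ) : ℂ) := by
  refine tsum_eq_sum fun n hn => ?_
  rcases Nat.eq_zero_or_pos n with rfl | hn0
  · simp
  · have h1 : M + 1 ≤ n := by
      by_contra h; exact hn (Finset.mem_Icc.2 ⟨hn0, by omega⟩)
    have : Real.log (M + 1) ≤ Real.log n :=
      Real.log_le_log (by positivity) (by exact_mod_cast h1)
    rw [max_eq_right (by linarith)]; simp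

/-- The difference between a partial sum and a difference quotient of the Riesz mean. -/
lemma norm_sum_mobius₂_sub_le {N : ℕ} (hN : 1 ≤ N) {h : ℝ} (h0 : 0 < h) (h1 : h ≤ 1) :
    ‖h * ∑ n ∈ Finset.Icc 1 N, (mobius₂ n : ℂ) / n -
      (rieszMean (Real.log N + h) - rieszMean (Real.log N))‖ ≤
    h * (2 * (2 * h * (2 + Real.log N) + 2 / Real.sqrt N)) := by
  have hN0 : (0 : ℝ) < N := by exact_mod_cast hN
  -- The terms n > M do not enter the Riesz mean at log N + h. From log N to log N + h, the weight
  -- of each n ≤ N grows by exactly h, and each n in (N, M] acquires a weight in [0, h]. The error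
  -- is therefore a sum over (N, M] only.
  set M := ⌊N * Real.exp h⌋₊ with hMdef
  have hexp : Real.exp h ≤ 1 + 2 * h := by
    have := Real.abs_exp_sub_one_le (x := h) (by rw [abs_of_pos h0]; exact h1)
    rw [abs_of_pos h0] at this
    linarith [(abs_le.1 this).2]
  have hexp3 : Real.exp h ≤ Real.exp 1 := Real.exp_le_exp.2 h1
  have hM1 : (M : ℝ) ≤ N * Real.exp h := Nat.floor_le (by positivity)
  have hNM : N ≤ M := Nat.le_floor (by nlinarith [Real.add_one_le_exp h])
  have hNM' : (N : ℝ) ≤ M := by exact_mod_cast hNM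
  have hM0 : (0 : ℝ) < M := by linarith
  have hlogM : Real.log M ≤ Real.log N + h := by
    have := Real.log_le_log hM0 hM1
    rwa [Real.log_mul hN0.ne' (Real.exp_ne_zero _), Real.log_exp] at this
  have hlogM' : Real.log N + h ≤ Real.log (M + 1) := by
    rw [← Real.log_exp h, ← Real.log_mul hN0.ne' (Real.exp_ne_zero _)]
    exact Real.log_le_log (by positivity) (Nat.lt_floor_add_one _).le
  have hlog_le : ∀ {a b : ℕ}, 1 ≤ a → a ≤ b → Real.log a ≤ Real.log b := fun ha hab =>
    Real.log_le_log (by exact_mod_cast ha) (by exact_mod_cast hab)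
  have e1 := rieszMean_eq_sum hlogM'
  have e2 := rieszMean_eq_sum (v := Real.log N) (M := N) (Real.log_le_log hN0 (by linarith))
  have hsplit : Finset.Icc 1 M = Finset.Icc 1 N ∪ Finset.Ioc N M := by
    ext n; simp only [Finset.mem_union, Finset.mem_Icc, Finset.mem_Ioc]; omega
  have hdisj : Disjoint (Finset.Icc 1 N) (Finset.Ioc N M) := by
    rw [Finset.disjoint_left]; intro n hn hn'
    simp only [Finset.mem_Icc, Finset.mem_Ioc] at hn hn'; omega
  rw [hsplit, Finset.sum_union hdisj] at e1
  have e3 : h * ∑ n ∈ Finset.Icc 1 N, (mobius₂ n : ℂ) / n -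
      (rieszMean (Real.log N + h) - rieszMean (Real.log N)) =
      -∑ n ∈ Finset.Ioc N M, (mobius₂ n : ℂ) / n * ((max (Real.log N + h - Real.log n) 0 : ℝ) : ℂ) := by
    have : h * ∑ n ∈ Finset.Icc 1 N, (mobius₂ n : ℂ) / n =
      ∑ n ∈ Finset.Icc 1 N, (mobius₂ n : ℂ) / n * ((max (Real.log N + h - Real.log n) 0 : ℝ) : ℂ) -
      ∑ n ∈ Finset.Icc 1 N, (mobius₂ n : ℂ) / n * ((max (Real.log N - Real.log n) 0 : ℝ) : ℂ) := by
      rw [Finset.mul_sum, ← Finset.sum_sub_distrib]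
      refine Finset.sum_congr rfl fun n hn => ?_
      rw [Finset.mem_Icc] at hn
      have := hlog_le hn.1 hn.2
      rw [max_eq_left (by linarith), max_eq_left (by linarith)]
      push_cast; ring
    rw [e1, e2, this]; ring
  rw [e3, norm_neg]
  calc _ ≤ ∑ n ∈ Finset.Ioc N M, h * ((n.divisors.card : ℝ) / N) := by
        refine norm_sum_le_of_le _ fun n hn => ?_
        rw [Finset.mem_Ioc] at hn
        rw [norm_mul, mul_comm, Complex.norm_real, Real.norm_of_nonneg (le_max_right _ _)]
        have hl := hlog_le hN hn.1.le
        gcongr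
        · exact max_le (by linarith) h0.le
        · refine (norm_mobius₂_div_le n).trans ?_
          gcongr
          exact hn.1.le
    _ = h * ((∑ n ∈ Finset.Ioc N M, (n.divisors.card : ℝ)) / N) := by
        rw [← Finset.mul_sum, Finset.sum_div]
    _ ≤ h * (2 * ((M - N) * (1 + Real.log M) + Real.sqrt M) / N) := by
        gcongr; exact sum_card_divisors_Ioc_le hNM
    _ ≤ _ := by
        gcongr
        rw [mul_div_assoc]
        gcongr
        rw [add_div]
        have hlogN : 0 ≤ Real.log N := Real.log_natCast_nonneg N
        gcongr ?_ + ?_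
        · rw [div_le_iff₀ hN0]
          have a1 : (M : ℝ) - N ≤ 2 * h * N := by nlinarith
          have a2 : 1 + Real.log M ≤ 2 + Real.log N := by linarith
          calc _ ≤ (2 * h * N) * (2 + Real.log N) := by
                apply mul_le_mul a1 a2 _ (by positivity)
                linarith [Real.log_natCast_nonneg M]
            _ = _ := by ring
        · have a3 : Real.sqrt M ≤ 2 * Real.sqrt N := by
            refine Real.sqrt_le_iff.2 ⟨by positivity, ?_⟩
            rw [mul_pow, Real.sq_sqrt hN0.le]
            nlinarith [Real.exp_one_lt_d9]
          have hs : 0 < Real.sqrt N := Real.sqrt_pos.2 hN0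
          rw [div_le_div_iff₀ hN0 hs]
          calc _ ≤ 2 * Real.sqrt N * Real.sqrt N := by gcongr
            _ = 2 * N := by rw [mul_assoc, Real.mul_self_sqrt hN0.le]

/-- `∑ μ₂(n) / n = 0`. -/
theorem tendsto_sum_mobius₂_div : Tendsto (fun N : ℕ => ∑ n ∈ Finset.Icc 1 N, (mobius₂ n : ℂ) / n)
    atTop (𝓝 0) := by
  rw [Metric.tendsto_atTop']
  intro ε hε
  -- The step will be h = δ/log N: short enough that the divisor average, of size log N, contributes
  -- only O(δ), and long enough that the Riesz mean, being o(1/log N), stays small after division by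
  -- h. The divisor term is at most 12δ ≤ ε/2, the square root term is below ε/4, and the two Riesz
  -- means give ε/4.
  set δ := min 1 (ε / 24) with hδ
  have hδ0 : 0 < δ := lt_min one_pos (by positivity)
  have hδ1 : δ ≤ 1 := min_le_left _ _
  have hδ2 : δ ≤ ε / 24 := min_le_right _ _
  have hlog : Tendsto (fun N : ℕ => Real.log N) atTop atTop :=
    Real.tendsto_log_atTop.comp tendsto_natCast_atTop_atTop
  have hsqrt : Tendsto (fun N : ℕ => 2 / Real.sqrt N) atTop (𝓝 0) :=
    (Real.tendsto_sqrt_atTop.comp tendsto_natCast_atTop_atTop).const_div_atTop 2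
  have hA := Metric.tendsto_atTop.1 tendsto_mul_rieszMean (δ * ε / 8) (by positivity)
  obtain ⟨V, hV⟩ := hA
  have ev : ∀ᶠ N : ℕ in atTop, 1 ≤ N ∧ 1 ≤ Real.log N ∧ V ≤ Real.log N ∧ 2 / Real.sqrt N < ε / 8 :=
    (eventually_ge_atTop 1).and ((hlog.eventually_ge_atTop 1).and ((hlog.eventually_ge_atTop V).and
      (hsqrt.eventually_lt_const (by positivity))))
  obtain ⟨N₀, hN₀⟩ := eventually_atTop.1 ev
  refine ⟨N₀, fun N hN => ?_⟩
  obtain ⟨hN1, hl1, hlV, hs⟩ := hN₀ N hN.le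
  set v := Real.log N with hv
  set h := δ / v with hh
  have hv0 : 0 < v := by linarith
  have hh0 : 0 < h := by positivity
  have hh1 : h ≤ 1 := by rw [hh, div_le_one hv0]; linarith
  have key := norm_sum_mobius₂_sub_le hN1 hh0 hh1
  have hr : ∀ u, v ≤ u → ‖rieszMean u‖ ≤ h * ε / 8 := by
    intro u hu
    have h1 := hV u (by linarith)
    rw [dist_zero_right, norm_mul, Complex.norm_real, Real.norm_of_nonneg (by linarith)] at h1
    have h2 : v * ‖rieszMean u‖ ≤ u * ‖rieszMean u‖ := by gcongr
    have h3 : h * ε / 8 = (δ * ε / 8) / v := by rw [hh]; ring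
    rw [h3, le_div_iff₀ hv0]; linarith
  rw [dist_zero_right]
  have hr1 := hr v le_rfl
  have hr2 := hr (v + h) (by linarith)
  set S := ∑ n ∈ Finset.Icc 1 N, (mobius₂ n : ℂ) / n
  have t1 : ‖(h : ℂ) * S‖ ≤ h * (2 * (2 * h * (2 + v) + 2 / Real.sqrt N)) + (h * ε / 8 + h * ε / 8) := by
    have := norm_add_le ((h : ℂ) * S - (rieszMean (v + h) - rieszMean v)) (rieszMean (v + h) - rieszMean v)
    rw [sub_add_cancel] at this
    have h4 := norm_sub_le (rieszMean (v + h)) (rieszMean v)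
    linarith
  rw [norm_mul, Complex.norm_real, Real.norm_of_nonneg hh0.le] at t1
  have hhv : h * (2 + v) ≤ 3 * δ := by
    have : h * v = δ := by rw [hh]; field_simp
    have : h ≤ δ := by rw [hh]; exact div_le_self hδ0.le hl1
    nlinarith
  have t2 : h * ‖S‖ < h * ε := by
    refine t1.trans_lt ?_
    have : 2 * (2 * h * (2 + v) + 2 / Real.sqrt N) < 12 * δ + ε / 4 := by nlinarith
    nlinarith
  exact lt_of_mul_lt_mul_left t2 hh0.le

end ZetaInvSq

/-! ### Residue theorem on rectangles -/

namespace ZetaInvSq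

open MeasureTheory

/-- The integral of `f` over the boundary of the rectangle `[a, b] × [c, d]`, counterclockwise. -/
noncomputable def rectIntegral (f : ℂ → ℂ) (a b c d : ℝ) : ℂ :=
  (∫ x : ℝ in a..b, f (x + c * Complex.I)) - (∫ x : ℝ in a..b, f (x + d * Complex.I)) +
    Complex.I * (∫ y : ℝ in c..d, f (b + y * Complex.I)) -
    Complex.I * (∫ y : ℝ in c..d, f (a + y * Complex.I))

/-- Integrability of `f` along the four sides of a rectangle. -/
def RectIntegrable (f : ℂ → ℂ) (a b c d : ℝ) : Prop :=
  IntervalIntegrable (fun x : ℝ => f (x + c * Complex.I)) volume a b ∧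
  IntervalIntegrable (fun x : ℝ => f (x + d * Complex.I)) volume a b ∧
  IntervalIntegrable (fun y : ℝ => f (b + y * Complex.I)) volume c d ∧
  IntervalIntegrable (fun y : ℝ => f (a + y * Complex.I)) volume c d

variable {f g : ℂ → ℂ} {a b c d : ℝ}

lemma rectIntegral_add (hf : RectIntegrable f a b c d) (hg : RectIntegrable g a b c d) :
    rectIntegral (fun z => f z + g z) a b c d = rectIntegral f a b c d + rectIntegral g a b c d := by
  obtain ⟨h1, h2, h3, h4⟩ := hf
  obtain ⟨k1, k2, k3, k4⟩ := hg
  simp only [rectIntegral]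
  rw [intervalIntegral.integral_add h1 k1, intervalIntegral.integral_add h2 k2,
    intervalIntegral.integral_add h3 k3, intervalIntegral.integral_add h4 k4]
  ring

lemma RectIntegrable.add (hf : RectIntegrable f a b c d) (hg : RectIntegrable g a b c d) :
    RectIntegrable (fun z => f z + g z) a b c d :=
  ⟨hf.1.add hg.1, hf.2.1.add hg.2.1, hf.2.2.1.add hg.2.2.1, hf.2.2.2.add hg.2.2.2⟩

lemma RectIntegrable.const_mul (k : ℂ) (hf : RectIntegrable f a b c d) :
    RectIntegrable (fun z => k * f z) a b c d :=
  ⟨hf.1.const_mul k, hf.2.1.const_mul k, hf.2.2.1.const_mul k, hf.2.2.2.const_mul k⟩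

lemma rectIntegral_const_mul (k : ℂ) :
    rectIntegral (fun z => k * f z) a b c d = k * rectIntegral f a b c d := by
  simp only [rectIntegral, intervalIntegral.integral_const_mul]; ring

lemma RectIntegrable.sum {ι : Type*} {F : ι → ℂ → ℂ} {s : Finset ι}
    (h : ∀ i ∈ s, RectIntegrable (F i) a b c d) : RectIntegrable (fun z => ∑ i ∈ s, F i z) a b c d := by
  classical
  induction s using Finset.induction_on with
  | empty => simp [RectIntegrable]
  | insert i s hi ih =>
    simp only [Finset.sum_insert hi]
    exact (h i (Finset.mem_insert_self i s)).add (ih fun j hj => h j (Finset.mem_insert_of_mem hj))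

lemma rectIntegral_sum {ι : Type*} {F : ι → ℂ → ℂ} {s : Finset ι}
    (h : ∀ i ∈ s, RectIntegrable (F i) a b c d) :
    rectIntegral (fun z => ∑ i ∈ s, F i z) a b c d = ∑ i ∈ s, rectIntegral (F i) a b c d := by
  classical
  induction s using Finset.induction_on with
  | empty => simp [rectIntegral]
  | insert i s hi ih =>
    simp only [Finset.sum_insert hi]
    have h' := fun j hj => h j (Finset.mem_insert_of_mem (a := j) (b := i) hj)
    rw [rectIntegral_add (h i (Finset.mem_insert_self i s)) (RectIntegrable.sum h'), ih h']

/-- The closed rectangle `[a, b] × [c, d]` without its interior. -/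
def rectBoundary (a b c d : ℝ) : Set ℂ :=
  (Set.Icc a b ×ℂ Set.Icc c d) \ (Set.Ioo a b ×ℂ Set.Ioo c d)

lemma sides_mem (hab : a ≤ b) (hcd : c ≤ d) :
    (∀ x ∈ Set.Icc a b, (x + c * Complex.I : ℂ) ∈ rectBoundary a b c d) ∧
    (∀ x ∈ Set.Icc a b, (x + d * Complex.I : ℂ) ∈ rectBoundary a b c d) ∧
    (∀ y ∈ Set.Icc c d, (b + y * Complex.I : ℂ) ∈ rectBoundary a b c d) ∧
    (∀ y ∈ Set.Icc c d, (a + y * Complex.I : ℂ) ∈ rectBoundary a b c d) := by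
  refine ⟨?_, ?_, ?_, ?_⟩ <;>
  · rintro x ⟨h1, h2⟩
    simp [rectBoundary, Complex.mem_reProdIm]
    grind

lemma rectIntegrable_of_continuousOn (hab : a ≤ b) (hcd : c ≤ d)
    (h : ContinuousOn f (rectBoundary a b c d)) : RectIntegrable f a b c d := by
  obtain ⟨h1, h2, h3, h4⟩ := sides_mem hab hcd
  refine ⟨?_, ?_, ?_, ?_⟩ <;> refine ContinuousOn.intervalIntegrable (h.comp (by fun_prop) ?_)
  · rw [Set.uIcc_of_le hab]; exact h1
  · rw [Set.uIcc_of_le hab]; exact h2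
  · rw [Set.uIcc_of_le hcd]; exact h3
  · rw [Set.uIcc_of_le hcd]; exact h4

lemma rectIntegral_congr (hab : a ≤ b) (hcd : c ≤ d) (h : Set.EqOn f g (rectBoundary a b c d)) :
    rectIntegral f a b c d = rectIntegral g a b c d := by
  obtain ⟨h1, h2, h3, h4⟩ := sides_mem hab hcd
  rw [rectIntegral, rectIntegral]
  congr 1
  · congr 1
    · congr 1
      · exact intervalIntegral.integral_congr fun x hx => h (h1 x (by rwa [Set.uIcc_of_le hab] at hx))
      · exact intervalIntegral.integral_congr fun x hx => h (h2 x (by rwa [Set.uIcc_of_le hab] at hx))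
    · congr 1
      exact intervalIntegral.integral_congr fun x hx => h (h3 x (by rwa [Set.uIcc_of_le hcd] at hx))
  · congr 1
    exact intervalIntegral.integral_congr fun x hx => h (h4 x (by rwa [Set.uIcc_of_le hcd] at hx))

lemma rectIntegral_eq_zero (hab : a ≤ b) (hcd : c ≤ d)
    (h : DifferentiableOn ℂ f (Set.Icc a b ×ℂ Set.Icc c d)) : rectIntegral f a b c d = 0 := by
  have := Complex.integral_boundary_rect_eq_zero_of_differentiableOn f (a + c * Complex.I) (b + d * Complex.I)
    (by simpa [Set.uIcc_of_le hab, Set.uIcc_of_le hcd] using h)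
  simpa [rectIntegral] using this

lemma integral_horizontal {F : ℂ → ℂ} {k : ℝ} (hab : a ≤ b)
    (hF : ∀ x ∈ Set.Icc a b, HasDerivAt F (f (x + k * Complex.I)) (x + k * Complex.I))
    (hc : ContinuousOn (fun x : ℝ => f (x + k * Complex.I)) (Set.Icc a b)) :
    ∫ x : ℝ in a..b, f (x + k * Complex.I) = F (b + k * Complex.I) - F (a + k * Complex.I) := by
  refine intervalIntegral.integral_eq_sub_of_hasDerivAt (f := fun x : ℝ => F (x + k * Complex.I)) (fun x hx => ?_)
    (ContinuousOn.intervalIntegrable (by rwa [Set.uIcc_of_le hab]))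
  rw [Set.uIcc_of_le hab] at hx
  have := (hF x hx).comp (x : ℂ) ((hasDerivAt_id (x : ℂ)).add_const (k * Complex.I))
  simpa using this.comp_ofReal

lemma integral_vertical {F : ℂ → ℂ} {k : ℝ} (hab : a ≤ b)
    (hF : ∀ x ∈ Set.Icc a b, HasDerivAt F (f (k + x * Complex.I)) (k + x * Complex.I))
    (hc : ContinuousOn (fun x : ℝ => f (k + x * Complex.I)) (Set.Icc a b)) :
    Complex.I * ∫ x : ℝ in a..b, f (k + x * Complex.I) = F (k + b * Complex.I) - F (k + a * Complex.I) := by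
  rw [← intervalIntegral.integral_const_mul]
  refine intervalIntegral.integral_eq_sub_of_hasDerivAt (f := fun x : ℝ => F (k + x * Complex.I)) (fun x hx => ?_)
    (ContinuousOn.intervalIntegrable (by rw [Set.uIcc_of_le hab]; exact continuousOn_const.mul hc))
  rw [Set.uIcc_of_le hab] at hx
  have h2 : HasDerivAt (fun z : ℂ => k + z * Complex.I) Complex.I (x : ℂ) := by
    simpa using ((hasDerivAt_id (x : ℂ)).mul_const Complex.I).const_add (k : ℂ)
  have := (hF x hx).comp (x : ℂ) h2
  rw [mul_comm]
  simpa using this.comp_ofReal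

lemma rectIntegral_eq_zero_of_primitive {F : ℂ → ℂ} (hab : a ≤ b) (hcd : c ≤ d)
    (hF : ∀ z ∈ rectBoundary a b c d, HasDerivAt F (f z) z)
    (hc : ContinuousOn f (rectBoundary a b c d)) : rectIntegral f a b c d = 0 := by
  obtain ⟨h1, h2, h3, h4⟩ := sides_mem hab hcd
  rw [rectIntegral, integral_horizontal hab (fun x hx => hF _ (h1 x hx)) (hc.comp (by fun_prop) h1),
    integral_horizontal hab (fun x hx => hF _ (h2 x hx)) (hc.comp (by fun_prop) h2),
    integral_vertical hcd (fun x hx => hF _ (h3 x hx)) (hc.comp (by fun_prop) h3),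
    integral_vertical hcd (fun x hx => hF _ (h4 x hx)) (hc.comp (by fun_prop) h4)]
  ring

variable {p : ℂ}

lemma sub_ne_zero_of_mem_rectBoundary (hp : p ∈ Set.Ioo a b ×ℂ Set.Ioo c d) {z : ℂ}
    (hz : z ∈ rectBoundary a b c d) : z - p ≠ 0 := by
  intro h
  rw [sub_eq_zero] at h
  exact hz.2 (h ▸ hp)

lemma continuousOn_inv_sub (hp : p ∈ Set.Ioo a b ×ℂ Set.Ioo c d) :
    ContinuousOn (fun z => (z - p)⁻¹) (rectBoundary a b c d) :=
  ContinuousOn.inv₀ (by fun_prop) fun _ hz => sub_ne_zero_of_mem_rectBoundary hp hz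

lemma rectIntegral_inv_sub_sq (hp : p ∈ Set.Ioo a b ×ℂ Set.Ioo c d) :
    rectIntegral (fun z => ((z - p) ^ 2)⁻¹) a b c d = 0 := by
  have h := Complex.mem_reProdIm.1 hp
  refine rectIntegral_eq_zero_of_primitive (F := fun z => -(z - p)⁻¹) (h.1.1.trans h.1.2).le (h.2.1.trans h.2.2).le
    (fun z hz => ?_) ?_
  · have hz' := sub_ne_zero_of_mem_rectBoundary hp hz
    have := (((hasDerivAt_id z).sub_const p).inv hz').neg
    convert! this using 1
    simp [neg_div]
  · simp only [← inv_pow]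
    exact (continuousOn_inv_sub hp).pow 2

/-- The principal logarithm of z - p is a primitive on the lower, upper and right sides. The left
side crosses its cut, and there log(-(z - p)) is used. The two differ by ±πi at the two left
corners, which adds up to 2πi. -/
lemma rectIntegral_inv_sub (hp : p ∈ Set.Ioo a b ×ℂ Set.Ioo c d) :
    rectIntegral (fun z => (z - p)⁻¹) a b c d = 2 * Real.pi * Complex.I := by
  obtain ⟨⟨ha, hb⟩, hc, hd⟩ := Complex.mem_reProdIm.1 hp
  have hab : a ≤ b := (ha.trans hb).le
  have hcd : c ≤ d := (hc.trans hd).le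
  obtain ⟨h1, h2, h3, h4⟩ := sides_mem hab hcd
  have hcont := continuousOn_inv_sub hp
  have hlog : ∀ z : ℂ, z - p ∈ Complex.slitPlane → HasDerivAt (fun z => Complex.log (z - p)) (z - p)⁻¹ z := by
    intro z hz
    have := ((hasDerivAt_id z).sub_const p).clog hz
    simpa using this
  have hlog' : ∀ z : ℂ, -(z - p) ∈ Complex.slitPlane → HasDerivAt (fun z => Complex.log (-(z - p))) (z - p)⁻¹ z := by
    intro z hz
    have := (((hasDerivAt_id z).sub_const p).neg).clog hz
    convert! this using 1
    simp only [Pi.neg_apply, id, neg_div_neg_eq, one_div]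
  have s1 : ∫ x : ℝ in a..b, (x + c * Complex.I - p)⁻¹ = _ :=
    integral_horizontal (f := fun z => (z - p)⁻¹) (F := fun z => Complex.log (z - p)) hab
      (fun x _ => hlog _ (Or.inr (by simp; linarith))) (hcont.comp (by fun_prop) h1)
  have s2 : ∫ x : ℝ in a..b, (x + d * Complex.I - p)⁻¹ = _ :=
    integral_horizontal (f := fun z => (z - p)⁻¹) (F := fun z => Complex.log (z - p)) hab
      (fun x _ => hlog _ (Or.inr (by simp; linarith))) (hcont.comp (by fun_prop) h2)
  have s3 : Complex.I * ∫ y : ℝ in c..d, (b + y * Complex.I - p)⁻¹ = _ :=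
    integral_vertical (f := fun z => (z - p)⁻¹) (F := fun z => Complex.log (z - p)) hcd
      (fun x _ => hlog _ (Or.inl (by simpa using hb))) (hcont.comp (by fun_prop) h3)
  have s4 : Complex.I * ∫ y : ℝ in c..d, (a + y * Complex.I - p)⁻¹ = _ :=
    integral_vertical (f := fun z => (z - p)⁻¹) (F := fun z => Complex.log (-(z - p))) hcd
      (fun x _ => hlog' _ (Or.inl (by simpa using ha))) (hcont.comp (by fun_prop) h4)
  rw [rectIntegral, s1, s2, s3, s4]
  have e1 : Complex.log (-(a + d * Complex.I - p)) = Complex.log (a + d * Complex.I - p) - Real.pi * Complex.I := by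
    rw [Complex.log, Complex.log, norm_neg, Complex.arg_neg_eq_arg_sub_pi_of_im_pos (by simpa using hd)]
    push_cast; ring
  have e2 : Complex.log (-(a + c * Complex.I - p)) = Complex.log (a + c * Complex.I - p) + Real.pi * Complex.I := by
    rw [Complex.log, Complex.log, norm_neg, Complex.arg_neg_eq_arg_add_pi_of_im_neg (by simpa using hc)]
    push_cast; ring
  simp only [e1, e2]
  ring

/-- The residue theorem on a rectangle, for poles of order at most two. -/
theorem rectIntegral_eq_sum_residues (hab : a ≤ b) (hcd : c ≤ d) (S : Finset ℂ)
    (hS : ∀ p ∈ S, p ∈ Set.Ioo a b ×ℂ Set.Ioo c d)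
    (hf : ∀ z ∈ Set.Icc a b ×ℂ Set.Icc c d, z ∉ S → DifferentiableAt ℂ f z)
    (h : ℂ → ℂ → ℂ) (hh : ∀ p ∈ S, AnalyticAt ℂ (h p) p)
    (hfh : ∀ p ∈ S, ∀ᶠ z in 𝓝[≠] p, f z = h p z / (z - p) ^ 2) :
    rectIntegral f a b c d = 2 * Real.pi * Complex.I * ∑ p ∈ S, deriv (h p) p := by
  classical
  set P : ℂ → ℂ → ℂ := fun p z => h p p * ((z - p) ^ 2)⁻¹ + deriv (h p) p * (z - p)⁻¹ with hP
  set G : ℂ → ℂ := fun z => f z - ∑ p ∈ S, P p z with hG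
  -- Without its principal parts, f has only removable singularities. The values at the points of S
  -- are replaced by punctured limits, because f may take arbitrary values there.
  set G' : ℂ → ℂ := fun z => if z ∈ S then limUnder (𝓝[≠] z) G else G z with hG'
  have hPd : ∀ p z, z ≠ p → DifferentiableAt ℂ (P p) z := by
    intro p z hz
    have : z - p ≠ 0 := sub_ne_zero.2 hz
    change DifferentiableAt ℂ (fun z => h p p * ((z - p) ^ 2)⁻¹ + deriv (h p) p * (z - p)⁻¹) z
    fun_prop (disch := simpa using this)
  have hoff : ∀ z : ℂ, ∀ᶠ w in 𝓝[≠] z, w ∉ S := by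
    intro z
    have : ∀ᶠ w in 𝓝 z, w ∉ (S.erase z : Set ℂ) :=
      (Finset.finite_toSet _).isClosed.isOpen_compl.mem_nhds (by simp)
    filter_upwards [nhdsWithin_le_nhds this, self_mem_nhdsWithin] with w hw hne hmem
    exact hw (by simp [hmem]; exact hne)
  have hG'd : ∀ z ∈ Set.Icc a b ×ℂ Set.Icc c d, DifferentiableAt ℂ G' z := by
    intro z hz
    by_cases hzS : z ∈ S
    · set k : ℂ → ℂ := fun w => dslope (dslope (h z) z) z w - ∑ q ∈ S.erase z, P q w with hk
      obtain ⟨U, hU, hdU⟩ := (hh z hzS).exists_mem_nhds_analyticOnNhd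
      have hkd : DifferentiableAt ℂ k z := by
        refine DifferentiableAt.sub ?_ (DifferentiableAt.fun_sum fun q hq =>
          hPd q z (Finset.ne_of_mem_erase hq).symm)
        have hd1 : DifferentiableOn ℂ (h z) U := hdU.differentiableOn
        exact ((Complex.differentiableOn_dslope hU).2
          ((Complex.differentiableOn_dslope hU).2 hd1)).differentiableAt hU
      have hGk : ∀ᶠ w in 𝓝[≠] z, G w = k w := by
        filter_upwards [hfh z hzS, self_mem_nhdsWithin] with w hw hne
        have hne' : w - z ≠ 0 := sub_ne_zero.2 hne
        simp only [hG, hk]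
        rw [← Finset.add_sum_erase S (fun p => P p w) hzS, dslope_of_ne _ hne, slope_def_field,
          dslope_of_ne _ hne, slope_def_field, dslope_same, hw]
        simp only [hP]
        field_simp
        ring
      have hlim : limUnder (𝓝[≠] z) G = k z :=
        Tendsto.limUnder_eq ((hkd.continuousAt.tendsto.mono_left nhdsWithin_le_nhds).congr'
          (hGk.mono fun _ h => h.symm))
      refine hkd.congr_of_eventuallyEq ?_
      filter_upwards [eventually_nhdsWithin_iff.1 (hGk.and (hoff z))] with w hw
      by_cases hwz : w = z
      · simp only [hG', hwz, if_pos hzS, hlim]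
      · simp only [hG', if_neg (hw hwz).2, (hw hwz).1]
    · have hGd : DifferentiableAt ℂ G z :=
        (hf z hz hzS).sub (DifferentiableAt.fun_sum fun q hq => hPd q z fun h => hzS (h ▸ hq))
      refine hGd.congr_of_eventuallyEq ?_
      filter_upwards [(Finset.finite_toSet S).isClosed.isOpen_compl.mem_nhds (show z ∈ (S : Set ℂ)ᶜ from hzS)]
        with w hw
      exact if_neg fun h => hw h
  have hbS : ∀ z ∈ rectBoundary a b c d, z ∉ S := fun z hz hzS => hz.2 (hS z hzS)
  have h0 : rectIntegral G a b c d = 0 := by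
    rw [← rectIntegral_eq_zero hab hcd fun z hz => (hG'd z hz).differentiableWithinAt]
    refine rectIntegral_congr hab hcd fun z hz => ?_
    simp only [hG', if_neg (hbS z hz)]
  have hPI : ∀ p ∈ S, RectIntegrable (P p) a b c d ∧
      rectIntegral (P p) a b c d = 2 * Real.pi * Complex.I * deriv (h p) p := by
    intro p hp
    have hc1 := continuousOn_inv_sub (hS p hp)
    have i1 : RectIntegrable (fun z => ((z - p) ^ 2)⁻¹) a b c d := by
      refine rectIntegrable_of_continuousOn hab hcd ?_
      simp only [← inv_pow]; exact hc1.pow 2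
    have i2 : RectIntegrable (fun z => (z - p)⁻¹) a b c d := rectIntegrable_of_continuousOn hab hcd hc1
    refine ⟨(i1.const_mul _).add (i2.const_mul _), ?_⟩
    simp only [hP]
    rw [rectIntegral_add (i1.const_mul _) (i2.const_mul _), rectIntegral_const_mul, rectIntegral_const_mul,
      rectIntegral_inv_sub_sq (hS p hp), rectIntegral_inv_sub (hS p hp)]
    ring
  have hGI : RectIntegrable G a b c d := by
    refine rectIntegrable_of_continuousOn hab hcd fun z hz => ContinuousAt.continuousWithinAt ?_
    exact ((hf z hz.1 (hbS z hz)).sub (DifferentiableAt.fun_sum fun q hq =>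
      hPd q z fun h => hbS z hz (h ▸ hq))).continuousAt
  have hfG : f = fun z => G z + ∑ p ∈ S, P p z := by funext z; simp [hG]
  rw [hfG, rectIntegral_add hGI (RectIntegrable.sum fun p hp => (hPI p hp).1), h0,
    rectIntegral_sum fun p hp => (hPI p hp).1, Finset.sum_congr rfl fun p hp => (hPI p hp).2,
    ← Finset.mul_sum, zero_add]

end ZetaInvSq

/-! ### Uniform decay of Γ in strips and the hyperbolic Beta integral -/

namespace ZetaInvSq

open MeasureTheory

lemma norm_cpow_neg {v : ℂ} (hv : v ≠ 0) (s : ℂ) :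
    ‖v ^ (-s)‖ = ‖v‖ ^ (-s.re) * Real.exp (v.arg * s.im) := by
  rw [Complex.norm_cpow_of_ne_zero hv]
  simp [← Real.exp_neg, div_eq_mul_inv]

lemma integrable_exp_neg_mul_abs {ε : ℝ} (hε : 0 < ε) : Integrable fun y : ℝ => Real.exp (-ε * |y|) := by
  have h1 : IntegrableOn (fun y : ℝ => Real.exp (-ε * |y|)) (Set.Ioi 0) :=
    (exp_neg_integrableOn_Ioi 0 hε).congr_fun (fun y hy => by rw [abs_of_pos hy]) measurableSet_Ioi
  have h2 : IntegrableOn (fun y : ℝ => Real.exp (-ε * |y|)) (Set.Iic 0) := by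
    rw [integrableOn_Iic_iff_integrableOn_Iio]
    have := h1.comp_neg
    simpa using this
  have := h2.union h1
  rwa [Set.Iic_union_Ioi, integrableOn_univ] at this

/-- Exponential decay of `Γ`, uniformly in vertical strips. -/
lemma exists_norm_Gamma_le {α β θ : ℝ} (hα : 0 < α) (h0 : 0 ≤ θ) (hθ : θ < Real.pi / 2) :
    ∃ K : ℝ, 0 < K ∧ ∀ a : ℂ, α ≤ a.re → a.re ≤ β → ‖Complex.Gamma a‖ ≤ K * Real.exp (-θ * |a.im|) := by
  have hcos : 0 < Real.cos θ := Real.cos_pos_of_mem_Ioo ⟨by linarith, hθ⟩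
  have hc : ContinuousOn (fun σ : ℝ => (Real.cos θ) ^ (-σ) * Real.Gamma σ) (Set.Icc α β) := by
    intro σ hσ
    have hσ0 : 0 < σ := hα.trans_le hσ.1
    refine ContinuousAt.continuousWithinAt (ContinuousAt.mul ?_ ?_)
    · exact (Real.continuousAt_const_rpow hcos.ne').comp (by fun_prop)
    · exact (Real.differentiableAt_Gamma fun m => (by linarith [(m.cast_nonneg : (0 : ℝ) ≤ m)] : -(m : ℝ) < σ).ne').continuousAt
  obtain ⟨K, hK⟩ := isCompact_Icc.exists_bound_of_continuousOn hc
  refine ⟨|K| + 1, by positivity, fun a h1 h2 => ?_⟩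
  have ha : 0 < a.re := hα.trans_le h1
  have hK' := (le_abs_self _).trans ((hK a.re ⟨h1, h2⟩).trans (le_abs_self K))
  have habs : |θ| < Real.pi / 2 := by rwa [abs_of_nonneg h0]
  have hb : ‖Complex.Gamma a‖ ≤ Real.exp (-θ * |a.im|) * ((Real.cos θ) ^ (-a.re) * Real.Gamma a.re) := by
    rcases le_total 0 a.im with hi | hi
    · have := norm_Gamma_le ha habs
      rwa [← neg_mul, ← abs_of_nonneg hi] at this
    · have := norm_Gamma_le ha (θ := -θ) (by rwa [abs_neg])
      rw [Real.cos_neg, ← neg_mul, neg_neg] at this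
      rwa [abs_of_nonpos hi, neg_mul_neg]
  rw [mul_comm]
  exact hb.trans (by gcongr; linarith)

lemma ofReal_rpow_mul_cpow {y : ℝ} (hy : 0 < y) (s : ℂ) :
    ((y ^ (-2 : ℝ) : ℝ) : ℂ) * ((y ^ (-2 : ℝ) : ℝ) : ℂ) ^ (s / 2 - 1) = (y : ℂ) ^ (-s) := by
  have hne : ((y ^ (-2 : ℝ) : ℝ) : ℂ) ≠ 0 := by
    exact Complex.ofReal_ne_zero.2 (Real.rpow_pos_of_pos hy _).ne'
  rw [Complex.cpow_sub _ _ hne, Complex.cpow_one, mul_div_cancel₀ _ hne, Complex.cpow_def_of_ne_zero hne,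
    Complex.cpow_def_of_ne_zero (by exact_mod_cast hy.ne'), ← Complex.ofReal_log hy.le,
    ← Complex.ofReal_log (Real.rpow_pos_of_pos hy _).le, Real.log_rpow hy]
  congr 1
  push_cast
  ring

lemma norm_two_cosh_cpow_neg (s : ℂ) (t : ℝ) :
    ‖((2 * Real.cosh t : ℝ) : ℂ) ^ (-s)‖ = (2 * Real.cosh t) ^ (-s.re) := by
  rw [Complex.norm_cpow_eq_rpow_re_of_pos (by positivity), Complex.neg_re]

lemma integrableOn_two_cosh_rpow {σ : ℝ} (hσ : 0 < σ) :
    IntegrableOn (fun t : ℝ => (2 * Real.cosh t) ^ (-σ)) (Set.Ioi 0) := by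
  refine Integrable.mono' (exp_neg_integrableOn_Ioi 0 hσ) ?_ (ae_of_all _ fun t => ?_)
  · refine Measurable.aestronglyMeasurable ?_
    exact (Real.continuous_cosh.measurable.const_mul 2).pow_const _
  · have h : Real.exp t ≤ 2 * Real.cosh t := by
      rw [Real.cosh_eq]
      linarith [Real.exp_pos (-t)]
    rw [Real.norm_of_nonneg (by positivity), mul_comm (-σ) t, Real.exp_mul]
    exact Real.rpow_le_rpow_of_nonpos (Real.exp_pos t) h (neg_nonpos.2 hσ.le)

lemma integrableOn_two_cosh_cpow {s : ℂ} (hs : 0 < s.re) :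
    IntegrableOn (fun t : ℝ => ((2 * Real.cosh t : ℝ) : ℂ) ^ (-s)) (Set.Ioi 0) := by
  refine Integrable.mono' (integrableOn_two_cosh_rpow hs) ?_
    (ae_of_all _ fun t => (norm_two_cosh_cpow_neg s t).le)
  have : Continuous fun t : ℝ => 2 * Real.cosh t := by fun_prop
  exact (Complex.measurable_ofReal.comp this.measurable |>.pow_const _).aestronglyMeasurable

/-- The Beta integral in hyperbolic form. -/
lemma integral_two_cosh_cpow {s : ℂ} (hs : 0 < s.re) :
    ∫ t : ℝ in Set.Ioi 0, ((2 * Real.cosh t : ℝ) : ℂ) ^ (-s) =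
      1 / 4 * (Complex.Gamma (s / 2) ^ 2 / Complex.Gamma s) := by
  have hs2 : 0 < (s / 2).re := by simpa using hs
  have hG := Complex.Gamma_mul_Gamma_eq_betaIntegral hs2 hs2
  rw [add_halves, Complex.betaIntegral, intervalIntegral.integral_of_le zero_le_one,
    integral_Ioc_eq_integral_Ioo] at hG
  -- The substitution u = sigmoid(2t) maps ℝ onto (0, 1) with u(1-u) = (2 cosh t)⁻² and du = 2u(1-u)
  -- dt. It turns B(s/2, s/2) into twice the integral of (2 cosh t)^(-s) over ℝ.
  have himg : (fun t : ℝ => Real.sigmoid (2 * t)) '' Set.univ = Set.Ioo 0 1 := by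
    rw [Set.image_univ, ← Real.range_sigmoid]
    exact (mul_left_surjective₀ two_ne_zero).range_comp Real.sigmoid
  have hder : ∀ t ∈ (Set.univ : Set ℝ), HasDerivWithinAt (fun t : ℝ => Real.sigmoid (2 * t))
      (Real.sigmoid (2 * t) * (1 - Real.sigmoid (2 * t)) * 2) Set.univ t := by
    intro t _
    have h := (Real.hasDerivAt_sigmoid (2 * t)).comp t ((hasDerivAt_id t).const_mul 2)
    simp only [mul_one] at h
    exact h.hasDerivWithinAt
  have hinj : Set.InjOn (fun t : ℝ => Real.sigmoid (2 * t)) Set.univ := by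
    intro x _ y _ h
    have := Real.sigmoid_injective h
    linarith
  rw [← himg, integral_image_eq_integral_abs_deriv_smul MeasurableSet.univ hder hinj] at hG
  have hint : ∀ t : ℝ, |Real.sigmoid (2 * t) * (1 - Real.sigmoid (2 * t)) * 2| •
      (((Real.sigmoid (2 * t) : ℝ) : ℂ) ^ (s / 2 - 1) * (1 - ((Real.sigmoid (2 * t) : ℝ) : ℂ)) ^ (s / 2 - 1))
      = 2 * ((2 * Real.cosh |t| : ℝ) : ℂ) ^ (-s) := by
    intro t
    have h1 := Real.sigmoid_pos (2 * t)
    have h2 : 0 < 1 - Real.sigmoid (2 * t) := sub_pos.2 (Real.sigmoid_lt_one _)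
    have hc : 0 < 2 * Real.cosh t := by positivity
    have e1 : Real.sigmoid (2 * t) * (1 - Real.sigmoid (2 * t)) = (2 * Real.cosh t) ^ (-2 : ℝ) := by
      rw [← Real.sigmoid_neg, Real.sigmoid_def, Real.sigmoid_def, ← mul_inv, Real.rpow_neg hc.le, inv_inj]
      rw [neg_neg, Real.cosh_eq, Real.exp_neg, Real.exp_neg, show 2 * t = t + t by ring, Real.exp_add,
        Real.rpow_two]
      have := Real.exp_pos t
      field_simp
      ring
    rw [abs_of_pos (by positivity), Complex.real_smul,
      show (1 - ((Real.sigmoid (2 * t) : ℝ) : ℂ)) = ((1 - Real.sigmoid (2 * t) : ℝ) : ℂ) by push_cast; rfl,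
      ← Complex.mul_cpow_ofReal_nonneg h1.le h2.le, ← Complex.ofReal_mul, e1, Real.cosh_abs]
    have e2 := ofReal_rpow_mul_cpow hc s
    rw [Complex.ofReal_mul, Complex.ofReal_ofNat, mul_comm _ (2 : ℂ), mul_assoc, e2]
  have hsplit : ∫ t : ℝ, 2 * ((2 * Real.cosh |t| : ℝ) : ℂ) ^ (-s) =
      4 * ∫ t : ℝ in Set.Ioi 0, ((2 * Real.cosh t : ℝ) : ℂ) ^ (-s) := by
    have hi : IntegrableOn (fun t : ℝ => ((2 * Real.cosh t : ℝ) : ℂ) ^ (-s)) (Set.Ioi 0) :=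
      integrableOn_two_cosh_cpow hs
    have h1 : ∫ t : ℝ in Set.Ioi 0, 2 * ((2 * Real.cosh |t| : ℝ) : ℂ) ^ (-s) =
        2 * ∫ t : ℝ in Set.Ioi 0, ((2 * Real.cosh t : ℝ) : ℂ) ^ (-s) := by
      simp_rw [Real.cosh_abs]
      exact integral_const_mul _ _
    have h2 := integral_comp_neg_Ioi 0 (fun t : ℝ => 2 * ((2 * Real.cosh |t| : ℝ) : ℂ) ^ (-s))
    simp only [abs_neg, neg_zero] at h2
    have hi1 : IntegrableOn (fun t : ℝ => 2 * ((2 * Real.cosh |t| : ℝ) : ℂ) ^ (-s)) (Set.Ioi 0) := by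
      simp_rw [Real.cosh_abs]
      exact hi.const_mul 2
    have hi2 : IntegrableOn (fun t : ℝ => 2 * ((2 * Real.cosh |t| : ℝ) : ℂ) ^ (-s)) (Set.Iic 0) := by
      rw [integrableOn_Iic_iff_integrableOn_Iio]
      have := hi1.comp_neg
      simpa using this
    rw [← setIntegral_univ, ← Set.Iic_union_Ioi (a := (0 : ℝ)),
      setIntegral_union (Set.Iic_disjoint_Ioi le_rfl) measurableSet_Ioi hi2 hi1, ← h2, h1]
    ring
  simp_rw [hint] at hG
  rw [setIntegral_univ, hsplit] at hG
  have := Complex.Gamma_ne_zero_of_re_pos hs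
  field_simp
  linear_combination -hG

end ZetaInvSq

/-! ### Mellin–Barnes integral for K₀ -/

namespace ZetaInvSq

open MeasureTheory

lemma integrable_of_norm_le_exp_neg_mul_abs {f : ℝ → ℂ} (hf : Continuous f) {C ε : ℝ} (hε : 0 < ε)
    (h : ∀ y, ‖f y‖ ≤ C * Real.exp (-ε * |y|)) : Integrable f :=
  ((integrable_exp_neg_mul_abs hε).const_mul C).mono' hf.aestronglyMeasurable (ae_of_all _ h)

lemma exists_abs_arg_lt {v : ℂ} (hv : 0 < v.re) : ∃ θ, |v.arg| < θ ∧ 0 ≤ θ ∧ θ < Real.pi / 2 := by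
  obtain ⟨θ, h1, h2⟩ := exists_between
    ((Complex.abs_arg_lt_pi_div_two_iff).2 (Or.inl hv))
  exact ⟨θ, h1, (abs_nonneg _).trans h1.le, h2⟩

lemma norm_cpow_neg_le {v : ℂ} (hv : v ≠ 0) (s : ℂ) :
    ‖v ^ (-s)‖ ≤ ‖v‖ ^ (-s.re) * Real.exp (|v.arg| * |s.im|) := by
  rw [norm_cpow_neg hv, ← abs_mul]
  gcongr
  exact le_abs_self _

lemma ofReal_mul_cpow {r : ℝ} (hr : 0 < r) {v : ℂ} (hv : v ≠ 0) (s : ℂ) :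
    ((r : ℂ) * v) ^ s = (r : ℂ) ^ s * v ^ s := by
  have hr' : (r : ℂ) ≠ 0 := Complex.ofReal_ne_zero.2 hr.ne'
  rw [Complex.cpow_def_of_ne_zero (mul_ne_zero hr' hv), Complex.cpow_def_of_ne_zero hr',
    Complex.cpow_def_of_ne_zero hv, Complex.log_ofReal_mul hr hv, ← Complex.exp_add,
    Complex.ofReal_log hr.le, add_mul]

lemma differentiableAt_Gamma_of_re_pos {s : ℂ} (hs : 0 < s.re) :
    DifferentiableAt ℂ Complex.Gamma s := by
  refine Complex.differentiableAt_Gamma s fun m h => ?_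
  rw [h] at hs
  simp at hs
  linarith [(m.cast_nonneg : (0 : ℝ) ≤ m)]

/-- The power grows at most like e^(|arg v||y|), and Γ decays like e^(-θ|y|) for any θ < π/2. Since
Re v > 0, some θ lies strictly between |arg v| and π/2. -/
lemma integrable_Gamma_mul_cpow_neg {σ : ℝ} (hσ : 0 < σ) {v : ℂ} (hv : 0 < v.re) :
    Integrable fun y : ℝ => Complex.Gamma (σ + y * Complex.I) * v ^ (-(σ + y * Complex.I)) := by
  have hv0 : v ≠ 0 := by rintro rfl; simp at hv
  obtain ⟨θ, h1, h2, h3⟩ := exists_abs_arg_lt hv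
  obtain ⟨K, hK, hG⟩ := exists_norm_Gamma_le (β := σ) hσ h2 h3
  refine integrable_of_norm_le_exp_neg_mul_abs (C := K * ‖v‖ ^ (-σ)) (ε := θ - |v.arg|) ?_
    (by linarith) fun y => ?_
  · have hc : Continuous fun y : ℝ => (σ + y * Complex.I : ℂ) := by fun_prop
    refine Continuous.mul ?_ ?_
    · refine continuous_iff_continuousAt.2 fun y => ContinuousAt.comp (f := fun y : ℝ => (σ + y * Complex.I : ℂ)) ?_ hc.continuousAt
      exact (differentiableAt_Gamma_of_re_pos (by simpa using hσ)).continuousAt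
    · exact hc.neg.const_cpow (Or.inl hv0)
  · have e1 := hG (σ + y * Complex.I) (by simp) (by simp)
    have e2 := norm_cpow_neg_le hv0 (σ + y * Complex.I)
    simp only [Complex.add_re, Complex.ofReal_re, Complex.mul_re, Complex.I_re, mul_zero,
      Complex.ofReal_im, Complex.I_im, sub_zero, add_zero, Complex.add_im, Complex.mul_im,
      mul_one, zero_add] at e1 e2
    rw [norm_mul]
    calc _ ≤ (K * Real.exp (-θ * |y|)) * (‖v‖ ^ (-σ) * Real.exp (|v.arg| * |y|)) := by gcongr
      _ = K * ‖v‖ ^ (-σ) * (Real.exp (-θ * |y|) * Real.exp (|v.arg| * |y|)) := by ring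
      _ = _ := by rw [← Real.exp_add]; ring_nf

/-- Mellin inversion of u ↦ e^(-zu), evaluated at u = 1. -/
lemma cexp_neg_eq_integral {σ : ℝ} (hσ : 0 < σ) {z : ℂ} (hz : 0 < z.re) :
    Complex.exp (-z) = 1 / (2 * Real.pi) *
      ∫ y : ℝ, Complex.Gamma (σ + y * Complex.I) * z ^ (-(σ + y * Complex.I)) := by
  have hm : ∀ s : ℂ, 0 < s.re →
      mellin (fun u : ℝ => Complex.exp (-(z * u))) s = z ^ (-s) * Complex.Gamma s := fun s hs => by
    simpa only [mellin, smul_eq_mul] using integral_cpow_mul_cexp hs hz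
  have hm' : ∀ y : ℝ, mellin (fun u : ℝ => Complex.exp (-(z * u))) (σ + y * Complex.I) =
      Complex.Gamma (σ + y * Complex.I) * z ^ (-(σ + y * Complex.I)) := fun y => by
    rw [hm _ (by simpa using hσ), mul_comm]
  have key := mellinInv_mellin_eq σ (fun u : ℝ => Complex.exp (-(z * u))) one_pos ?_ ?_ ?_
  · rw [mellinInv] at key
    simp only [hm', Complex.ofReal_one, Complex.one_cpow, one_smul, mul_one] at key
    rw [← key, Complex.real_smul]
    push_cast
    rfl
  · simpa only [MellinConvergent, smul_eq_mul] using
      integrableOn_cpow_mul_cexp (a := σ) (by simpa using hσ) hz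
  · rw [Complex.VerticalIntegrable]
    simp_rw [hm']
    exact integrable_Gamma_mul_cpow_neg hσ hz
  · fun_prop

/-- Mellin–Barnes integral for `K₀`. -/
lemma besselK0_two_mul {σ : ℝ} (hσ : 0 < σ) {v : ℂ} (hv : 0 < v.re) :
    besselK0 (2 * v) = 1 / (2 * Real.pi) *
      ∫ y : ℝ, 1 / 4 * (Complex.Gamma ((σ + y * Complex.I) / 2) ^ 2 * v ^ (-(σ + y * Complex.I))) := by
  have hv0 : v ≠ 0 := by rintro rfl; simp at hv
  have hcosh : ∀ t : ℝ, 0 < 2 * Real.cosh t := fun t => by positivity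
  set G : ℝ → ℂ := fun y => Complex.Gamma (σ + y * Complex.I) * v ^ (-(σ + y * Complex.I)) with hGdef
  have hG : Integrable G := integrable_Gamma_mul_cpow_neg hσ hv
  -- The exponential in the definition of K₀(2v) has argument 2 cosh t · v. Once it is a Mellin
  -- integral, Fubini isolates the integral of (2 cosh t)^(-s) over t, and the Beta integral
  -- replaces Γ(s) by Γ(s/2)²/4.
  have h1 : ∀ t : ℝ, Complex.exp (-(2 * v) * (Real.cosh t : ℂ)) = 1 / (2 * Real.pi) *
      ∫ y : ℝ, G y * ((2 * Real.cosh t : ℝ) : ℂ) ^ (-(σ + y * Complex.I)) := by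
    intro t
    have hre : 0 < (((2 * Real.cosh t : ℝ) : ℂ) * v).re := by
      rw [Complex.re_ofReal_mul]; exact mul_pos (hcosh t) hv
    have := cexp_neg_eq_integral hσ hre
    rw [show -(2 * v) * (Real.cosh t : ℂ) = -(((2 * Real.cosh t : ℝ) : ℂ) * v) by push_cast; ring, this]
    congr 2
    funext y
    rw [ofReal_mul_cpow (hcosh t) hv0]
    simp only [hGdef]
    ring
  have hint : Integrable (Function.uncurry fun (t : ℝ) (y : ℝ) =>
      G y * ((2 * Real.cosh t : ℝ) : ℂ) ^ (-(σ + y * Complex.I)))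
      ((volume.restrict (Set.Ioi 0)).prod volume) := by
    refine Integrable.mono ((integrableOn_two_cosh_rpow hσ).ofReal (𝕜 := ℂ) |>.mul_prod hG) ?_
      (ae_of_all _ fun p => ?_)
    · refine hG.1.comp_snd.mul (Measurable.aestronglyMeasurable ?_)
      have m1 : Measurable fun p : ℝ × ℝ => ((2 * Real.cosh p.1 : ℝ) : ℂ) := by
        have : Continuous fun p : ℝ × ℝ => ((2 * Real.cosh p.1 : ℝ) : ℂ) := by fun_prop
        exact this.measurable
      have m2 : Measurable fun p : ℝ × ℝ => -((σ : ℂ) + p.2 * Complex.I) := by fun_prop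
      exact m1.pow m2
    · have := norm_two_cosh_cpow_neg (σ + p.2 * Complex.I) p.1
      have h0 : 0 ≤ (2 * Real.cosh p.1) ^ (-σ) := Real.rpow_nonneg (hcosh _).le _
      simp only [Function.uncurry, norm_mul, this]
      rw [show ‖(RCLike.ofReal ((2 * Real.cosh p.1) ^ (-σ)) : ℂ)‖ = (2 * Real.cosh p.1) ^ (-σ) by
        rw [RCLike.norm_ofReal, abs_of_nonneg h0]]
      simp [mul_comm]
  rw [besselK0]
  simp_rw [h1]
  rw [integral_const_mul, integral_integral_swap hint]
  congr 2
  funext y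
  have hs : 0 < (σ + y * Complex.I : ℂ).re := by simpa using hσ
  rw [integral_const_mul, integral_two_cosh_cpow hs]
  have := Complex.Gamma_ne_zero_of_re_pos hs
  simp only [hGdef]
  field_simp

end ZetaInvSq

/-! ### Shifting the contour of K₀ past the double pole at 0 -/

namespace ZetaInvSq

open MeasureTheory

/-- The heights form an arbitrary sequence because an integrand containing 1/ζ can be controlled
only on selected horizontal lines. -/
lemma tendsto_rectIntegral {f : ℂ → ℂ} {a b : ℝ} (hab : a ≤ b) {T B : ℕ → ℝ}
    (hT : Tendsto T atTop atTop) (hB : Tendsto B atTop (𝓝 0))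
    (ha : Integrable fun y : ℝ => f (a + y * Complex.I))
    (hb : Integrable fun y : ℝ => f (b + y * Complex.I))
    (h : ∀ k, ∀ x ∈ Set.Icc a b, ‖f (x + (T k : ℝ) * Complex.I)‖ ≤ B k ∧
      ‖f (x + (-T k : ℝ) * Complex.I)‖ ≤ B k) :
    Tendsto (fun k => rectIntegral f a b (-T k) (T k)) atTop
      (𝓝 (Complex.I * (∫ y : ℝ, f (b + y * Complex.I)) -
        Complex.I * ∫ y : ℝ, f (a + y * Complex.I))) := by
  have hT' : Tendsto (fun k => -T k) atTop atBot := tendsto_neg_atTop_atBot.comp hT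
  have h1 := intervalIntegral_tendsto_integral ha hT' hT
  have h2 := intervalIntegral_tendsto_integral hb hT' hT
  have hz : Tendsto (fun k => B k * |b - a|) atTop (𝓝 0) := by
    simpa using hB.mul_const |b - a|
  have hu : ∀ x, x ∈ Set.uIoc a b → x ∈ Set.Icc a b := fun x hx => by
    rw [Set.uIoc_of_le hab] at hx
    exact ⟨hx.1.le, hx.2⟩
  have h3 : Tendsto (fun k => ∫ x in a..b, f (x + (T k : ℝ) * Complex.I)) atTop (𝓝 0) :=
    squeeze_zero_norm (fun k => intervalIntegral.norm_integral_le_of_norm_le_const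
      fun x hx => (h k x (hu x hx)).1) hz
  have h4 : Tendsto (fun k => ∫ x in a..b, f (x + (-T k : ℝ) * Complex.I)) atTop (𝓝 0) :=
    squeeze_zero_norm (fun k => intervalIntegral.norm_integral_le_of_norm_le_const
      fun x hx => (h k x (hu x hx)).2) hz
  have := ((h4.sub h3).add (h2.const_mul Complex.I)).sub (h1.const_mul Complex.I)
  simpa [rectIntegral] using this

/-- The recursion Γ(s/2) = Γ(s/2+1)/(s/2) carries the strip into Re > 0, and |s/2| ≥ 1/4 keeps the
denominator away from 0. Squaring restores the full rate θ, since Im(s/2) is half of Im s. -/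
lemma exists_norm_Gamma_half_sq_le {θ : ℝ} (h0 : 0 ≤ θ) (hθ : θ < Real.pi / 2) :
    ∃ K : ℝ, 0 < K ∧ ∀ s : ℂ, -(1 / 2) ≤ s.re → s.re ≤ 3 / 2 → 1 / 2 ≤ ‖s‖ →
      ‖Complex.Gamma (s / 2) ^ 2‖ ≤ K * Real.exp (-θ * |s.im|) := by
  obtain ⟨K, hK, hG⟩ := exists_norm_Gamma_le (α := 1 / 2) (β := 2) (by norm_num) h0 hθ
  refine ⟨(4 * K) ^ 2, by positivity, fun s h1 h2 h3 => ?_⟩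
  have hs0 : s / 2 ≠ 0 := by
    intro h
    have : s = 0 := by simpa using h
    rw [this] at h3
    norm_num at h3
  have hre : (s / 2 + 1).re = s.re / 2 + 1 := by simp
  have him : (s / 2 + 1).im = s.im / 2 := by simp
  have e1 := hG (s / 2 + 1) (by rw [hre]; linarith) (by rw [hre]; linarith)
  rw [Complex.Gamma_add_one _ hs0, norm_mul, him, abs_div, abs_two] at e1
  have e2 : (1 / 4 : ℝ) ≤ ‖s / 2‖ := by
    rw [norm_div, Complex.norm_ofNat]
    linarith
  have e3 : ‖Complex.Gamma (s / 2)‖ ≤ 4 * K * Real.exp (-θ * (|s.im| / 2)) := by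
    nlinarith [norm_nonneg (Complex.Gamma (s / 2))]
  rw [norm_pow]
  calc _ ≤ (4 * K * Real.exp (-θ * (|s.im| / 2))) ^ 2 := by gcongr
    _ = (4 * K) ^ 2 * (Real.exp (-θ * (|s.im| / 2)) * Real.exp (-θ * (|s.im| / 2))) := by ring
    _ = _ := by rw [← Real.exp_add]; ring_nf

lemma norm_cpow_neg_le_max {v : ℂ} (hv : v ≠ 0) {s : ℂ} (h1 : -(1 / 2) ≤ s.re) (h2 : s.re ≤ 3 / 2) :
    ‖v ^ (-s)‖ ≤ (‖v‖ ^ (1 / 2 : ℝ) + ‖v‖ ^ (-(3 / 2) : ℝ)) * Real.exp (|v.arg| * |s.im|) := by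
  refine (norm_cpow_neg_le hv s).trans ?_
  have hp : 0 < ‖v‖ := norm_pos_iff.2 hv
  gcongr
  rcases le_total 1 ‖v‖ with h | h
  · have := Real.rpow_le_rpow_of_exponent_le h (by linarith : -s.re ≤ 1 / 2)
    linarith [Real.rpow_nonneg hp.le (-(3 / 2) : ℝ)]
  · have := Real.rpow_le_rpow_of_exponent_ge hp h (by linarith : -(3 / 2) ≤ -s.re)
    linarith [Real.rpow_nonneg hp.le (1 / 2 : ℝ)]

lemma exists_norm_Gamma_half_sq_mul_cpow_le {v : ℂ} (hv : 0 < v.re) :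
    ∃ C ε : ℝ, 0 < C ∧ 0 < ε ∧ ∀ s : ℂ, -(1 / 2) ≤ s.re → s.re ≤ 3 / 2 → 1 / 2 ≤ ‖s‖ →
      ‖Complex.Gamma (s / 2) ^ 2 * v ^ (-s)‖ ≤ C * Real.exp (-ε * |s.im|) := by
  have hv0 : v ≠ 0 := by rintro rfl; simp at hv
  have hp : 0 < ‖v‖ := norm_pos_iff.2 hv0
  obtain ⟨θ, h1, h2, h3⟩ := exists_abs_arg_lt hv
  obtain ⟨K, hK, hG⟩ := exists_norm_Gamma_half_sq_le h2 h3
  refine ⟨K * (‖v‖ ^ (1 / 2 : ℝ) + ‖v‖ ^ (-(3 / 2) : ℝ)), θ - |v.arg|, by positivity, by linarith,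
    fun s k1 k2 k3 => ?_⟩
  rw [norm_mul]
  calc _ ≤ (K * Real.exp (-θ * |s.im|)) *
        ((‖v‖ ^ (1 / 2 : ℝ) + ‖v‖ ^ (-(3 / 2) : ℝ)) * Real.exp (|v.arg| * |s.im|)) :=
        mul_le_mul (hG s k1 k2 k3) (norm_cpow_neg_le_max hv0 k1 k2) (norm_nonneg _) (by positivity)
    _ = K * (‖v‖ ^ (1 / 2 : ℝ) + ‖v‖ ^ (-(3 / 2) : ℝ)) *
        (Real.exp (-θ * |s.im|) * Real.exp (|v.arg| * |s.im|)) := by ring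
    _ = _ := by rw [← Real.exp_add]; ring_nf

lemma half_le_norm_of_abs_re {s : ℂ} (h : 1 / 2 ≤ |s.re|) : 1 / 2 ≤ ‖s‖ :=
  h.trans (Complex.abs_re_le_norm s)

lemma differentiableAt_Gamma_half {s : ℂ} (h : -2 < s.re) (h0 : s ≠ 0) :
    DifferentiableAt ℂ (fun s => Complex.Gamma (s / 2)) s := by
  refine DifferentiableAt.comp (f := fun s : ℂ => s / 2) s
    (Complex.differentiableAt_Gamma _ fun m hm => ?_) (by fun_prop)
  have e : s = -(2 * m : ℝ) := by
    push_cast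
    linear_combination 2 * hm
  rcases Nat.eq_zero_or_pos m with rfl | hm'
  · exact h0 (by simpa using e)
  · have : (1 : ℝ) ≤ m := by exact_mod_cast hm'
    rw [e] at h
    simp at h
    linarith

lemma differentiableAt_Gamma_half_sq_mul_cpow {v : ℂ} (hv : v ≠ 0) {s : ℂ} (h : -2 < s.re)
    (h0 : s ≠ 0) : DifferentiableAt ℂ (fun s => Complex.Gamma (s / 2) ^ 2 * v ^ (-s)) s := by
  refine ((differentiableAt_Gamma_half h h0).pow 2).mul ?_
  exact DifferentiableAt.const_cpow (by fun_prop) (Or.inl hv)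

lemma continuous_vertical {f : ℂ → ℂ} {σ : ℝ} (h : ∀ y : ℝ, ContinuousAt f (σ + y * Complex.I)) :
    Continuous fun y : ℝ => f (σ + y * Complex.I) := by
  refine continuous_iff_continuousAt.2 fun y => ?_
  refine ContinuousAt.comp (f := fun y : ℝ => (σ + y * Complex.I : ℂ)) (h y) ?_
  fun_prop

lemma vertical_re (σ y : ℝ) : (σ + y * Complex.I : ℂ).re = σ := by simp
lemma vertical_im (σ y : ℝ) : (σ + y * Complex.I : ℂ).im = y := by simp

lemma integrable_Gamma_half_sq_mul_cpow {v : ℂ} (hv : 0 < v.re) {σ : ℝ} (h1 : -(1 / 2) ≤ σ)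
    (h2 : σ ≤ 3 / 2) (h3 : 1 / 2 ≤ |σ|) :
    Integrable fun y : ℝ => Complex.Gamma ((σ + y * Complex.I) / 2) ^ 2 * v ^ (-(σ + y * Complex.I)) := by
  have hv0 : v ≠ 0 := by rintro rfl; simp at hv
  obtain ⟨C, ε, hC, hε, hb⟩ := exists_norm_Gamma_half_sq_mul_cpow_le hv
  have hn : ∀ y : ℝ, 1 / 2 ≤ ‖(σ + y * Complex.I : ℂ)‖ := fun y =>
    half_le_norm_of_abs_re (by rwa [vertical_re])
  refine integrable_of_norm_le_exp_neg_mul_abs (C := C) (ε := ε) ?_ hε fun y => ?_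
  · refine continuous_vertical (f := fun s => Complex.Gamma (s / 2) ^ 2 * v ^ (-s)) fun y =>
      (differentiableAt_Gamma_half_sq_mul_cpow hv0 (by rw [vertical_re]; linarith) ?_).continuousAt
    intro h
    have := hn y
    rw [h] at this
    norm_num at this
  · have := hb (σ + y * Complex.I) (by rwa [vertical_re]) (by rwa [vertical_re]) (hn y)
    rwa [vertical_im] at this

lemma Gamma_half_sq_eq {s : ℂ} (hs : s ≠ 0) :
    Complex.Gamma (s / 2) ^ 2 = 4 * Complex.Gamma (s / 2 + 1) ^ 2 / s ^ 2 := by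
  rw [Complex.Gamma_add_one _ (div_ne_zero hs two_ne_zero)]
  field_simp
  ring

/-- This derivative is the residue of Γ(s/2)² v^(-s) at 0, because Γ(s/2)² = 4Γ(s/2+1)²/s². It is
the source of the logarithm in the series. -/
lemma hasDerivAt_Gamma_half_add_one_sq_mul_cpow {v : ℂ} (hv : v ≠ 0) :
    HasDerivAt (fun s : ℂ => 4 * Complex.Gamma (s / 2 + 1) ^ 2 * v ^ (-s))
      (4 * (deriv Complex.Gamma 1 - Complex.log v)) 0 := by
  have h1 : HasDerivAt Complex.Gamma (deriv Complex.Gamma 1) ((0 : ℂ) / 2 + 1) := by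
    simpa using (differentiableAt_Gamma_of_re_pos (s := 1) (by simp)).hasDerivAt
  have h2 : HasDerivAt (fun s : ℂ => s / 2 + 1) (1 / 2) 0 :=
    ((hasDerivAt_id (0 : ℂ)).div_const 2).add_const 1
  have h3 := h1.comp (0 : ℂ) h2
  have h4 : HasDerivAt (fun s : ℂ => v ^ (-s)) (v ^ (-(0 : ℂ)) * Complex.log v * -1) 0 :=
    ((hasDerivAt_id (0 : ℂ)).neg).const_cpow (Or.inl hv)
  have h5 := ((h3.pow 2).const_mul 4).mul h4
  refine h5.congr_deriv ?_
  simp only [Pi.pow_apply, Function.comp_apply, zero_div, zero_add, Complex.Gamma_one, neg_zero, Complex.cpow_zero]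
  push_cast
  ring

/-- `K₀(2v) + log v` as a Mellin–Barnes integral to the left of the double pole at the origin. -/
lemma besselK0_two_mul_add_log {v : ℂ} (hv : 0 < v.re) :
    besselK0 (2 * v) + Complex.log v = deriv Complex.Gamma 1 + 1 / (8 * Real.pi) *
      ∫ y : ℝ, Complex.Gamma (((-(1 / 2) : ℝ) + y * Complex.I) / 2) ^ 2 *
        v ^ (-((-(1 / 2) : ℝ) + y * Complex.I)) := by
  have hv0 : v ≠ 0 := by rintro rfl; simp at hv
  obtain ⟨C, ε, hC, hε, hb⟩ := exists_norm_Gamma_half_sq_mul_cpow_le hv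
  have hT : Tendsto (fun k : ℕ => (k : ℝ) + 1) atTop atTop :=
    tendsto_atTop_add_const_right _ _ tendsto_natCast_atTop_atTop
  have hB : Tendsto (fun k : ℕ => C * Real.exp (-ε * ((k : ℝ) + 1))) atTop (𝓝 0) := by
    have : Tendsto (fun k : ℕ => -ε * ((k : ℝ) + 1)) atTop atBot :=
      hT.const_mul_atTop_of_neg (by linarith)
    simpa using (Real.tendsto_exp_atBot.comp this).const_mul C
  have hlim := tendsto_rectIntegral (f := fun s => Complex.Gamma (s / 2) ^ 2 * v ^ (-s))
    (a := -(1 / 2)) (b := 1 / 2) (by norm_num) hT hB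
    (integrable_Gamma_half_sq_mul_cpow hv (by norm_num) (by norm_num) (by norm_num))
    (integrable_Gamma_half_sq_mul_cpow hv (by norm_num) (by norm_num) (by norm_num)) (by
      intro k x hx
      have hk : (0 : ℝ) ≤ k := k.cast_nonneg
      constructor
      · have := hb (x + (((k : ℝ) + 1 : ℝ) : ℂ) * Complex.I) (by rw [vertical_re]; exact hx.1)
          (by rw [vertical_re]; linarith [hx.2])
          (le_trans (by rw [vertical_im, abs_of_nonneg] <;> linarith) (Complex.abs_im_le_norm _))
        rwa [vertical_im, abs_of_nonneg (by linarith)] at this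
      · have := hb (x + ((-((k : ℝ) + 1) : ℝ) : ℂ) * Complex.I) (by rw [vertical_re]; exact hx.1)
          (by rw [vertical_re]; linarith [hx.2])
          (le_trans (by rw [vertical_im, abs_neg, abs_of_nonneg] <;> linarith) (Complex.abs_im_le_norm _))
        rwa [vertical_im, abs_neg, abs_of_nonneg (by linarith)] at this)
  have hres : ∀ k : ℕ, rectIntegral (fun s => Complex.Gamma (s / 2) ^ 2 * v ^ (-s)) (-(1 / 2)) (1 / 2)
      (-((k : ℝ) + 1)) ((k : ℝ) + 1) =
      2 * Real.pi * Complex.I * (4 * (deriv Complex.Gamma 1 - Complex.log v)) := by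
    intro k
    have hk : (0 : ℝ) ≤ k := k.cast_nonneg
    rw [rectIntegral_eq_sum_residues (by norm_num) (by linarith) {0} ?_ ?_
      (fun _ s => 4 * Complex.Gamma (s / 2 + 1) ^ 2 * v ^ (-s)) ?_ ?_]
    · rw [Finset.sum_singleton, (hasDerivAt_Gamma_half_add_one_sq_mul_cpow hv0).deriv]
    · intro p hp
      rw [Finset.mem_singleton] at hp
      subst hp
      rw [Complex.mem_reProdIm]
      refine ⟨by norm_num, ?_, ?_⟩ <;> simp <;> linarith
    · intro z hz hz0
      rw [Complex.mem_reProdIm] at hz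
      exact differentiableAt_Gamma_half_sq_mul_cpow hv0 (by linarith [hz.1.1]) (by simpa using hz0)
    · intro p hp
      rw [Finset.mem_singleton] at hp
      subst hp
      refine Complex.analyticAt_iff_eventually_differentiableAt.2 ?_
      have : ∀ᶠ z : ℂ in 𝓝 0, -2 < z.re :=
        Complex.continuous_re.continuousAt.eventually (lt_mem_nhds (by simp))
      filter_upwards [this] with z hz
      refine DifferentiableAt.mul (DifferentiableAt.const_mul (DifferentiableAt.pow ?_ 2) 4)
        (DifferentiableAt.const_cpow (by fun_prop) (Or.inl hv0))
      refine DifferentiableAt.comp (f := fun s : ℂ => s / 2 + 1) z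
        (differentiableAt_Gamma_of_re_pos ?_) (by fun_prop)
      simp
      linarith
    · intro p hp
      rw [Finset.mem_singleton] at hp
      subst hp
      filter_upwards [self_mem_nhdsWithin] with z hz
      rw [Gamma_half_sq_eq hz, sub_zero]
      ring
  simp_rw [hres] at hlim
  have huniq := tendsto_nhds_unique hlim tendsto_const_nhds
  rw [← mul_sub, mul_comm (2 * (Real.pi : ℂ)) Complex.I, mul_assoc] at huniq
  have h2 := mul_left_cancel₀ Complex.I_ne_zero huniq
  rw [besselK0_two_mul (σ := 1 / 2) (by norm_num) hv, integral_const_mul]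
  have hpi : (Real.pi : ℂ) ≠ 0 := Complex.ofReal_ne_zero.2 Real.pi_ne_zero
  rw [sub_eq_iff_eq_add] at h2
  rw [h2]
  generalize (∫ y : ℝ, Complex.Gamma (((-(1 / 2) : ℝ) + y * Complex.I) / 2) ^ 2 *
        v ^ (-((-(1 / 2) : ℝ) + y * Complex.I))) = J
  field_simp
  ring

end ZetaInvSq

/-! ### The series over n as a contour integral -/

namespace ZetaInvSq

open MeasureTheory

lemma csqrt_eq_exp {x : ℂ} (hx : x ≠ 0) : csqrt x = Complex.exp (Complex.log x / 2) := by
  rw [csqrt, Complex.cpow_def_of_ne_zero hx]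
  ring_nf

lemma csqrt_ne_zero {x : ℂ} (hx : x ≠ 0) : csqrt x ≠ 0 := by
  rw [csqrt_eq_exp hx]
  exact Complex.exp_ne_zero _

lemma log_csqrt {x : ℂ} (hx : x ≠ 0) : Complex.log (csqrt x) = Complex.log x / 2 := by
  rw [csqrt_eq_exp hx]
  have h1 := Complex.neg_pi_lt_log_im x
  have h2 := Complex.log_im_le_pi x
  have e : (Complex.log x / 2).im = (Complex.log x).im / 2 := by simp
  have := Real.pi_pos
  exact Complex.log_exp (by rw [e]; linarith) (by rw [e]; linarith)

lemma arg_csqrt {x : ℂ} (hx : x ≠ 0) : (csqrt x).arg = x.arg / 2 := by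
  have := congrArg Complex.im (log_csqrt hx)
  rw [Complex.log_im] at this
  simpa [Complex.log_im] using this

lemma arg_pi_mul_csqrt {x : ℂ} (hx : x ≠ 0) : (Real.pi * csqrt x).arg = x.arg / 2 := by
  rw [Complex.arg_real_mul _ Real.pi_pos, arg_csqrt hx]

lemma pi_mul_csqrt_re_pos {x : ℂ} (hx : x ≠ 0) (h : |x.arg| < Real.pi / 2) :
    0 < (Real.pi * csqrt x).re := by
  have h1 : |(Real.pi * csqrt x).arg| < Real.pi / 2 := by
    rw [arg_pi_mul_csqrt hx, abs_div, abs_two]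
    linarith [abs_nonneg x.arg]
  rcases Complex.abs_arg_lt_pi_div_two_iff.1 h1 with h2 | h2
  · exact h2
  · exact absurd h2 (mul_ne_zero (Complex.ofReal_ne_zero.2 Real.pi_ne_zero) (csqrt_ne_zero hx))

/-- The integrand whose double poles at the zeros of `ζ` give the terms `residueTerm`. -/
noncomputable def kernel (x s : ℂ) : ℂ :=
  Complex.Gamma (s / 2) ^ 2 * (riemannZeta (1 - s) ^ 2)⁻¹ * (Real.pi * csqrt x) ^ (-s)

/-- The factor n^s released by (v/n)^(-s) combines with 1/n into n^(-(1-s)), so the sum over n is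
the Dirichlet series of ζ⁻² at 1 - s. -/
lemma mobius₂_div_mul_cpow {v s : ℂ} (hv : v ≠ 0) (n : ℕ) :
    (mobius₂ n : ℂ) / n * (v / n) ^ (-s) =
      LSeries.term (fun n => (mobius₂ n : ℂ)) (1 - s) n * v ^ (-s) := by
  rcases Nat.eq_zero_or_pos n with rfl | hn
  · simp
  have hn' : (n : ℂ) ≠ 0 := by exact_mod_cast hn.ne'
  rw [LSeries.term_of_ne_zero hn.ne']
  have h1 : v / n = (((n : ℝ)⁻¹ : ℝ) : ℂ) * v := by push_cast; ring
  rw [h1, ofReal_mul_cpow (by positivity) hv, Complex.cpow_sub _ _ hn', Complex.cpow_one]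
  have h2 : (((n : ℝ)⁻¹ : ℝ) : ℂ) ^ (-s) = (n : ℂ) ^ s := by
    push_cast
    rw [Complex.inv_cpow _ _ (by rw [Complex.natCast_arg]; exact Real.pi_pos.ne), ← Complex.cpow_neg,
      neg_neg]
  rw [h2]
  have h3 : (n : ℂ) ^ s ≠ 0 := by simp [Complex.cpow_eq_zero_iff, hn']
  field_simp

/-- Each summand is Γ'(1) μ₂(n)/n plus an integral over Re s = -1/2. There Re(1-s) = 3/2, so the
integrals sum absolutely and may be summed under the integral sign. The constants vanish in the
limit by `tendsto_sum_mobius₂_div`, a limit of partial sums. -/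
theorem tendsto_mobiusPartialSum {x : ℂ} (hx : x ≠ 0) (h : |x.arg| < Real.pi / 2) :
    Tendsto (mobiusPartialSum x) atTop
      (𝓝 (1 / (8 * Real.pi) * ∫ y : ℝ, kernel x ((-(1 / 2) : ℝ) + y * Complex.I))) := by
  set V : ℂ := Real.pi * csqrt x with hV
  have hVre : 0 < V.re := pi_mul_csqrt_re_pos hx h
  have hV0 : V ≠ 0 := by intro h0; rw [h0] at hVre; simp at hVre
  set s : ℝ → ℂ := fun y => (-(1 / 2) : ℝ) + y * Complex.I with hs
  set Ψ : ℝ → ℂ := fun y => Complex.Gamma (s y / 2) ^ 2 * V ^ (-s y) with hΨ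
  have hΨi : Integrable Ψ :=
    integrable_Gamma_half_sq_mul_cpow hVre (by norm_num) (by norm_num) (by norm_num)
  set F : ℕ → ℝ → ℂ := fun n y =>
    (mobius₂ n : ℂ) / n * (Complex.Gamma (s y / 2) ^ 2 * (V / n) ^ (-s y)) with hF
  have hvn : ∀ n : ℕ, 0 < n → 0 < (V / n).re := fun n hn => by
    rw [Complex.div_natCast_re]
    positivity
  have hFi : ∀ n, Integrable (F n) := by
    intro n
    rcases Nat.eq_zero_or_pos n with rfl | hn
    · simp [hF]
    · exact (integrable_Gamma_half_sq_mul_cpow (hvn n hn) (by norm_num) (by norm_num)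
        (by norm_num)).const_mul _
  have hFe : ∀ n y, F n y = LSeries.term (fun n => (mobius₂ n : ℂ)) (1 - s y) n * Ψ y := by
    intro n y
    simp only [hF, hΨ]
    rw [mul_left_comm, mobius₂_div_mul_cpow hV0]
    ring
  have hre : ∀ y, (1 - s y).re = 3 / 2 := fun y => by
    rw [Complex.sub_re, vertical_re]; norm_num
  have hFn : ∀ n y, ‖F n y‖ = ‖LSeries.term (fun n => (mobius₂ n : ℂ)) (3 / 2) n‖ * ‖Ψ y‖ := by
    intro n y
    rw [hFe, norm_mul, LSeries.norm_term_eq, LSeries.norm_term_eq, hre]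
    norm_num
  have hsum : Summable fun n => ∫ y, ‖F n y‖ := by
    simp_rw [hFn, integral_const_mul]
    exact ((LSeries_mobius₂ (s := 3 / 2) (by norm_num)).1.norm).mul_right _
  have hS := (hasSum_integral_of_summable_integral_norm hFi hsum).tendsto_sum_nat
  have hlim : ∫ y, ∑' n, F n y = ∫ y, kernel x (s y) := by
    congr 1
    funext y
    simp_rw [hFe, tsum_mul_right]
    have := (LSeries_mobius₂ (s := 1 - s y) (by rw [hre]; norm_num)).2
    rw [LSeries] at this
    rw [this]
    simp only [hΨ, kernel]
    ring
  rw [hlim] at hS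
  have hS1 := (tendsto_add_atTop_iff_nat 1).2 hS
  have hfin := (tendsto_sum_mobius₂_div.const_mul (deriv Complex.Gamma 1)).add
    (hS1.const_mul (1 / (8 * (Real.pi : ℂ))))
  rw [mul_zero, zero_add] at hfin
  refine hfin.congr fun N => ?_
  have hr : ∑ i ∈ Finset.range (N + 1), ∫ y, F i y = ∑ i ∈ Finset.Icc 1 N, ∫ y, F i y := by
    rw [Finset.range_eq_Ico, Finset.sum_eq_sum_Ico_succ_bot (Nat.succ_pos N)]
    have h0 : ∫ y, F 0 y = 0 := by simp [hF]
    rw [h0, zero_add]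
    rfl
  rw [hr, mobiusPartialSum, Finset.mul_sum, Finset.mul_sum, ← Finset.sum_add_distrib]
  refine Finset.sum_congr rfl fun n hn => ?_
  have hn1 : 0 < n := (Finset.mem_Icc.1 hn).1
  have hb := besselK0_two_mul_add_log (hvn n hn1)
  rw [show 2 * (Real.pi : ℂ) * csqrt x / n = 2 * (V / n) by rw [hV]; ring, hb]
  simp only [hF]
  rw [integral_const_mul]
  ring

theorem mobiusSeriesConverges {x : ℂ} (hx : x ≠ 0) (h : |x.arg| < Real.pi / 2) :
    MobiusSeriesConverges x := ⟨_, tendsto_mobiusPartialSum hx h⟩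

theorem four_mul_mobiusSeries {x : ℂ} (hx : x ≠ 0) (h : |x.arg| < Real.pi / 2) :
    4 * mobiusSeries x =
      1 / (2 * Real.pi) * ∫ y : ℝ, kernel x ((-(1 / 2) : ℝ) + y * Complex.I) := by
  rw [mobiusSeries, (tendsto_mobiusPartialSum hx h).limUnder_eq]
  have hpi : (Real.pi : ℂ) ≠ 0 := Complex.ofReal_ne_zero.2 Real.pi_ne_zero
  generalize (∫ y : ℝ, kernel x ((-(1 / 2) : ℝ) + y * Complex.I)) = J
  field_simp
  ring

end ZetaInvSq

/-! ### Lower bounds for holomorphic functions with simple zeros in a disc -/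

namespace ZetaInvSq

lemma exists_eq_prod_sub_mul {F : ℂ → ℂ} {U : Set ℂ} (hU : IsOpen U) (hF : DifferentiableOn ℂ F U)
    (S : Finset ℂ) (hS : ∀ p ∈ S, p ∈ U ∧ F p = 0) :
    ∃ g : ℂ → ℂ, DifferentiableOn ℂ g U ∧ ∀ z ∈ U, F z = (∏ p ∈ S, (z - p)) * g z := by
  classical
  induction S using Finset.induction_on with
  | empty => exact ⟨F, hF, by simp⟩
  | insert q S hq ih =>
    obtain ⟨g, hg, hFg⟩ := ih fun p hp => hS p (Finset.mem_insert_of_mem hp)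
    obtain ⟨hqU, hq0⟩ := hS q (Finset.mem_insert_self q S)
    have hgq : g q = 0 := by
      have h1 := hFg q hqU
      rw [hq0] at h1
      rcases mul_eq_zero.1 h1.symm with h2 | h2
      · obtain ⟨p, hp, hp0⟩ := Finset.prod_eq_zero_iff.1 h2
        rw [sub_eq_zero] at hp0
        exact absurd (hp0 ▸ hp) hq
      · exact h2
    refine ⟨dslope g q, (Complex.differentiableOn_dslope (hU.mem_nhds hqU)).2 hg, fun z hz => ?_⟩
    have h3 := sub_smul_dslope g q z
    rw [hgq, sub_zero, smul_eq_mul] at h3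
    rw [Finset.prod_insert hq, hFg z hz, ← h3]
    ring

/-- A zero-free holomorphic function on a disc has a holomorphic logarithm. -/
lemma exists_eq_mul_exp {g : ℂ → ℂ} {r : ℝ} (hr : 0 < r) (hg : DifferentiableOn ℂ g (Metric.ball 0 r))
    (h0 : ∀ z ∈ Metric.ball 0 r, g z ≠ 0) :
    ∃ H : ℂ → ℂ, DifferentiableOn ℂ H (Metric.ball 0 r) ∧ H 0 = 0 ∧
      ∀ z ∈ Metric.ball 0 r, g z = g 0 * Complex.exp (H z) := by
  have hd : DifferentiableOn ℂ (fun z => deriv g z / g z) (Metric.ball 0 r) :=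
    (hg.deriv Metric.isOpen_ball).div hg h0
  obtain ⟨H0, hH0⟩ := hd.isExactOn_ball
  have hH : ∀ z ∈ Metric.ball (0 : ℂ) r, HasDerivAt (fun z => H0 z - H0 0) (deriv g z / g z) z :=
    fun z hz => (hH0 z hz).sub_const _
  have hgd : ∀ z ∈ Metric.ball (0 : ℂ) r, HasDerivAt g (deriv g z) z := fun z hz =>
    ((hg z hz).differentiableAt (Metric.isOpen_ball.mem_nhds hz)).hasDerivAt
  refine ⟨fun z => H0 z - H0 0, fun z hz => (hH z hz).differentiableAt.differentiableWithinAt,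
    sub_self _, fun z hz => ?_⟩
  have hk : ∀ w ∈ Metric.ball (0 : ℂ) r,
      HasDerivAt (fun z => g z * Complex.exp (-(H0 z - H0 0))) 0 w := fun w hw => by
    refine ((hgd w hw).mul (hH w hw).neg.cexp).congr_deriv ?_
    have := h0 w hw
    field_simp
    ring
  have hconst := (convex_ball (0 : ℂ) r).is_const_of_fderivWithin_eq_zero (𝕜 := ℂ)
    (f := fun z => g z * Complex.exp (-(H0 z - H0 0)))
    (fun w hw => (hk w hw).differentiableAt.differentiableWithinAt)
    (fun w hw => by
      rw [fderivWithin_of_isOpen Metric.isOpen_ball hw, (hk w hw).hasFDerivAt.fderiv]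
      ext
      simp) hz (Metric.mem_ball_self hr)
  simp only [sub_self, neg_zero, Complex.exp_zero, mul_one] at hconst
  rw [← hconst, mul_assoc, ← Complex.exp_add, neg_add_cancel, Complex.exp_zero, mul_one]

/-- Blaschke factors have modulus 1 on the boundary circle; this is that identity with the
denominator cleared. -/
lemma norm_blaschke_denom {R : ℝ} (hR : 0 < R) {w z : ℂ} (hw : ‖w‖ < R) (hz : ‖z‖ = R) :
    ‖(R : ℂ) ^ 2 - (starRingEnd ℂ) w * z‖ = R * ‖z - w‖ := by
  have h := Complex.norm_canonicalFactor_eval_circle_eq_one (R := R) (w := w) (z := z)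
    (by simpa using hw) (by simpa using hz)
  have hzw : z - w ≠ 0 := by
    intro h0
    rw [sub_eq_zero] at h0
    rw [← h0] at hw
    linarith
  rw [Complex.canonicalFactor_apply, norm_div, norm_mul, Complex.norm_real,
    Real.norm_of_nonneg hR.le, div_eq_one_iff_eq (by positivity)] at h
  exact h

/-- Lower bound for a holomorphic function with simple zeros near the centre of a disc, in terms of
an upper bound on a larger disc, and the corresponding bound for the number of zeros. -/
theorem norm_ge_of_simple_zeros {F : ℂ → ℂ} {r₁ R R' M : ℝ} (h0r : 0 < r₁) (hr : r₁ < R)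
    (hR : R < R') (hF : DifferentiableOn ℂ F (Metric.ball 0 R'))
    (hM : ∀ z, ‖z‖ = R → ‖F z‖ ≤ M) (hF0 : F 0 ≠ 0) (hFM : ‖F 0‖ < M) (S : Finset ℂ)
    (hS : ∀ p ∈ S, ‖p‖ ≤ r₁ ∧ F p = 0 ∧ deriv F p ≠ 0)
    (hS' : ∀ z, ‖z‖ < r₁ → F z = 0 → z ∈ S) :
    (R / r₁) ^ S.card * ‖F 0‖ ≤ M ∧ ∀ z, ‖z‖ < r₁ →
      ‖F 0‖ * Real.exp (-(2 * Real.log (M / ‖F 0‖) * ‖z‖ / (r₁ - ‖z‖))) *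
        ∏ p ∈ S, (‖z - p‖ / (2 * R)) ≤ ‖F z‖ := by
  classical
  have hR0 : 0 < R := h0r.trans hr
  have hnF : 0 < ‖F 0‖ := norm_pos_iff.2 hF0
  have hM0 : 0 < M := hnF.trans hFM
  have hmemU : ∀ z : ℂ, ‖z‖ ≤ R → z ∈ Metric.ball (0 : ℂ) R' := fun z hz => by
    simpa using hz.trans_lt hR
  obtain ⟨g, hg, hFg⟩ := exists_eq_prod_sub_mul Metric.isOpen_ball hF S fun p hp =>
    ⟨hmemU p ((hS p hp).1.trans hr.le), (hS p hp).2.1⟩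
  set D : ℂ → ℂ → ℂ := fun p z => ((R : ℂ) ^ 2 - (starRingEnd ℂ) p * z) / R with hD
  have hRc : (R : ℂ) ≠ 0 := Complex.ofReal_ne_zero.2 hR0.ne'
  have hDn : ∀ p ∈ S, ∀ z : ℂ, ‖z‖ ≤ R → D p z ≠ 0 ∧ ‖D p z‖ ≤ 2 * R := by
    intro p hp z hz
    have hpR : ‖p‖ < R := (hS p hp).1.trans_lt hr
    have h1 : ‖(starRingEnd ℂ) p * z‖ < R ^ 2 := by
      rw [norm_mul, RCLike.norm_conj, sq]
      nlinarith [norm_nonneg p, norm_nonneg z]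
    have h2 : ‖(R : ℂ) ^ 2‖ = R ^ 2 := by
      rw [norm_pow, Complex.norm_real, Real.norm_of_nonneg hR0.le]
    refine ⟨div_ne_zero (fun h => ?_) hRc, ?_⟩
    · rw [sub_eq_zero] at h
      rw [← h, h2] at h1
      exact lt_irrefl _ h1
    · simp only [hD]
      rw [norm_div, Complex.norm_real, Real.norm_of_nonneg hR0.le, div_le_iff₀ hR0]
      refine (norm_sub_le _ _).trans ?_
      rw [h2]
      nlinarith
  have hDd : ∀ p, Differentiable ℂ (D p) := fun p => by simp only [hD]; fun_prop
  -- G is F divided by its Blaschke product. It has the modulus of F on the circle of radius R,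
  -- hence is at most M inside. At the centre each divided zero gains a factor at least R/r₁, which
  -- bounds the number of zeros as in Jensen's formula.
  set G : ℂ → ℂ := fun z => g z * ∏ p ∈ S, D p z with hG
  have hGd : DifferentiableOn ℂ G (Metric.ball 0 R') :=
    hg.mul (DifferentiableOn.fun_finsetProd fun p _ => (hDd p).differentiableOn)
  have hFG : ∀ z : ℂ, ‖z‖ ≤ R → F z * ∏ p ∈ S, D p z = (∏ p ∈ S, (z - p)) * G z := fun z hz => by
    rw [hFg z (hmemU z hz)]; simp only [hG]; ring
  have hGM : ∀ z : ℂ, ‖z‖ ≤ R → ‖G z‖ ≤ M := by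
    intro z hz
    refine Complex.norm_le_of_forall_mem_frontier_norm_le (U := Metric.ball 0 R)
      Metric.isBounded_ball ?_ ?_ ?_
    · refine DifferentiableOn.diffContOnCl ?_
      rw [closure_ball _ hR0.ne']
      exact hGd.mono fun w hw => hmemU w (by simpa using hw)
    · intro w hw
      rw [frontier_ball _ hR0.ne', mem_sphere_zero_iff_norm] at hw
      have e1 := congrArg norm (hFG w hw.le)
      rw [norm_mul, norm_mul, Complex.norm_prod, Complex.norm_prod] at e1
      have e2 : ∏ p ∈ S, ‖D p w‖ = ∏ p ∈ S, ‖w - p‖ := by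
        refine Finset.prod_congr rfl fun p hp => ?_
        simp only [hD]
        rw [norm_div, norm_blaschke_denom hR0 ((hS p hp).1.trans_lt hr) hw, Complex.norm_real,
          Real.norm_of_nonneg hR0.le, mul_div_cancel_left₀ _ hR0.ne']
      have e3 : 0 < ∏ p ∈ S, ‖w - p‖ := by
        rw [← e2]
        exact Finset.prod_pos fun p hp => norm_pos_iff.2 (hDn p hp w hw.le).1
      rw [e2, mul_comm] at e1
      rw [← mul_left_cancel₀ e3.ne' e1]
      exact hM w hw
    · rw [closure_ball _ hR0.ne']
      simpa using hz
  have hG0 : (R / r₁) ^ S.card * ‖F 0‖ ≤ ‖G 0‖ := by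
    have e1 := congrArg norm (hFG 0 (by simpa using hR0.le))
    rw [norm_mul, norm_mul, Complex.norm_prod, Complex.norm_prod] at e1
    have e2 : ∏ p ∈ S, ‖D p 0‖ = R ^ S.card := by
      rw [← Finset.prod_const]
      refine Finset.prod_congr rfl fun p _ => ?_
      simp only [hD, mul_zero, sub_zero]
      rw [norm_div, norm_pow, Complex.norm_real, Real.norm_of_nonneg hR0.le]
      field_simp
    have e3 : ∏ p ∈ S, ‖0 - p‖ ≤ r₁ ^ S.card := by
      rw [← Finset.prod_const]
      refine Finset.prod_le_prod (fun _ _ => norm_nonneg _) fun p hp => ?_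
      rw [zero_sub, norm_neg]
      exact (hS p hp).1
    rw [e2] at e1
    rw [div_pow, div_mul_eq_mul_div, div_le_iff₀ (by positivity), mul_comm, e1, mul_comm]
    gcongr
  -- A zero of g would be a zero of F, hence a point of S, and then a double zero of F: here
  -- simplicity is needed.
  have hgne : ∀ z : ℂ, ‖z‖ < r₁ → g z ≠ 0 := by
    intro z hz h
    have hzU := hmemU z (hz.le.trans hr.le)
    have hFz : F z = 0 := by rw [hFg z hzU, h, mul_zero]
    have hzS := hS' z hz hFz
    have hdd := (hS z hzS).2.2
    have hnhds := Metric.isOpen_ball.mem_nhds hzU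
    have hgz : HasDerivAt g (deriv g z) z := ((hg z hzU).differentiableAt hnhds).hasDerivAt
    have hpd : DifferentiableAt ℂ (fun z => ∏ p ∈ S, (z - p)) z :=
      DifferentiableAt.fun_finsetProd fun p _ => by fun_prop
    have h1 := hpd.hasDerivAt.mul hgz
    have hp0 : ∏ p ∈ S, (z - p) = 0 := Finset.prod_eq_zero hzS (sub_self z)
    have h2 : F =ᶠ[𝓝 z] (fun z => ∏ p ∈ S, (z - p)) * g := by
      filter_upwards [hnhds] with w hw using hFg w hw
    rw [h2.deriv_eq, h1.deriv, h, hp0, mul_zero, zero_mul, add_zero] at hdd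
    exact hdd rfl
  have hGne : ∀ z ∈ Metric.ball (0 : ℂ) r₁, G z ≠ 0 := by
    intro z hz
    have hz' : ‖z‖ < r₁ := by simpa using hz
    exact mul_ne_zero (hgne z hz') (Finset.prod_ne_zero_iff.2 fun p hp =>
      (hDn p hp z (hz'.le.trans hr.le)).1)
  have hF1 : ‖F 0‖ ≤ ‖G 0‖ := by
    refine le_trans ?_ hG0
    have : 1 ≤ (R / r₁) ^ S.card := one_le_pow₀ ((one_le_div h0r).2 hr.le)
    nlinarith
  refine ⟨hG0.trans (hGM 0 (by simpa using hR0.le)), fun z hz => ?_⟩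
  obtain ⟨H, hHd, hH0, hH⟩ := exists_eq_mul_exp h0r
    (hGd.mono (Metric.ball_subset_ball (hr.trans hR).le)) hGne
  have hL : 0 < Real.log (M / ‖F 0‖) := Real.log_pos ((one_lt_div hnF).2 hFM)
  -- H is a logarithm of G/G(0). Its real part is at most log(M/|F(0)|) because |G| ≤ M and |G(0)| ≥
  -- |F(0)|, so Borel–Carathéodory bounds |H| and thereby |G| from below.
  have hbc := Complex.borelCaratheodory_zero (z := z) hL hHd (fun w hw => by
    have hw' : ‖w‖ < r₁ := by simpa using hw
    have e1 : ‖G w‖ = ‖G 0‖ * Real.exp (H w).re := by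
      rw [hH w hw, norm_mul, Complex.norm_exp]
    have e2 := hGM w (hw'.le.trans hr.le)
    have e3 : Real.exp (H w).re ≤ M / ‖F 0‖ := by
      rw [le_div_iff₀ hnF]
      calc _ ≤ Real.exp (H w).re * ‖G 0‖ := by gcongr
        _ = ‖G w‖ := by rw [e1, mul_comm]
        _ ≤ M := e2
    exact (Real.le_log_iff_exp_le (by positivity)).2 e3) h0r (by simpa using hz) hH0
  have hGz : ‖F 0‖ * Real.exp (-(2 * Real.log (M / ‖F 0‖) * ‖z‖ / (r₁ - ‖z‖))) ≤ ‖G z‖ := by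
    rw [hH z (by simpa using hz), norm_mul, Complex.norm_exp]
    gcongr
    have := (Complex.abs_re_le_norm (H z)).trans hbc
    linarith [neg_abs_le (H z).re]
  have hzR : ‖z‖ ≤ R := hz.le.trans hr.le
  have e1 := congrArg norm (hFG z hzR)
  rw [norm_mul, norm_mul, Complex.norm_prod, Complex.norm_prod] at e1
  have hpos : 0 < ∏ p ∈ S, ‖D p z‖ := Finset.prod_pos fun p hp => norm_pos_iff.2 (hDn p hp z hzR).1
  have e2 : ‖F z‖ = ‖G z‖ * ∏ p ∈ S, (‖z - p‖ / ‖D p z‖) := by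
    rw [Finset.prod_div_distrib, mul_div_assoc', eq_div_iff hpos.ne', e1, mul_comm]
  rw [e2]
  refine mul_le_mul hGz (Finset.prod_le_prod (fun p _ => by positivity) fun p hp => ?_)
    (Finset.prod_nonneg fun p _ => by positivity) (norm_nonneg _)
  have := norm_pos_iff.2 (hDn p hp z hzR).1
  have h2 := (hDn p hp z hzR).2
  gcongr

end ZetaInvSq

/-! ### Heights at which ζ is not small -/

namespace ZetaInvSq

/-- The Dirichlet series of ζ⁻² is bounded on Re s = 2 by its absolute values, whose sum does not
depend on t. -/
lemma exists_norm_riemannZeta_two_ge :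
    ∃ m : ℝ, 0 < m ∧ ∀ t : ℝ, m ≤ ‖riemannZeta (2 + t * Complex.I)‖ := by
  have hre : ∀ t : ℝ, (2 + t * Complex.I : ℂ).re = 2 := fun t => by simp
  set B : ℝ := ∑' n, ‖LSeries.term (fun n => (mobius₂ n : ℂ)) 2 n‖ with hB
  have hb : ∀ t : ℝ, 1 ≤ (B + 1) * ‖riemannZeta (2 + t * Complex.I)‖ ^ 2 := by
    intro t
    obtain ⟨h1, h2⟩ := LSeries_mobius₂ (s := 2 + t * Complex.I) (by rw [hre]; norm_num)
    have hn : ∀ n, ‖LSeries.term (fun n => (mobius₂ n : ℂ)) (2 + t * Complex.I) n‖ =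
        ‖LSeries.term (fun n => (mobius₂ n : ℂ)) 2 n‖ := fun n => by
      rw [LSeries.norm_term_eq, LSeries.norm_term_eq, hre]; norm_num
    have h3 : ‖(riemannZeta (2 + t * Complex.I) ^ 2)⁻¹‖ ≤ B := by
      rw [← h2, LSeries, hB]
      simp_rw [← hn]
      exact norm_tsum_le_tsum_norm h1.norm
    have h4 : riemannZeta (2 + t * Complex.I) ≠ 0 :=
      riemannZeta_ne_zero_of_one_lt_re (by rw [hre]; norm_num)
    rw [norm_inv, norm_pow] at h3
    have h5 : 0 < ‖riemannZeta (2 + t * Complex.I)‖ ^ 2 := by positivity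
    rw [inv_le_iff_one_le_mul₀ h5] at h3
    linarith
  have hB0 : 0 ≤ B := tsum_nonneg fun _ => norm_nonneg _
  refine ⟨1 / (B + 1), by positivity, fun t => ?_⟩
  rw [div_le_iff₀ (by positivity), mul_comm]
  by_contra! h
  have := hb t
  have h0 := norm_nonneg (riemannZeta (2 + t * Complex.I))
  nlinarith [mul_nonneg hB0 h0]

/-- Finitely many points leave a gap of comparable size in a given interval. -/
lemma exists_far_from_finset (Y : Finset ℝ) :
    ∃ u : ℝ, 0 ≤ u ∧ u ≤ 1 / 8 ∧ ∀ y ∈ Y, 1 / (32 * ((Y.card : ℝ) + 1)) ≤ |u - y| := by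
  by_contra! hcon
  set n : ℝ := (Y.card : ℝ) + 1 with hn
  have hn0 : 0 < n := by positivity
  -- Pigeonhole on one more candidate than there are points: the candidates have spacing 1/(8n), so
  -- two of them cannot both lie within 1/(32n) of the same y.
  have hu : ∀ j ∈ Finset.range (Y.card + 1), ∃ y ∈ Y, |(j : ℝ) / (8 * n) - y| < 1 / (32 * n) := by
    intro j hj
    refine hcon _ (by positivity) ?_
    have : (j : ℝ) ≤ Y.card := by exact_mod_cast Nat.lt_succ_iff.1 (Finset.mem_range.1 hj)
    rw [div_le_div_iff₀ (by positivity) (by norm_num)]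
    linarith
  choose! φ hφ hφ' using hu
  obtain ⟨i, hi, j, hj, hij, he⟩ := Finset.exists_ne_map_eq_of_card_lt_of_maps_to
    (s := Finset.range (Y.card + 1)) (t := Y) (by simp) (f := φ) hφ
  have h1 := hφ' i hi
  have h2 := hφ' j hj
  rw [he] at h1
  have h3 : |(i : ℝ) / (8 * n) - j / (8 * n)| < 1 / (16 * n) := by
    have := abs_sub_le ((i : ℝ) / (8 * n)) (φ j) (j / (8 * n))
    rw [abs_sub_comm (φ j)] at this
    have e : 1 / (16 * n) = 1 / (32 * n) + 1 / (32 * n) := by field_simp; norm_num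
    linarith
  have h4 : (1 : ℝ) ≤ |(i : ℝ) - j| := by
    have : (1 : ℤ) ≤ |(i : ℤ) - j| := Int.one_le_abs (sub_ne_zero.2 (by exact_mod_cast hij))
    exact_mod_cast this
  rw [← sub_div, abs_div, abs_of_pos (by positivity : 0 < 8 * n),
    div_lt_div_iff₀ (by positivity) (by positivity)] at h3
  nlinarith

/-- A gap of 1/(32(n+1)) makes each factor at least 1/(112(n+1)) ≥ e^(-112(n+1)), and there are n
factors. This crude bound suffices: X will be of order log T, and log² T is negligible against T. -/
lemma exp_le_prod_norm_sub {S : Finset ℂ} {z : ℂ} {X : ℝ}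
    (h : ∀ y ∈ S.image Complex.im, 1 / (32 * (((S.image Complex.im).card : ℝ) + 1)) ≤ |z.im - y|)
    (hX : (S.card : ℝ) ≤ X) :
    Real.exp (-(112 * (X + 1) ^ 2)) ≤ ∏ p ∈ S, (‖z - p‖ / (2 * (7 / 4))) := by
  set n : ℝ := (S.card : ℝ) with hn
  have hn0 : 0 ≤ n := Nat.cast_nonneg _
  have hcardY : ((S.image Complex.im).card : ℝ) ≤ n := by
    rw [hn]
    exact_mod_cast Finset.card_image_le
  have h1 : ∀ p ∈ S, Real.exp (-(112 * (n + 1))) ≤ ‖z - p‖ / (2 * (7 / 4)) := by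
    intro p hp
    have h1 := h p.im (Finset.mem_image_of_mem _ hp)
    have h2 : |z.im - p.im| ≤ ‖z - p‖ := by
      simpa using Complex.abs_im_le_norm (z - p)
    have h3 : 1 / (32 * (n + 1)) ≤ 1 / (32 * (((S.image Complex.im).card : ℝ) + 1)) := by
      gcongr
    have h4 : Real.exp (-(112 * (n + 1))) ≤ (112 * (n + 1))⁻¹ := by
      rw [Real.exp_neg]
      gcongr
      linarith [Real.add_one_le_exp (112 * (n + 1))]
    rw [le_div_iff₀ (by norm_num)]
    have h5 : (112 * (n + 1))⁻¹ * (2 * (7 / 4)) = 1 / (32 * (n + 1)) := by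
      field_simp
      norm_num
    nlinarith
  refine le_trans ?_ (Finset.prod_le_prod (fun p _ => (Real.exp_pos _).le) h1)
  rw [Finset.prod_const, ← Real.exp_nat_mul, ← hn]
  refine Real.exp_le_exp.2 ?_
  have : (n + 1) ^ 2 ≤ (X + 1) ^ 2 := by gcongr
  nlinarith

/-- An explicit lower bound for `ζ` on a horizontal segment close to any given height. -/
lemma exists_norm_riemannZeta_ge_aux
    (hsimple : ∀ ρ ∈ nontrivialZeros, deriv riemannZeta ρ ≠ 0) :
    ∃ m A κ : ℝ, 0 < m ∧ 0 < κ ∧ m ≤ A ∧ ∀ T : ℝ, 3 ≤ T → ∃ u : ℝ, 0 ≤ u ∧ u ≤ 1 / 8 ∧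
      ∀ σ ∈ Set.Icc (1 / 2 : ℝ) (3 / 2),
        m * Real.exp (-(34 * Real.log (A * T / m))) *
          Real.exp (-(112 * (Real.log (A * T / m) / κ + 1) ^ 2)) ≤
            ‖riemannZeta (σ + (T + u : ℝ) * Complex.I)‖ := by
  classical
  obtain ⟨C, hC, hCb⟩ := exists_norm_riemannZeta_le (δ := 1 / 4) (by norm_num) (by norm_num)
  obtain ⟨m, hm, hmb⟩ := exists_norm_riemannZeta_two_ge
  have hCT : ∀ s : ℂ, 1 / 4 ≤ s.re → s.re ≤ 4 → 1 ≤ |s.im| → ‖riemannZeta s‖ ≤ C * |s.im| := by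
    intro s h1 h2 h3
    refine (hCb s h1 h2 h3).trans ?_
    gcongr
    calc |s.im| ^ (1 - 1 / 4 : ℝ) ≤ |s.im| ^ (1 : ℝ) :=
          Real.rpow_le_rpow_of_exponent_le h3 (by norm_num)
      _ = |s.im| := Real.rpow_one _
  have hκ : 0 < Real.log (35 / 32) := Real.log_pos (by norm_num)
  -- The factor 2C absorbs T + 7/4 ≤ 2T, and the extra m makes the bound at the centre strict. The
  -- number 35/32 is the ratio R/r₁ of the radii 7/4 and 8/5, which governs the zero count.
  refine ⟨m, 2 * C + m, Real.log (35 / 32), hm, hκ, by linarith, fun T hT => ?_⟩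
  set A := 2 * C + m with hA
  -- Around 2 + iT, radius 7/4 stays in Re s ≥ 1/4, where the growth bound holds, and radius 8/5
  -- meets only non-trivial zeros. The points σ + i(T+u) lie within 1.51 of the centre; 2·1.51/(8/5
  -- - 1.51) < 34 explains the constant 34.
  set c : ℂ := 2 + T * Complex.I with hc
  have hcre : c.re = 2 := by simp [hc]
  have hcim : c.im = T := by simp [hc]
  set F : ℂ → ℂ := fun z => riemannZeta (c + z) with hF
  have hreim : ∀ z : ℂ, ∀ r : ℝ, ‖z‖ < r → (c + z).re ∈ Set.Ioo (2 - r) (2 + r) ∧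
      (c + z).im ∈ Set.Ioo (T - r) (T + r) := by
    intro z r hz
    have h1 := abs_lt.1 ((Complex.abs_re_le_norm z).trans_lt hz)
    have h2 := abs_lt.1 ((Complex.abs_im_le_norm z).trans_lt hz)
    rw [Complex.add_re, Complex.add_im, hcre, hcim]
    exact ⟨⟨by linarith, by linarith⟩, ⟨by linarith, by linarith⟩⟩
  have hne1 : ∀ z : ℂ, ‖z‖ < 15 / 8 → c + z ≠ 1 := by
    intro z hz h
    have := (hreim z _ hz).2.1
    rw [h, Complex.one_im] at this
    linarith
  have hFd : DifferentiableOn ℂ F (Metric.ball 0 (15 / 8)) := by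
    intro z hz
    have : DifferentiableAt ℂ F z := DifferentiableAt.comp (f := fun z => c + z) z
      (differentiableAt_riemannZeta (hne1 z (by simpa using hz))) (by fun_prop)
    exact this.differentiableWithinAt
  have hFM : ∀ z : ℂ, ‖z‖ = 7 / 4 → ‖F z‖ ≤ A * T := by
    intro z hz
    have h1 := abs_le.1 ((Complex.abs_re_le_norm z).trans_eq hz)
    have h2 := abs_le.1 ((Complex.abs_im_le_norm z).trans_eq hz)
    have e1 : (c + z).re = 2 + z.re := by rw [Complex.add_re, hcre]
    have e2 : (c + z).im = T + z.im := by rw [Complex.add_im, hcim]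
    have e3 : |(c + z).im| = T + z.im := by rw [e2, abs_of_pos]; linarith
    refine (hCT (c + z) (by rw [e1]; linarith) (by rw [e1]; linarith) (by rw [e3]; linarith)).trans ?_
    rw [e3, hA]
    nlinarith
  have hF0m : m ≤ ‖F 0‖ := by simpa [hF, hc] using hmb T
  have hF0 : F 0 ≠ 0 := fun h => by rw [h, norm_zero] at hF0m; linarith
  have hF0A : ‖F 0‖ < A * T := by
    have := hCT c (by rw [hcre]; norm_num) (by rw [hcre]; norm_num)
      (by rw [hcim, abs_of_pos] <;> linarith)
    rw [hcim, abs_of_pos (by linarith)] at this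
    have h2 : ‖F 0‖ ≤ C * T := by simpa [hF] using this
    rw [hA]
    nlinarith
  set S : Finset ℂ := ((zerosUpTo (T + 2)).image (fun ρ => ρ - c)).filter (fun p => ‖p‖ ≤ 8 / 5) with hSdef
  have hzmem : ∀ ρ, ρ ∈ zerosUpTo (T + 2) ↔ ρ ∈ nontrivialZeros ∧ |ρ.im| ≤ T + 2 := by
    intro ρ
    rw [zerosUpTo, Set.Finite.mem_toFinset]
    rfl
  have hS : ∀ p ∈ S, ‖p‖ ≤ 8 / 5 ∧ F p = 0 ∧ deriv F p ≠ 0 := by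
    intro p hp
    obtain ⟨hp1, hp2⟩ := Finset.mem_filter.1 hp
    obtain ⟨ρ, hρ, rfl⟩ := Finset.mem_image.1 hp1
    have hρz := ((hzmem ρ).1 hρ).1
    have e : c + (ρ - c) = ρ := by ring
    refine ⟨hp2, by simp only [hF]; rw [e]; exact hρz.1, ?_⟩
    simp only [hF]
    rw [deriv_comp_const_add, e]
    exact hsimple ρ hρz
  have hS' : ∀ z : ℂ, ‖z‖ < 8 / 5 → F z = 0 → z ∈ S := by
    intro z hz hz0
    obtain ⟨h1, h2⟩ := hreim z _ hz
    refine Finset.mem_filter.2 ⟨Finset.mem_image.2 ⟨c + z, (hzmem _).2 ⟨⟨hz0, ?_, ?_⟩, ?_⟩, by ring⟩, hz.le⟩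
    · linarith [h1.1]
    · by_contra! h
      exact riemannZeta_ne_zero_of_one_le_re h hz0
    · rw [abs_of_pos] <;> linarith [h2.1, h2.2]
  obtain ⟨hcard, hlow⟩ := norm_ge_of_simple_zeros (by norm_num) (by norm_num) (by norm_num) hFd hFM
    hF0 hF0A S hS hS'
  have hAT : 0 < A * T := lt_of_le_of_lt (norm_nonneg _) hF0A
  set Q := Real.log (A * T / m) with hQ
  have hQL : Real.log (A * T / ‖F 0‖) ≤ Q := by
    refine Real.log_le_log (by positivity) ?_
    gcongr
  have hn : (S.card : ℝ) ≤ Q / Real.log (35 / 32) := by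
    rw [le_div_iff₀ hκ, ← Real.log_pow]
    refine Real.log_le_log (by positivity) ?_
    rw [le_div_iff₀ hm]
    refine le_trans ?_ hcard
    rw [show (7 / 4 / (8 / 5) : ℝ) = 35 / 32 by norm_num]
    gcongr
  obtain ⟨u, hu0, hu1, hu⟩ := exists_far_from_finset (S.image Complex.im)
  refine ⟨u, hu0, hu1, fun σ hσ => ?_⟩
  set z : ℂ := ((σ - 2 : ℝ) : ℂ) + u * Complex.I with hz
  have hcz : c + z = σ + (T + u : ℝ) * Complex.I := by
    simp only [hc, hz]; push_cast; ring
  have hzn : ‖z‖ ≤ 151 / 100 := by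
    rw [hz, Complex.norm_add_mul_I]
    refine Real.sqrt_le_iff.2 ⟨by norm_num, ?_⟩
    nlinarith [hσ.1, hσ.2]
  have key := hlow z (by linarith)
  have hprod : Real.exp (-(112 * (Q / Real.log (35 / 32) + 1) ^ 2)) ≤
      ∏ p ∈ S, (‖z - p‖ / (2 * (7 / 4))) :=
    exp_le_prod_norm_sub (by rw [show z.im = u by simp [hz]]; exact hu) hn
  have hL0 : 0 ≤ Q := (Real.log_nonneg ((one_le_div (by positivity)).2 hF0A.le)).trans hQL
  have hexp : Real.exp (-(34 * Q)) ≤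
      Real.exp (-(2 * Real.log (A * T / ‖F 0‖) * ‖z‖ / (8 / 5 - ‖z‖))) := by
    refine Real.exp_le_exp.2 (neg_le_neg ?_)
    rw [div_le_iff₀ (by linarith)]
    have h1 : 2 * Real.log (A * T / ‖F 0‖) * ‖z‖ ≤ 2 * Q * (151 / 100) := by gcongr
    nlinarith
  rw [← hcz]
  refine le_trans ?_ key
  gcongr

/-- The explicit lower bound is exp(-O(log² T)), which eventually exceeds e^(-εT), and hence
e^(-ε(T+u)). Conjugation symmetry handles the line at height -T. -/
theorem exists_norm_riemannZeta_ge
    (hsimple : ∀ ρ ∈ nontrivialZeros, deriv riemannZeta ρ ≠ 0) {ε : ℝ} (hε : 0 < ε) (N : ℝ) :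
    ∃ T : ℝ, N ≤ T ∧ ∀ σ ∈ Set.Icc (1 / 2 : ℝ) (3 / 2),
      Real.exp (-(ε * T)) ≤ ‖riemannZeta (σ + (T : ℝ) * Complex.I)‖ ∧
      Real.exp (-(ε * T)) ≤ ‖riemannZeta (σ + (-T : ℝ) * Complex.I)‖ := by
  obtain ⟨m, A, κ, hm, hκ, hmA, h⟩ := exists_norm_riemannZeta_ge_aux hsimple
  have hA : 0 < A := hm.trans_le hmA
  set q := Real.log (A / m) with hq
  have hlo : (fun T : ℝ => -Real.log m + 34 * (Real.log T + q) +
      112 * ((Real.log T + q) / κ + 1) ^ 2) =o[atTop] (fun T : ℝ => T) := by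
    have l0 : ∀ a : ℝ, (fun _ : ℝ => a) =o[atTop] (fun T : ℝ => T) := fun a =>
      Asymptotics.isLittleO_const_id_atTop a
    have l1 : (fun T : ℝ => Real.log T) =o[atTop] (fun T : ℝ => T) := Real.isLittleO_log_id_atTop
    have l2 : (fun T : ℝ => Real.log T ^ 2) =o[atTop] (fun T : ℝ => T) :=
      Real.isLittleO_pow_log_id_atTop
    have := ((l2.const_mul_left (112 / κ ^ 2)).add
      (l1.const_mul_left (34 + 224 * (q / κ + 1) / κ))).add
      (l0 (-Real.log m + 34 * q + 112 * (q / κ + 1) ^ 2))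
    refine this.congr_left fun T => ?_
    field_simp
    ring
  have hev := (hlo.bound hε).and (eventually_ge_atTop (max 3 N))
  obtain ⟨T, hT1, hT2⟩ := hev.exists
  have hT3 : 3 ≤ T := (le_max_left _ _).trans hT2
  have hTN : N ≤ T := (le_max_right _ _).trans hT2
  obtain ⟨u, hu0, hu1, hb⟩ := h T hT3
  have hlog : Real.log (A * T / m) = Real.log T + q := by
    rw [hq, ← Real.log_mul (by positivity) (by positivity)]
    congr 1
    ring
  have hlow : ∀ σ ∈ Set.Icc (1 / 2 : ℝ) (3 / 2), Real.exp (-(ε * (T + u))) ≤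
      ‖riemannZeta (σ + (T + u : ℝ) * Complex.I)‖ := by
    intro σ hσ
    refine le_trans ?_ (hb σ hσ)
    rw [hlog]
    rw [show m * Real.exp (-(34 * (Real.log T + q))) =
      Real.exp (Real.log m) * Real.exp (-(34 * (Real.log T + q))) by rw [Real.exp_log hm],
      ← Real.exp_add, ← Real.exp_add]
    refine Real.exp_le_exp.2 ?_
    have h1 := (le_abs_self _).trans hT1
    rw [Real.norm_of_nonneg (by linarith : 0 ≤ T)] at h1
    nlinarith
  refine ⟨T + u, by linarith, fun σ hσ => ⟨hlow σ hσ, ?_⟩⟩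
  have hconj : riemannZeta (σ + (-(T + u) : ℝ) * Complex.I) =
      (starRingEnd ℂ) (riemannZeta (σ + (T + u : ℝ) * Complex.I)) := by
    rw [← riemannZeta_conj]
    congr 1
    simp
    ring
  rw [hconj, RCLike.norm_conj]
  exact hlow σ hσ

end ZetaInvSq

/-! ### The functional equation and its effect on the kernel -/

namespace ZetaInvSq

open MeasureTheory

lemma Gammaℝ_ne_zero_of_forall {s : ℂ} (h : ∀ m : ℕ, s / 2 ≠ -m) : Complex.Gammaℝ s ≠ 0 := by
  intro h0
  obtain ⟨n, hn⟩ := Complex.Gammaℝ_eq_zero_iff.1 h0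
  exact h n (by rw [hn]; ring)

/-- The functional equation of `ζ` in symmetric form. -/
lemma Gammaℝ_mul_riemannZeta {s : ℂ} (h : ∀ m : ℕ, s / 2 ≠ -m) (h' : ∀ m : ℕ, (1 - s) / 2 ≠ -m) :
    Complex.Gammaℝ s * riemannZeta s = Complex.Gammaℝ (1 - s) * riemannZeta (1 - s) := by
  have hs : s ≠ 0 := by
    rintro rfl
    exact h 0 (by simp)
  have hs' : 1 - s ≠ 0 := by
    intro h0
    exact h' 0 (by simp [h0])
  have := Gammaℝ_ne_zero_of_forall h
  have := Gammaℝ_ne_zero_of_forall h'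
  rw [riemannZeta_def_of_ne_zero hs, riemannZeta_def_of_ne_zero hs', completedRiemannZeta_one_sub]
  field_simp

lemma riemannZeta_one_sub_eq_zero_iff {s : ℂ} (h : ∀ m : ℕ, s / 2 ≠ -m)
    (h' : ∀ m : ℕ, (1 - s) / 2 ≠ -m) : riemannZeta (1 - s) = 0 ↔ riemannZeta s = 0 := by
  have e := Gammaℝ_mul_riemannZeta h h'
  have h1 := Gammaℝ_ne_zero_of_forall h
  have h2 := Gammaℝ_ne_zero_of_forall h'
  constructor <;> intro h0 <;> simpa [h0, h1, h2] using e

lemma Lam_eq (s : ℂ) : Lam s = Complex.Gammaℝ s / riemannZeta (1 - s) := by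
  rw [Lam, Complex.Gammaℝ_def]
  exact (div_eq_mul_inv _ _).symm

/-- Λ(s) is Γ_ℝ(s)/ζ(1-s), so Λ(s) = Λ(1-s) is the symmetric functional equation of ζ after
cross-multiplication. -/
theorem functionalEquation : FunctionalEquation := by
  intro s h h' hz hz'
  have e := Gammaℝ_mul_riemannZeta h h'
  rw [Lam_eq, Lam_eq, sub_sub_cancel]
  congr 1
  rw [div_eq_div_iff hz' hz, e]

lemma half_ne_neg_nat_of_im {s : ℂ} (h : s.im ≠ 0) (m : ℕ) : s / 2 ≠ -m := by
  intro h0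
  apply h
  have : s = -(2 * m : ℝ) := by push_cast; linear_combination 2 * h0
  rw [this]
  simp

lemma half_ne_neg_nat_of_re {s : ℂ} (h : -2 < s.re) (h0 : s ≠ 0) (m : ℕ) : s / 2 ≠ -m := by
  intro hm
  have e : s = -(2 * m : ℝ) := by push_cast; linear_combination 2 * hm
  rcases Nat.eq_zero_or_pos m with rfl | hm'
  · exact h0 (by simpa using e)
  · have : (1 : ℝ) ≤ m := by exact_mod_cast hm'
    rw [e] at h
    simp at h
    linarith

lemma nontrivialZeros_one_sub {ρ : ℂ} (h : ρ ∈ nontrivialZeros) : 1 - ρ ∈ nontrivialZeros := by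
  obtain ⟨h0, h1, h2⟩ := h
  have hre : (1 - ρ).re = 1 - ρ.re := by simp
  have hρ : ρ ≠ 0 := by rintro rfl; simp at h1
  have hρ' : 1 - ρ ≠ 0 := by
    intro h
    rw [h] at hre
    simp at hre
    linarith
  refine ⟨(riemannZeta_one_sub_eq_zero_iff (half_ne_neg_nat_of_re (by linarith) hρ)
    (half_ne_neg_nat_of_re (by linarith) hρ')).2 h0, ?_, ?_⟩ <;> linarith

lemma one_div_ne_zero_and_arg {x : ℂ} (hx : x ≠ 0) (h : |x.arg| < Real.pi / 2) :
    1 / x ≠ 0 ∧ |(1 / x).arg| < Real.pi / 2 := by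
  refine ⟨one_div_ne_zero hx, ?_⟩
  rw [one_div, Complex.abs_arg_inv]
  exact h

lemma arg_ne_pi_of_abs_lt {x : ℂ} (h : |x.arg| < Real.pi / 2) : x.arg ≠ Real.pi := by
  intro h0
  rw [h0, abs_of_pos Real.pi_pos] at h
  linarith [Real.pi_pos]

lemma csqrt_one_div {x : ℂ} (h : |x.arg| < Real.pi / 2) : csqrt (1 / x) = (csqrt x)⁻¹ := by
  rw [csqrt, csqrt, one_div x, Complex.inv_cpow _ _ (arg_ne_pi_of_abs_lt h)]

lemma kernel_eq {x : ℂ} (hx : x ≠ 0) (s : ℂ) : kernel x s = Lam s ^ 2 * csqrt x ^ (-s) := by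
  have hpi : (Real.pi : ℂ) ≠ 0 := Complex.ofReal_ne_zero.2 Real.pi_ne_zero
  have e : (Real.pi : ℂ) ^ (-s) = ((Real.pi : ℂ) ^ (-s / 2)) ^ 2 := by
    rw [sq, ← Complex.cpow_add _ _ hpi, add_halves]
  rw [kernel, Lam, ofReal_mul_cpow Real.pi_pos (csqrt_ne_zero hx), e]
  ring

/-- The kernel is Λ(s)² (√x)^(-s): reflecting s leaves the first factor unchanged and turns the
second into (√x)⁻¹ (1/√x)^(-s). -/
lemma kernel_one_sub (hFE : FunctionalEquation) {x s : ℂ} (hx : x ≠ 0) (hx' : |x.arg| < Real.pi / 2)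
    (h : ∀ m : ℕ, s / 2 ≠ -m) (h' : ∀ m : ℕ, (1 - s) / 2 ≠ -m) (hz : riemannZeta s ≠ 0) :
    kernel x (1 - s) = (csqrt x)⁻¹ * kernel (1 / x) s := by
  have hz' : riemannZeta (1 - s) ≠ 0 := fun h0 =>
    hz ((riemannZeta_one_sub_eq_zero_iff h h').1 h0)
  have hc := csqrt_ne_zero hx
  have harg : (csqrt x).arg ≠ Real.pi := by
    rw [arg_csqrt hx]
    have := abs_lt.1 hx'
    intro h0
    linarith [Real.pi_pos]
  rw [kernel_eq hx, kernel_eq (one_div_ne_zero hx), csqrt_one_div hx', ← hFE s h h' hz hz',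
    Complex.inv_cpow _ _ harg, ← Complex.cpow_neg, neg_neg, neg_sub, Complex.cpow_sub _ _ hc,
    Complex.cpow_one]
  ring

lemma differentiableAt_kernel {x s : ℂ} (hx : x ≠ 0) (h : -2 < s.re) (h0 : s ≠ 0)
    (hz : riemannZeta (1 - s) ≠ 0) : DifferentiableAt ℂ (kernel x) s := by
  have hv : (Real.pi : ℂ) * csqrt x ≠ 0 :=
    mul_ne_zero (Complex.ofReal_ne_zero.2 Real.pi_ne_zero) (csqrt_ne_zero hx)
  have h1 : DifferentiableAt ℂ (fun s => riemannZeta (1 - s)) s :=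
    DifferentiableAt.comp (f := fun s : ℂ => 1 - s) s
      (differentiableAt_riemannZeta (by simpa [sub_eq_self] using h0)) (by fun_prop)
  refine DifferentiableAt.mul (DifferentiableAt.mul ((differentiableAt_Gamma_half h h0).pow 2) ?_)
    (DifferentiableAt.const_cpow (by fun_prop) (Or.inl hv))
  exact (h1.pow 2).inv (pow_ne_zero 2 hz)

lemma norm_inv_riemannZeta_sq_le : ∃ B : ℝ, ∀ y : ℝ,
    ‖(riemannZeta (1 - ((-(1 / 2) : ℝ) + y * Complex.I)) ^ 2)⁻¹‖ ≤ B := by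
  refine ⟨∑' n, ‖LSeries.term (fun n => (mobius₂ n : ℂ)) (3 / 2) n‖, fun y => ?_⟩
  have hre : (1 - ((-(1 / 2) : ℝ) + y * Complex.I) : ℂ).re = 3 / 2 := by
    rw [Complex.sub_re, vertical_re]; norm_num
  obtain ⟨h1, h2⟩ := LSeries_mobius₂ (s := 1 - ((-(1 / 2) : ℝ) + y * Complex.I)) (by rw [hre]; norm_num)
  have hn : ∀ n, ‖LSeries.term (fun n => (mobius₂ n : ℂ)) (1 - ((-(1 / 2) : ℝ) + y * Complex.I)) n‖ =
      ‖LSeries.term (fun n => (mobius₂ n : ℂ)) (3 / 2) n‖ := fun n => by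
    rw [LSeries.norm_term_eq, LSeries.norm_term_eq, hre]; norm_num
  rw [← h2, LSeries]
  simp_rw [← hn]
  exact norm_tsum_le_tsum_norm h1.norm

lemma integrable_kernel_left {x : ℂ} (hx : x ≠ 0) (h : |x.arg| < Real.pi / 2) :
    Integrable fun y : ℝ => kernel x ((-(1 / 2) : ℝ) + y * Complex.I) := by
  have hV := pi_mul_csqrt_re_pos hx h
  have hi := integrable_Gamma_half_sq_mul_cpow hV (σ := -(1 / 2)) (by norm_num) (by norm_num)
    (by norm_num)
  obtain ⟨B, hB⟩ := norm_inv_riemannZeta_sq_le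
  have hc : Continuous fun y : ℝ => (riemannZeta (1 - ((-(1 / 2) : ℝ) + y * Complex.I)) ^ 2)⁻¹ := by
    refine continuous_vertical (f := fun s => (riemannZeta (1 - s) ^ 2)⁻¹) fun y => ?_
    have hre : (1 - ((-(1 / 2) : ℝ) + y * Complex.I) : ℂ).re = 3 / 2 := by
      rw [Complex.sub_re, vertical_re]; norm_num
    refine ContinuousAt.inv₀ (ContinuousAt.pow (ContinuousAt.comp (f := fun s : ℂ => 1 - s)
      (differentiableAt_riemannZeta ?_).continuousAt (by fun_prop)) 2) (pow_ne_zero 2 ?_)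
    · intro h1
      rw [h1] at hre
      norm_num at hre
    · exact riemannZeta_ne_zero_of_one_lt_re (by rw [hre]; norm_num)
  refine (hi.bdd_mul hc.aestronglyMeasurable (ae_of_all _ hB)).congr (ae_of_all _ fun y => ?_)
  simp only [kernel]
  ring

/-- On Re s = 3/2 the factor 1/ζ(1-s) lies outside the range of the Dirichlet series. Reflection to
Re s = -1/2 replaces any estimate there by the case of 1/x. -/
lemma kernel_right (hFE : FunctionalEquation) {x : ℂ} (hx : x ≠ 0) (hx' : |x.arg| < Real.pi / 2)
    (y : ℝ) : kernel x ((3 / 2 : ℝ) + y * Complex.I) =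
      (csqrt x)⁻¹ * kernel (1 / x) ((-(1 / 2) : ℝ) + (-y : ℝ) * Complex.I) := by
  set s : ℂ := (-(1 / 2) : ℝ) + (-y : ℝ) * Complex.I with hs
  have e : ((3 / 2 : ℝ) + y * Complex.I : ℂ) = 1 - s := by rw [hs]; push_cast; ring
  have hre : s.re = -(1 / 2) := vertical_re _ _
  have hre' : (1 - s).re = 3 / 2 := by rw [Complex.sub_re, hre]; norm_num
  have h0 : s ≠ 0 := fun h => by rw [h] at hre; norm_num at hre
  have h0' : 1 - s ≠ 0 := fun h => by rw [h] at hre'; norm_num at hre'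
  have k1 := half_ne_neg_nat_of_re (by rw [hre]; norm_num) h0
  have k2 := half_ne_neg_nat_of_re (by rw [hre']; norm_num) h0'
  rw [e]
  refine kernel_one_sub hFE hx hx' k1 k2 fun hz => ?_
  exact riemannZeta_ne_zero_of_one_lt_re (by rw [hre']; norm_num)
    ((riemannZeta_one_sub_eq_zero_iff k1 k2).2 hz)

lemma integrable_kernel_right (hFE : FunctionalEquation) {x : ℂ} (hx : x ≠ 0)
    (hx' : |x.arg| < Real.pi / 2) :
    Integrable fun y : ℝ => kernel x ((3 / 2 : ℝ) + y * Complex.I) := by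
  obtain ⟨h1, h2⟩ := one_div_ne_zero_and_arg hx hx'
  simp_rw [kernel_right hFE hx hx']
  exact ((integrable_kernel_left h1 h2).comp_neg).const_mul _

lemma integral_kernel_right (hFE : FunctionalEquation) {x : ℂ} (hx : x ≠ 0)
    (hx' : |x.arg| < Real.pi / 2) :
    ∫ y : ℝ, kernel x ((3 / 2 : ℝ) + y * Complex.I) =
      (csqrt x)⁻¹ * ∫ y : ℝ, kernel (1 / x) ((-(1 / 2) : ℝ) + y * Complex.I) := by
  simp_rw [kernel_right hFE hx hx']
  rw [integral_const_mul,
    integral_neg_eq_self (fun y : ℝ => kernel (1 / x) ((-(1 / 2) : ℝ) + y * Complex.I))]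

/-- The Gamma factor and the power together decay like e^(-ε|Im s|). The lower bound on ζ costs
e^(2η|Im s|) after squaring, and η ≤ ε/4 keeps half of the decay. -/
lemma exists_norm_kernel_le {x : ℂ} (hx : x ≠ 0) (h : |x.arg| < Real.pi / 2) :
    ∃ C ε : ℝ, 0 < C ∧ 0 < ε ∧ ∀ s : ℂ, ∀ η ≤ ε / 4, -(1 / 2) ≤ s.re → s.re ≤ 1 / 2 → 1 / 2 ≤ ‖s‖ →
      Real.exp (-(η * |s.im|)) ≤ ‖riemannZeta (1 - s)‖ →
      ‖kernel x s‖ ≤ C * Real.exp (-(ε / 2) * |s.im|) := by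
  obtain ⟨C, ε, hC, hε, hb⟩ := exists_norm_Gamma_half_sq_mul_cpow_le (pi_mul_csqrt_re_pos hx h)
  refine ⟨C, ε, hC, hε, fun s η hη h1 h2 h3 h4 => ?_⟩
  have h5 := hb s h1 (by linarith) h3
  have h6 : ‖(riemannZeta (1 - s) ^ 2)⁻¹‖ ≤ Real.exp (ε / 2 * |s.im|) := by
    rw [norm_inv, norm_pow]
    have h7 : Real.exp (-(ε / 2 * |s.im|)) ≤ ‖riemannZeta (1 - s)‖ ^ 2 := by
      refine le_trans ?_ (pow_le_pow_left₀ (Real.exp_pos _).le h4 2)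
      rw [← Real.exp_nat_mul]
      refine Real.exp_le_exp.2 ?_
      push_cast
      nlinarith [abs_nonneg s.im]
    rw [← neg_neg (ε / 2 * |s.im|), Real.exp_neg (-(ε / 2 * |s.im|))]
    gcongr
  have e : kernel x s = Complex.Gamma (s / 2) ^ 2 * (Real.pi * csqrt x) ^ (-s) *
      (riemannZeta (1 - s) ^ 2)⁻¹ := by
    rw [kernel]
    ring
  rw [e, norm_mul]
  calc _ ≤ C * Real.exp (-ε * |s.im|) * Real.exp (ε / 2 * |s.im|) := by gcongr
    _ = _ := by rw [mul_assoc, ← Real.exp_add]; ring_nf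

end ZetaInvSq

/-! ### Residues at the zeros and the theta relation -/

namespace ZetaInvSq

open MeasureTheory

lemma mem_zerosUpTo {T : ℝ} {ρ : ℂ} : ρ ∈ zerosUpTo T ↔ ρ ∈ nontrivialZeros ∧ |ρ.im| ≤ T := by
  rw [zerosUpTo, Set.Finite.mem_toFinset]
  rfl

lemma nontrivialZeros_ne {ρ : ℂ} (h : ρ ∈ nontrivialZeros) : ρ ≠ 0 ∧ 1 - ρ ≠ 0 := by
  obtain ⟨-, h1, h2⟩ := h
  constructor
  · rintro rfl
    simp at h1
  · intro h
    have := congrArg Complex.re h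
    simp at this
    linarith

/-- The regular part of `kernel x` at a zero: `(s - ρ)² * kernel x s`. -/
noncomputable def kernelNumer (x ρ s : ℂ) : ℂ :=
  Complex.Gamma (s / 2) ^ 2 * (dslope (fun s => riemannZeta (1 - s)) ρ s ^ 2)⁻¹ *
    (Real.pi * csqrt x) ^ (-s)

/-- With ρ also 1 - ρ is a simple zero, so the divided difference of ζ(1-s) at ρ takes the non-zero
value -ζ'(1-ρ) and its inverse square is analytic. -/
lemma analyticAt_kernelNumer (hsimple : ∀ ρ ∈ nontrivialZeros, deriv riemannZeta ρ ≠ 0) {x ρ : ℂ}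
    (hx : x ≠ 0) (hρ : ρ ∈ nontrivialZeros) : AnalyticAt ℂ (kernelNumer x ρ) ρ := by
  have hv : (Real.pi : ℂ) * csqrt x ≠ 0 :=
    mul_ne_zero (Complex.ofReal_ne_zero.2 Real.pi_ne_zero) (csqrt_ne_zero hx)
  obtain ⟨hρ0, hρ1⟩ := nontrivialZeros_ne hρ
  have hd : DifferentiableOn ℂ (fun s => riemannZeta (1 - s)) {0}ᶜ := fun s hs =>
    (DifferentiableAt.comp (f := fun s : ℂ => 1 - s) s
      (differentiableAt_riemannZeta (by simpa [sub_eq_self] using hs))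
      (by fun_prop)).differentiableWithinAt
  have hnhds : ({0}ᶜ : Set ℂ) ∈ 𝓝 ρ := isOpen_compl_singleton.mem_nhds hρ0
  have hds : AnalyticAt ℂ (dslope (fun s => riemannZeta (1 - s)) ρ) ρ :=
    ((Complex.differentiableOn_dslope hnhds).2 hd).analyticAt hnhds
  have hne : dslope (fun s => riemannZeta (1 - s)) ρ ρ ≠ 0 := by
    rw [dslope_same, deriv_comp_const_sub]
    exact neg_ne_zero.2 (hsimple _ (nontrivialZeros_one_sub hρ))
  have hG : AnalyticAt ℂ (fun s => Complex.Gamma (s / 2)) ρ := by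
    refine Complex.analyticAt_iff_eventually_differentiableAt.2 ?_
    have h1 : ∀ᶠ z : ℂ in 𝓝 ρ, -2 < z.re :=
      Complex.continuous_re.continuousAt.eventually (lt_mem_nhds (by linarith [hρ.2.1]))
    filter_upwards [h1, hnhds] with z hz hz0 using differentiableAt_Gamma_half hz hz0
  have hp : AnalyticAt ℂ (fun s => ((Real.pi : ℂ) * csqrt x) ^ (-s)) ρ :=
    Differentiable.analyticAt (fun s => DifferentiableAt.const_cpow (by fun_prop) (Or.inl hv)) ρ
  exact ((hG.pow 2).mul ((hds.pow 2).inv (pow_ne_zero 2 hne))).mul hp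

lemma kernel_eq_kernelNumer_div {x ρ s : ℂ} (hρ : ρ ∈ nontrivialZeros) (hs : s ≠ ρ) :
    kernel x s = kernelNumer x ρ s / (s - ρ) ^ 2 := by
  have hs' : s - ρ ≠ 0 := sub_ne_zero.2 hs
  have h0 : riemannZeta (1 - ρ) = 0 := (nontrivialZeros_one_sub hρ).1
  have e : riemannZeta (1 - s) = (s - ρ) * dslope (fun s => riemannZeta (1 - s)) ρ s := by
    have := sub_smul_dslope (fun s => riemannZeta (1 - s)) ρ s
    rw [smul_eq_mul, h0, sub_zero] at this
    exact this.symm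
  rw [kernel, kernelNumer, e, mul_pow, mul_inv]
  field_simp

/-- Away from ρ the function differentiated in `residueTerm` is `kernelNumer`, but at ρ itself the
factor (s - ρ)² makes it 0. Hence the derivative is read off as a limit over punctured
neighbourhoods. -/
lemma residueTerm_eq (hsimple : ∀ ρ ∈ nontrivialZeros, deriv riemannZeta ρ ≠ 0) {x ρ : ℂ}
    (hx : x ≠ 0) (hρ : ρ ∈ nontrivialZeros) : residueTerm ρ x = deriv (kernelNumer x ρ) ρ := by
  rw [residueTerm]
  have he : ∀ s : ℂ, s ≠ ρ → (s - ρ) ^ 2 * Complex.Gamma (s / 2) ^ 2 *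
      (riemannZeta (1 - s) ^ 2)⁻¹ * (Real.pi * csqrt x) ^ (-s) = kernelNumer x ρ s := fun s hs => by
    have hs' : s - ρ ≠ 0 := sub_ne_zero.2 hs
    have h1 := kernel_eq_kernelNumer_div (x := x) hρ hs
    rw [eq_div_iff (pow_ne_zero 2 hs')] at h1
    rw [← h1, kernel]
    ring
  have hlim : Tendsto (deriv (kernelNumer x ρ)) (𝓝[≠] ρ) (𝓝 (deriv (kernelNumer x ρ) ρ)) :=
    (analyticAt_kernelNumer hsimple hx hρ).deriv.continuousAt.tendsto.mono_left nhdsWithin_le_nhds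
  refine (hlim.congr' ?_).limUnder_eq
  filter_upwards [self_mem_nhdsWithin] with s hs
  refine (EventuallyEq.deriv_eq ?_).symm
  filter_upwards [isOpen_compl_singleton.mem_nhds hs] with w hw using he w hw

/-- The analytic continuation of `kernel x` to a neighbourhood of the origin. -/
lemma kernel_eq_near_zero {x s : ℂ} (hs : s ≠ 0) :
    kernel x s = (s ^ 2 * (4 * Complex.Gamma (s / 2 + 1) ^ 2 * (riemannZeta₁ (1 - s) ^ 2)⁻¹ *
      (Real.pi * csqrt x) ^ (-s))) / (s - 0) ^ 2 := by
  have h1 : riemannZeta₁ (1 - s) = -s * riemannZeta (1 - s) := by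
    rw [riemannZeta₁_eq_mul (by simpa [sub_eq_self] using hs)]
    ring
  rw [kernel, Gamma_half_sq_eq hs, h1, sub_zero, mul_pow, mul_inv, neg_sq]
  field_simp

lemma analyticAt_kernel_numer_zero {x : ℂ} (hx : x ≠ 0) :
    AnalyticAt ℂ (fun s => 4 * Complex.Gamma (s / 2 + 1) ^ 2 * (riemannZeta₁ (1 - s) ^ 2)⁻¹ *
      (Real.pi * csqrt x) ^ (-s)) 0 := by
  have hv : (Real.pi : ℂ) * csqrt x ≠ 0 :=
    mul_ne_zero (Complex.ofReal_ne_zero.2 Real.pi_ne_zero) (csqrt_ne_zero hx)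
  have hG : AnalyticAt ℂ (fun s => Complex.Gamma (s / 2 + 1)) 0 := by
    refine Complex.analyticAt_iff_eventually_differentiableAt.2 ?_
    have h1 : ∀ᶠ z : ℂ in 𝓝 0, -2 < z.re :=
      Complex.continuous_re.continuousAt.eventually (lt_mem_nhds (by simp))
    filter_upwards [h1] with z hz
    refine DifferentiableAt.comp (f := fun s : ℂ => s / 2 + 1) z
      (differentiableAt_Gamma_of_re_pos ?_) (by fun_prop)
    simp
    linarith
  have hz : AnalyticAt ℂ (fun s => riemannZeta₁ (1 - s)) 0 :=
    Differentiable.analyticAt (differentiable_riemannZeta₁.comp (by fun_prop : Differentiable ℂ fun s : ℂ => 1 - s)) 0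
  have hp : AnalyticAt ℂ (fun s : ℂ => ((Real.pi : ℂ) * csqrt x) ^ (-s)) 0 :=
    Differentiable.analyticAt (fun s => DifferentiableAt.const_cpow (by fun_prop) (Or.inl hv)) 0
  have hne : riemannZeta₁ (1 - 0) ≠ 0 := riemannZeta₁_ne_zero (by simp)
  exact ((analyticAt_const.mul (hG.pow 2)).mul ((hz.pow 2).inv (pow_ne_zero 2 hne))).mul hp

/-- The residue theorem for `kernel x` on a rectangle around the critical strip. -/
lemma rectIntegral_kernel (hsimple : ∀ ρ ∈ nontrivialZeros, deriv riemannZeta ρ ≠ 0) {x : ℂ}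
    (hx : x ≠ 0) {T : ℝ} (hT : 0 < T) (hTz : ∀ ρ ∈ nontrivialZeros, |ρ.im| ≠ T) :
    rectIntegral (kernel x) (-(1 / 2)) (3 / 2) (-T) T =
      2 * Real.pi * Complex.I * zeroPartialSum x T := by
  classical
  have h0mem : (0 : ℂ) ∉ zerosUpTo T := fun h => (nontrivialZeros_ne (mem_zerosUpTo.1 h).1).1 rfl
  -- The origin is listed as a pole, although the kernel has only a removable singularity there,
  -- because the formal value at 0 need not be the limit. Its numerator contains s², so its residue
  -- is 0.
  set h : ℂ → ℂ → ℂ := fun p s => if p = 0 then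
    s ^ 2 * (4 * Complex.Gamma (s / 2 + 1) ^ 2 * (riemannZeta₁ (1 - s) ^ 2)⁻¹ *
      (Real.pi * csqrt x) ^ (-s)) else kernelNumer x p s with hh
  have hh0 : h 0 = fun s => s ^ 2 * (4 * Complex.Gamma (s / 2 + 1) ^ 2 *
      (riemannZeta₁ (1 - s) ^ 2)⁻¹ * (Real.pi * csqrt x) ^ (-s)) := by
    funext s
    simp [hh]
  have hhρ : ∀ ρ ∈ zerosUpTo T, h ρ = kernelNumer x ρ := fun ρ hρ => by
    funext s
    simp [hh, (nontrivialZeros_ne (mem_zerosUpTo.1 hρ).1).1]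
  have ha0 := analyticAt_kernel_numer_zero hx
  rw [rectIntegral_eq_sum_residues (by norm_num) (by linarith) (insert 0 (zerosUpTo T)) ?_ ?_ h ?_ ?_]
  · rw [Finset.sum_insert h0mem, zeroPartialSum]
    have hd0 : deriv (h 0) 0 = 0 := by
      rw [hh0]
      have := ((hasDerivAt_id (0 : ℂ)).pow 2).mul ha0.differentiableAt.hasDerivAt
      exact (this.congr_deriv (by simp)).deriv
    rw [hd0, zero_add]
    congr 1
    refine Finset.sum_congr rfl fun ρ hρ => ?_
    rw [hhρ ρ hρ, residueTerm_eq hsimple hx (mem_zerosUpTo.1 hρ).1]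
  · intro p hp
    rw [Complex.mem_reProdIm]
    rcases Finset.mem_insert.1 hp with rfl | hp
    · refine ⟨by norm_num, ?_⟩
      simpa using hT
    · obtain ⟨h1, h2⟩ := mem_zerosUpTo.1 hp
      refine ⟨⟨by linarith [h1.2.1], by linarith [h1.2.2]⟩, ?_⟩
      exact abs_lt.1 (lt_of_le_of_ne h2 (hTz p h1))
  · intro z hz hzS
    rw [Complex.mem_reProdIm] at hz
    obtain ⟨⟨hz1, hz2⟩, hz3⟩ := hz
    have hz0 : z ≠ 0 := fun h => hzS (h ▸ Finset.mem_insert_self _ _)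
    refine differentiableAt_kernel hx (by linarith) hz0 fun hzero => ?_
    by_cases hz1' : 1 - z = 0
    · rw [hz1', riemannZeta_zero] at hzero
      norm_num at hzero
    have hre : (1 - z).re = 1 - z.re := by simp
    have hzz := (riemannZeta_one_sub_eq_zero_iff (half_ne_neg_nat_of_re (by linarith) hz0)
      (half_ne_neg_nat_of_re (by rw [hre]; linarith) hz1')).1 hzero
    have hre0 : 0 < z.re := by
      by_contra! hle
      exact riemannZeta_ne_zero_of_one_le_re (by rw [hre]; linarith) hzero
    have hre1 : z.re < 1 := by
      by_contra! hle
      exact riemannZeta_ne_zero_of_one_le_re hle hzz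
    exact hzS (Finset.mem_insert_of_mem (mem_zerosUpTo.2 ⟨⟨hzz, hre0, hre1⟩, abs_le.2 hz3⟩))
  · intro p hp
    rcases Finset.mem_insert.1 hp with rfl | hp
    · rw [hh0]
      exact (analyticAt_id.pow 2).mul ha0
    · rw [hhρ p hp]
      exact analyticAt_kernelNumer hsimple hx (mem_zerosUpTo.1 hp).1
  · intro p hp
    filter_upwards [self_mem_nhdsWithin] with z hz
    rcases Finset.mem_insert.1 hp with rfl | hp
    · rw [hh0]
      exact kernel_eq_near_zero hz
    · rw [hhρ p hp]
      exact kernel_eq_kernelNumer_div (mem_zerosUpTo.1 hp).1 hz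

/-- On a horizontal line along which `ζ` is not small on the right half of the strip, the kernel is
small on the whole strip. -/
lemma exists_norm_kernel_horizontal_le (hFE : FunctionalEquation) {x : ℂ} (hx : x ≠ 0)
    (h : |x.arg| < Real.pi / 2) : ∃ η C : ℝ, 0 < η ∧ ∀ s : ℂ, 1 ≤ |s.im| →
      -(1 / 2) ≤ s.re → s.re ≤ 3 / 2 →
      (s.re ≤ 1 / 2 → Real.exp (-(η * |s.im|)) ≤ ‖riemannZeta (1 - s)‖) →
      (1 / 2 ≤ s.re → Real.exp (-(η * |s.im|)) ≤ ‖riemannZeta s‖) →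
      ‖kernel x s‖ ≤ C * Real.exp (-η * |s.im|) := by
  obtain ⟨h1, h2⟩ := one_div_ne_zero_and_arg hx h
  obtain ⟨C, ε, hC, hε, hb⟩ := exists_norm_kernel_le hx h
  obtain ⟨C', ε', hC', hε', hb'⟩ := exists_norm_kernel_le h1 h2
  set η := min (ε / 4) (ε' / 4) with hη
  have hη1 : η ≤ ε / 4 := min_le_left _ _
  have hη2 : η ≤ ε' / 4 := min_le_right _ _
  have hη0 : 0 < η := lt_min (by positivity) (by positivity)
  have hd : 0 ≤ ‖(csqrt x)⁻¹‖ * C' := by positivity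
  refine ⟨η, C + ‖(csqrt x)⁻¹‖ * C', hη0, fun s him hre1 hre2 hl hr => ?_⟩
  have him0 : s.im ≠ 0 := by
    intro h0
    rw [h0] at him
    norm_num at him
  have him' : (1 - s).im ≠ 0 := by simpa using him0
  rcases le_total s.re (1 / 2) with hs | hs
  · refine (hb s η hη1 hre1 hs (by linarith [Complex.abs_im_le_norm s]) (hl hs)).trans ?_
    gcongr
    · linarith
    · linarith
  · have ere : (1 - s).re = 1 - s.re := by simp
    have eim : |(1 - s).im| = |s.im| := by simp
    have hz : riemannZeta s ≠ 0 := fun h0 => by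
      have := hr hs
      rw [h0, norm_zero] at this
      exact (Real.exp_pos _).not_ge this
    have k1 := half_ne_neg_nat_of_im him0
    have k2 := half_ne_neg_nat_of_im him'
    have e := kernel_one_sub hFE (s := 1 - s) hx h k2 (by rw [sub_sub_cancel]; exact k1)
      (fun h0 => hz ((riemannZeta_one_sub_eq_zero_iff k1 k2).1 h0))
    rw [sub_sub_cancel] at e
    have h3 := hb' (1 - s) η hη2 (by rw [ere]; linarith) (by rw [ere]; linarith)
      (by linarith [Complex.abs_im_le_norm (1 - s)]) (by rw [eim, sub_sub_cancel]; exact hr hs)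
    rw [eim] at h3
    rw [e, norm_mul]
    calc _ ≤ ‖(csqrt x)⁻¹‖ * (C' * Real.exp (-(ε' / 2) * |s.im|)) := by gcongr
      _ = ‖(csqrt x)⁻¹‖ * C' * Real.exp (-(ε' / 2) * |s.im|) := by ring
      _ ≤ (C + ‖(csqrt x)⁻¹‖ * C') * Real.exp (-η * |s.im|) := by
          gcongr
          · linarith
          · linarith

/-- The residue theorem between Re s = -1/2 and Re s = 3/2: the left line gives the series at x and
the right line, by reflection, the series at 1/x. Convergence of the zero sum allows its value to be
computed along the selected heights alone. -/
theorem zeroSeries_eq (hsimple : ∀ ρ ∈ nontrivialZeros, deriv riemannZeta ρ ≠ 0)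
    (hFE : FunctionalEquation) {x : ℂ} (hx : x ≠ 0) (h : |x.arg| < Real.pi / 2)
    (hconv : ZeroSeriesConverges x) :
    zeroSeries x = (csqrt x)⁻¹ * (4 * mobiusSeries (1 / x)) - 4 * mobiusSeries x := by
  obtain ⟨h1, h2⟩ := one_div_ne_zero_and_arg hx h
  obtain ⟨η, C, hη, hb⟩ := exists_norm_kernel_horizontal_le hFE hx h
  choose T hTN hTz using fun k : ℕ => exists_norm_riemannZeta_ge hsimple hη ((k : ℝ) + 1)
  have hT1 : ∀ k, 1 ≤ T k := fun k => by
    have := hTN k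
    have h0 : (0 : ℝ) ≤ k := k.cast_nonneg
    linarith
  have hT : Tendsto T atTop atTop :=
    tendsto_atTop_mono hTN (tendsto_atTop_add_const_right _ _ tendsto_natCast_atTop_atTop)
  have hB : Tendsto (fun k => C * Real.exp (-η * T k)) atTop (𝓝 0) := by
    have : Tendsto (fun k => -η * T k) atTop atBot := hT.const_mul_atTop_of_neg (by linarith)
    simpa using (Real.tendsto_exp_atBot.comp this).const_mul C
  have hlow : ∀ k, ∀ s : ℂ, |s.im| = T k → 1 / 2 ≤ s.re → s.re ≤ 3 / 2 →
      Real.exp (-(η * |s.im|)) ≤ ‖riemannZeta s‖ := by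
    intro k s hs hs1 hs2
    rcases abs_choice s.im with hi | hi
    · have := (hTz k s.re ⟨hs1, hs2⟩).1
      rwa [← hs, hi, Complex.re_add_im, ← hi] at this
    · have := (hTz k s.re ⟨hs1, hs2⟩).2
      rwa [← hs, hi, neg_neg, Complex.re_add_im, ← hi] at this
  have hlim := tendsto_rectIntegral (by norm_num) hT hB (integrable_kernel_left hx h)
    (integrable_kernel_right hFE hx h) fun k => by
      have key : ∀ s : ℂ, |s.im| = T k → s.re ∈ Set.Icc (-(1 / 2)) (3 / 2) →
          ‖kernel x s‖ ≤ C * Real.exp (-η * T k) := fun s hs hre => by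
        rw [← hs]
        refine hb s (by rw [hs]; exact hT1 k) hre.1 hre.2 (fun hle => ?_) fun hge =>
          hlow k s hs hge hre.2
        have := hlow k (1 - s) (by simpa using hs) (by simp; linarith) (by simp; linarith [hre.1])
        simpa using this
      intro y hy
      have hTk := abs_of_nonneg (zero_le_one.trans (hT1 k))
      exact ⟨key _ (by rw [vertical_im, hTk]) (by rw [vertical_re]; exact hy),
        key _ (by rw [vertical_im, abs_neg, hTk]) (by rw [vertical_re]; exact hy)⟩
  -- One of ρ and 1 - ρ has real part at least 1/2, where ζ is bounded below at height T k; so no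
  -- zero lies on the contour.
  have hne : ∀ k, ∀ ρ ∈ nontrivialZeros, |ρ.im| ≠ T k := by
    have key : ∀ k, ∀ ρ ∈ nontrivialZeros, |ρ.im| = T k → ¬ 1 / 2 ≤ ρ.re := by
      intro k ρ hρ him hge
      have := hlow k ρ him hge (by linarith [hρ.2.2])
      rw [hρ.1, norm_zero] at this
      exact (Real.exp_pos _).not_ge this
    intro k ρ hρ him
    have k1 := key k ρ hρ him
    have k2 := key k (1 - ρ) (nontrivialZeros_one_sub hρ) (by simpa using him)
    simp only [Complex.sub_re, Complex.one_re] at k2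
    linarith
  have hres : ∀ k, rectIntegral (kernel x) (-(1 / 2)) (3 / 2) (-T k) (T k) =
      2 * Real.pi * Complex.I * zeroPartialSum x (T k) := fun k =>
    rectIntegral_kernel hsimple hx (by linarith [hT1 k]) (hne k)
  simp_rw [hres] at hlim
  obtain ⟨S, hS⟩ := hconv
  have huniq := tendsto_nhds_unique hlim ((hS.comp hT).const_mul (2 * Real.pi * Complex.I))
  rw [zeroSeries, hS.limUnder_eq, four_mul_mobiusSeries hx h, four_mul_mobiusSeries h1 h2]
  rw [integral_kernel_right hFE hx h, ← mul_sub, mul_comm (2 * (Real.pi : ℂ)) Complex.I,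
    mul_assoc] at huniq
  have h3 := mul_left_cancel₀ Complex.I_ne_zero huniq
  have hpi : (2 * (Real.pi : ℂ)) ≠ 0 :=
    mul_ne_zero two_ne_zero (Complex.ofReal_ne_zero.2 Real.pi_ne_zero)
  rw [← mul_right_inj' hpi, ← h3, mul_sub]
  congr 1
  · rw [mul_left_comm, one_div (2 * (Real.pi : ℂ)), mul_inv_cancel_left₀ hpi]
  · rw [one_div (2 * (Real.pi : ℂ)), mul_inv_cancel_left₀ hpi]

/-- Substituting the value of the zero sum gives U(x) = (M(x) + M(1/x)/√x)/2, where M is four times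
the series over n, and multiplication by √x interchanges the roles of x and 1/x. -/
theorem thetaRelation (hsimple : ∀ ρ ∈ nontrivialZeros, deriv riemannZeta ρ ≠ 0)
    (hFE : FunctionalEquation) : ThetaRelation := by
  intro x hx h hc hc'
  obtain ⟨h1, h2⟩ := one_div_ne_zero_and_arg hx h
  have e1 := zeroSeries_eq hsimple hFE hx h hc
  have e2 := zeroSeries_eq hsimple hFE h1 h2 hc'
  have hs := csqrt_ne_zero hx
  rw [csqrt_one_div h, inv_inv, one_div_one_div] at e2
  rw [U, U, e1, e2]
  field_simp
  ring

end ZetaInvSq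

theorem mainTheorem9
    (hsimple : ∀ ρ ∈ ZetaInvSq.nontrivialZeros, deriv riemannZeta ρ ≠ 0)
    (hconv : ∀ x : ℝ, 0 < x → ZetaInvSq.ZeroSeriesConverges (x : ℂ)) :
    (∀ x : ℂ, x ≠ 0 → |x.arg| < Real.pi / 2 → ZetaInvSq.MobiusSeriesConverges x) ∧
      (ZetaInvSq.FunctionalEquation ↔ ZetaInvSq.ThetaRelation) :=
  ⟨fun _ hx h => ZetaInvSq.mobiusSeriesConverges hx h,
    fun hFE => ZetaInvSq.thetaRelation hsimple hFE, fun _ => ZetaInvSq.functionalEquation⟩
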